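/- Let $X$ and $Y$ be nonempty Zariski open subsets of smooth irreducible complex algebraic varieties, let $f\colon X\to Y$ be a dominant morphism (that is, $f(X)$ is Zariski dense in $Y$), and let $$X\times_f X:=\{(p,q)\in X\times X : f(p)=f(q)\}.$$ (a) If $f$ is a submersion (that is, its differential $T_pX\to T_{f(p)}Y$ is surjective at every point $p\in X$), then $X\times_f X$ is a complex manifold (a complex submanifold of $X\times X$) and $$\dim (X\times_f X)=2\dim X-\dim Y.$$ (b) If $X\times_f X$ is irreducible, then the general fiber of $f$ is irreducible; that is, there is a Zariski closed subset $Z\subset Y$ with $\dim Z<\dim Y$ such that $f^{-1}(y)$ is irreducible for all $y\in Y\setminus Z$. Here a subset of a variety is called irreducible if its Zariski closure is irreducible. -/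

import Mathlib

open CategoryTheory CategoryTheory.Limits AlgebraicGeometry

noncomputable section

namespace FiberProduct

/-! ### Complex varieties and their points -/

/-- The base scheme `Spec ℂ`. -/
abbrev SpecC : Scheme.{0} := Spec (CommRingCat.of ℂ)

/-- An irreducible complex variety: an integral separated scheme of finite type over `ℂ`. -/
class IsIrreducibleVariety (X : Scheme.{0}) [X.Over SpecC] : Prop where
  isIntegral : IsIntegral X
  isSeparated : IsSeparated (X ↘ SpecC)
  locallyOfFiniteType : LocallyOfFiniteType (X ↘ SpecC)
  quasiCompact : QuasiCompact (X ↘ SpecC)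

/-- A smooth irreducible complex variety. -/
class IsSmoothIrreducibleVariety (X : Scheme.{0}) [X.Over SpecC] : Prop
    extends IsIrreducibleVariety X where
  smooth : Smooth (X ↘ SpecC)

/-- The points of a complex variety in the classical sense: its `ℂ`-valued points. -/
@[ext]
structure CPoint (X : Scheme.{0}) [X.Over SpecC] where
  /-- the morphism `Spec ℂ ⟶ X` -/
  hom : SpecC ⟶ X
  hom_over : hom ≫ X ↘ SpecC = 𝟙 SpecC

/-- The (closed) point of the scheme that underlies a `ℂ`-valued point. -/
def CPoint.pt {X : Scheme.{0}} [X.Over SpecC] (p : CPoint X) : X :=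
  p.hom (IsLocalRing.closedPoint ℂ)

/-- The image of a point under a morphism of complex varieties. -/
def CPoint.map {X Y : Scheme.{0}} [X.Over SpecC] [Y.Over SpecC] (f : X ⟶ Y) [f.IsOver SpecC]
    (p : CPoint X) : CPoint Y where
  hom := p.hom ≫ f
  hom_over := by rw [Category.assoc, comp_over f SpecC, p.hom_over]

/-- A set of classical points is irreducible in the Zariski topology (equivalently, its
Zariski closure is irreducible). -/
def IsZariskiIrreducible {X : Scheme.{0}} [X.Over SpecC] (S : Set (CPoint X)) : Prop :=
  IsIrreducible (CPoint.pt '' S)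

/-- `P` holds for a general point of `Y`: the points where it fails lie in a Zariski closed subset
of dimension smaller than `dim Y`. -/
def HoldsForGeneralPoint (Y : Scheme.{0}) [Y.Over SpecC] (P : CPoint Y → Prop) : Prop :=
  ∃ Z : Set Y, IsClosed Z ∧ topologicalKrullDim Z < topologicalKrullDim Y ∧
    ∀ y : CPoint Y, ¬ P y → y.pt ∈ Z

/-! ### Submersions -/

/-- The inclusion `Spec ℂ ⟶ Spec ℂ[ε]` of the reduced point, given by `ε ↦ 0`. -/
def dualZero : SpecC ⟶ Spec (CommRingCat.of (DualNumber ℂ)) :=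
  Spec.map (CommRingCat.ofHom (TrivSqZeroExt.fstHom ℂ ℂ ℂ).toRingHom)

/-- The Zariski tangent space of `X` at `p`: the morphisms `Spec ℂ[ε] ⟶ X` over `ℂ` that extend
the morphism `p : Spec ℂ ⟶ X`. -/
@[ext]
structure TangentVector {X : Scheme.{0}} [X.Over SpecC] (p : CPoint X) where
  /-- the morphism `Spec ℂ[ε] ⟶ X` -/
  hom : Spec (CommRingCat.of (DualNumber ℂ)) ⟶ X
  hom_over : hom ≫ X ↘ SpecC = Spec.map (CommRingCat.ofHom (algebraMap ℂ (DualNumber ℂ)))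
  base : dualZero ≫ hom = p.hom

/-- The differential of `f` at `p`. -/
def TangentVector.map {X Y : Scheme.{0}} [X.Over SpecC] [Y.Over SpecC] (f : X ⟶ Y)
    [f.IsOver SpecC] {p : CPoint X} (v : TangentVector p) : TangentVector (p.map f) where
  hom := v.hom ≫ f
  hom_over := by rw [Category.assoc, comp_over f SpecC, v.hom_over]
  base := by rw [← Category.assoc, v.base]; rfl

/-- `f` is a submersion: its differential is surjective at every point of `X`. -/
def IsSubmersion {X Y : Scheme.{0}} [X.Over SpecC] [Y.Over SpecC] (f : X ⟶ Y)
    [f.IsOver SpecC] : Prop :=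
  ∀ p : CPoint X, Function.Surjective
    (TangentVector.map f : TangentVector p → TangentVector (p.map f))

/-! ### Complex submanifolds -/

/-- `M ⊆ ℂⁿ` is, near its point `v`, a complex submanifold of dimension `d`: some biholomorphic map
between a neighbourhood of `v` and an open subset of `ℂᵈ × ℂᵉ` carries `M` to `ℂᵈ × {0}`. -/
def IsSubmanifoldAt {n : ℕ} (d : ℕ) (M : Set (Fin n → ℂ)) (v : Fin n → ℂ) : Prop :=
  ∃ (e : ℕ) (Φ : OpenPartialHomeomorph (Fin n → ℂ) ((Fin d → ℂ) × (Fin e → ℂ))),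
    v ∈ Φ.source ∧ DifferentiableOn ℂ Φ Φ.source ∧ DifferentiableOn ℂ Φ.symm Φ.target ∧
      ∀ w ∈ Φ.source, w ∈ M ↔ (Φ w).2 = 0

/-- An affine chart of a complex variety `X`: an affine open subset `Spec A` together with
finitely many generators of the `ℂ`-algebra `A`, that is, with a closed embedding of the affine
open subset into some `ℂⁿ`. -/
structure AffineChart (X : Scheme.{0}) [X.Over SpecC] where
  /-- the coordinate ring -/
  A : Type
  [commRing : CommRing A]
  [algebra : Algebra ℂ A]
  /-- the inclusion into `X` -/
  ι : Spec (CommRingCat.of A) ⟶ X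
  [isOpenImmersion : IsOpenImmersion ι]
  hom_over : ι ≫ X ↘ SpecC = Spec.map (CommRingCat.ofHom (algebraMap ℂ A))
  /-- the dimension of the ambient affine space -/
  n : ℕ
  /-- the coordinate functions -/
  coord : Fin n → A
  adjoin_coord : Algebra.adjoin ℂ (Set.range coord) = ⊤

attribute [instance] AffineChart.commRing AffineChart.algebra AffineChart.isOpenImmersion

/-- The point of `X` given by a `ℂ`-algebra homomorphism from the coordinate ring of a chart. -/
def AffineChart.point {X : Scheme.{0}} [X.Over SpecC] (c : AffineChart X) (α : c.A →ₐ[ℂ] ℂ) :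
    CPoint X where
  hom := Spec.map (CommRingCat.ofHom α.toRingHom) ≫ c.ι
  hom_over := by
    rw [Category.assoc, c.hom_over, ← Spec.map_comp, ← CommRingCat.ofHom_comp, ← Spec.map_id]
    congr 2
    exact α.comp_algebraMap

/-- The coordinates in `ℂⁿ` of the point given by `α`. -/
def AffineChart.coords {X : Scheme.{0}} [X.Over SpecC] (c : AffineChart X) (α : c.A →ₐ[ℂ] ℂ) :
    Fin c.n → ℂ :=
  fun i => α (c.coord i)

/-- The image in `ℂⁿ` of a set of points of `X` under a chart. -/
def AffineChart.image {X : Scheme.{0}} [X.Over SpecC] (c : AffineChart X) (S : Set (CPoint X)) :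
    Set (Fin c.n → ℂ) :=
  c.coords '' {α | c.point α ∈ S}

/-- A set `S` of points of a complex variety `X` is a complex submanifold of dimension `d` (for the
analytic topology): around each of its points it is one in the coordinates of an affine chart.
The coordinates of any two charts are related by regular functions, so the choice of the charts
does not matter. -/
def IsComplexSubmanifold {X : Scheme.{0}} [X.Over SpecC] (d : ℕ) (S : Set (CPoint X)) : Prop :=
  ∀ p ∈ S, ∃ (c : AffineChart X) (α : c.A →ₐ[ℂ] ℂ),
    c.point α = p ∧ IsSubmanifoldAt d (c.image S) (c.coords α)

/-! ### The fiber product and the fibers of a morphism -/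

/-- The product variety `X × X`. -/
def square (X : Scheme.{0}) [X.Over SpecC] : Scheme.{0} :=
  pullback (X ↘ SpecC) (X ↘ SpecC)

/-- The first projection `X × X ⟶ X`. -/
def square.fst (X : Scheme.{0}) [X.Over SpecC] : square X ⟶ X :=
  pullback.fst (X ↘ SpecC) (X ↘ SpecC)

/-- The second projection `X × X ⟶ X`. -/
def square.snd (X : Scheme.{0}) [X.Over SpecC] : square X ⟶ X :=
  pullback.snd (X ↘ SpecC) (X ↘ SpecC)

instance (X : Scheme.{0}) [X.Over SpecC] : (square X).Over SpecC :=
  ⟨square.fst X ≫ X ↘ SpecC⟩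

instance (X : Scheme.{0}) [X.Over SpecC] : (square.fst X).IsOver SpecC := ⟨rfl⟩

instance (X : Scheme.{0}) [X.Over SpecC] : (square.snd X).IsOver SpecC :=
  ⟨pullback.condition.symm⟩

/-- The fiber product `X ×_f X`, as the set of the points `(p, q)` of `X × X` with
`f p = f q`. -/
def fiberSquare {X Y : Scheme.{0}} [X.Over SpecC] [Y.Over SpecC] (f : X ⟶ Y) [f.IsOver SpecC] :
    Set (CPoint (square X)) :=
  {z | (z.map (square.fst X)).map f = (z.map (square.snd X)).map f}

/-- The fiber of `f` over a point `y`. -/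
def fiber {X Y : Scheme.{0}} [X.Over SpecC] [Y.Over SpecC] (f : X ⟶ Y) [f.IsOver SpecC]
    (y : CPoint Y) : Set (CPoint X) :=
  {p | p.map f = y}

end FiberProduct

end

/-! Part (a) is the implicit function theorem. Near the two components of a point of the fiber
square, and near their common image in `Y`, choose affine patches with submersive presentations:
each patch is the zero set in affine space of polynomials whose Jacobian has an invertible minor,
and the coordinates outside that minor (`Free`) are local coordinates of the variety. In the product
of the two affine spaces upstairs, the fiber square is cut out locally by both sets of relations and
by the equality of the free coordinates of the two images in `Y`. These equations have independent
differentials because `f` is a submersion (`isSubmanifoldAt_fiberProduct`). Counting them gives `2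
dim X - dim Y`, since the dimension of a presentation of a domain is its Krull dimension.

Part (b) is algebra on patches `Spec B → Spec A` with `A` normal, which holds because `Y` is smooth.
By the Nullstellensatz, irreducibility of the fiber square makes zero divisors in `B_g ⊗[A] B_g`
nilpotent (`isNilpotent_or_isNilpotent`). This forces `K = Frac A` to be algebraically closed in `L
= Frac B`: if `β` is algebraic over `K`, then `β ⊗ 1` and `1 ⊗ β` are roots of the same separable
polynomial, and they must coincide (`mem_range_of_isIntegral_fractionRing`).

After inverting an element of `A`, the ring `B` is finite over `R = A[x₁, …, x_r]` and `L = Frac R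
(α)` for some `α` in `B`. The minimal polynomial of `α` stays irreducible over every finite
extension of `K`, so by elimination theory its specialization at a general `y` is irreducible over
`ℂ[x₁, …, x_r]` (`exists_forall_irreducible_minpoly_map`). Hence a single prime of `B` lies over the
kernel of `R → ℂ[x₁, …, x_r]`, and by going down it is contained in the maximal ideal of every point
of the fiber, which is therefore irreducible. Finally the fibers on finitely many patches of `X` are
glued: a general fiber also meets the overlap of any two of them
(`holdsForGeneralPoint_isZariskiIrreducible_fiber`). -/

/-! ### Dimension and normality of smooth algebras over a field. -/

theorem ringKrullDim_eq_of_isIntegral_of_injective {R S : Type*} [CommRing R] [CommRing S]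
    [Algebra R S] [Algebra.IsIntegral R S] (h : Function.Injective (algebraMap R S)) :
    ringKrullDim R = ringKrullDim S := by
  apply le_antisymm
  · refine iSup_le fun l => ?_
    have := (faithfulSMul_iff_algebraMap_injective _ _).mpr h
    obtain ⟨P, -, _, hP⟩ := Ideal.exists_ideal_over_prime_of_isIntegral
      l.head.asIdeal (⊥ : Ideal S) (by simp [← RingHom.ker_eq_comap_bot])
    have : P.LiesOver l.head.asIdeal := ⟨hP.symm⟩
    obtain ⟨L, hL, -⟩ := Ideal.exists_ltSeries_of_hasGoingUp l P
    rw [← hL]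
    exact le_iSup (fun l : LTSeries (PrimeSpectrum S) => (l.length : WithBot ℕ∞)) L
  · exact Order.krullDim_le_of_strictMono (PrimeSpectrum.comap (algebraMap R S))
      fun p q hpq => Ideal.IsIntegral.comap_lt_comap hpq

/-- By Noether normalization `A` is integral over a polynomial ring in `s` variables; neither
invariant changes in an injective integral extension, so both equal `s`. -/
theorem exists_ringKrullDim_eq_trdeg (k A : Type) [Field k] [CommRing A] [IsDomain A]
    [Algebra k A] [Algebra.FiniteType k A] :
    ∃ n : ℕ, ringKrullDim A = n ∧ Algebra.trdeg k A = n := by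
  obtain ⟨s, g, hg, hint⟩ := exists_integral_inj_algHom_of_fg k A
  algebraize [g.toRingHom]
  have : Algebra.IsIntegral (MvPolynomial (Fin s) k) A := ⟨hint⟩
  have hinj : Function.Injective (algebraMap (MvPolynomial (Fin s) k) A) := hg
  have := (faithfulSMul_iff_algebraMap_injective _ _).mpr hinj
  have : IsScalarTower k (MvPolynomial (Fin s) k) A := .of_algebraMap_eq' g.comp_algebraMap.symm
  refine ⟨s, ?_, ?_⟩
  · rw [← ringKrullDim_eq_of_isIntegral_of_injective hinj,
      MvPolynomial.ringKrullDim_of_isNoetherianRing, ringKrullDim_eq_zero_of_field]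
    simp
  · have h := trdeg_add_eq k (MvPolynomial (Fin s) k) (A := A)
    rw [trdeg_eq_zero (A := A), add_zero] at h
    rw [← h, MvPolynomial.trdeg_of_isDomain]
    simp

/-- Over `Frac R` an étale algebra is finite, hence algebraic, and `S` embeds into its base change
because it is flat over `R`. -/
theorem isAlgebraic_of_etale (R S : Type) [CommRing R] [CommRing S] [IsDomain R] [IsDomain S]
    [Algebra R S] [Algebra.Etale R S] : Algebra.IsAlgebraic R S := by
  have := Algebra.FormallyUnramified.finite_of_free (FractionRing R) (TensorProduct R (FractionRing R) S)
  refine ⟨fun x => ?_⟩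
  have h : IsAlgebraic (FractionRing R)
    ((1 : FractionRing R) ⊗ₜ[R] x : TensorProduct R (FractionRing R) S) :=
      Algebra.IsAlgebraic.isAlgebraic _
  rw [← IsFractionRing.isAlgebraic_iff R] at h
  exact (isAlgebraic_algHom_iff (Algebra.TensorProduct.includeRight :
    S →ₐ[R] TensorProduct R (FractionRing R) S)
    (Algebra.TensorProduct.includeRight_injective (IsFractionRing.injective R _))).mp h

theorem algebraMap_injective_of_flat (R S : Type) [CommRing R] [CommRing S] [IsDomain R]
    [Nontrivial S] [Algebra R S] [Module.Flat R S] : Function.Injective (algebraMap R S) := by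
  rw [injective_iff_map_eq_zero]
  intro a ha
  by_contra h0
  have : (a : R) • (1 : S) = a • (0 : S) := by rw [Algebra.smul_def, ha]; simp
  exact one_ne_zero (Module.Flat.isSMulRegular_of_nonZeroDivisors (mem_nonZeroDivisors_of_ne_zero h0) this)

/-- Such an algebra is étale over affine `n`-space, hence an injective algebraic extension of the
polynomial ring, so its transcendence degree is `n`. -/
theorem ringKrullDim_of_isStandardSmoothOfRelativeDimension (k A : Type) [Field k] [CommRing A]
    [IsDomain A] [Algebra k A] (n : ℕ) [Algebra.IsStandardSmoothOfRelativeDimension n k A] :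
    ringKrullDim A = n := by
  obtain ⟨g, hg⟩ :=
    Algebra.IsStandardSmoothOfRelativeDimension.exists_etale_mvPolynomial n k A
  have := Algebra.IsStandardSmoothOfRelativeDimension.isStandardSmooth n (R := k) (S := A)
  obtain ⟨m, hm, hm'⟩ := exists_ringKrullDim_eq_trdeg k A
  algebraize [g.toRingHom]
  have : IsScalarTower k (MvPolynomial (Fin n) k) A := .of_algebraMap_eq' g.comp_algebraMap.symm
  have : Algebra.Etale (MvPolynomial (Fin n) k) A := hg
  have := isAlgebraic_of_etale (MvPolynomial (Fin n) k) A
  have := (faithfulSMul_iff_algebraMap_injective _ _).mpr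
    (algebraMap_injective_of_flat (MvPolynomial (Fin n) k) A)
  have h := trdeg_add_eq k (MvPolynomial (Fin n) k) (A := A)
  rw [trdeg_eq_zero (A := A), add_zero, hm', MvPolynomial.trdeg_of_isDomain] at h
  rw [hm]
  simp at h
  rw [h]

/-- With `T = S ⊗[R] Frac R`, two facts combine: `S` is integrally closed in `T`, and `T` is the
fraction field of `S`. -/
theorem isIntegrallyClosed_of_etale (R S : Type) [CommRing R] [CommRing S] [IsDomain R]
    [IsDomain S] [Algebra R S] [Algebra.Etale R S] [IsIntegrallyClosed R] :
    IsIntegrallyClosed S := by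
  let K := FractionRing R
  let T := TensorProduct R S K
  have hinj := algebraMap_injective_of_flat R S
  have hST : Function.Injective (algebraMap S T) :=
    Algebra.TensorProduct.includeLeft_injective (S := R) (IsFractionRing.injective R K)
  have : IsLocalization (Algebra.algebraMapSubmonoid S (nonZeroDivisors R)) T := inferInstance
  have hle : Algebra.algebraMapSubmonoid S (nonZeroDivisors R) ≤ nonZeroDivisors S := by
    rintro _ ⟨r, hr, rfl⟩
    exact mem_nonZeroDivisors_of_ne_zero (by simpa using (map_ne_zero_iff _ hinj).mpr (nonZeroDivisors.ne_zero hr))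
  have : IsDomain T := IsLocalization.isDomain_of_le_nonZeroDivisors _ hle
  -- Integral closure commutes with smooth base change, and `R` is its own closure in `K`, so the
  -- closure of `S` in `T` comes from `S ⊗ R = S`.
  have hbij := TensorProduct.toIntegralClosure_bijective_of_smooth (R := R) (S := S) (B := K)
  have : IsIntegrallyClosedIn S T := by
    rw [isIntegrallyClosedIn_iff]
    refine ⟨hST, fun {x} hx => ?_⟩
    obtain ⟨y, hy⟩ := hbij.2 ⟨x, hx⟩
    have hy' : x = (TensorProduct.toIntegralClosure R S K y).1 := by rw [hy]
    rw [hy']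
    clear hy hy'
    induction y with
    | zero => exact ⟨0, by simp⟩
    | tmul s b =>
      obtain ⟨r, hr⟩ := IsIntegrallyClosed.isIntegral_iff.mp b.2
      refine ⟨s * algebraMap R S r, ?_⟩
      have : (TensorProduct.toIntegralClosure R S K (s ⊗ₜ[R] b)).1 = s ⊗ₜ[R] b.1 := rfl
      rw [this, ← hr]
      rw [Algebra.TensorProduct.algebraMap_apply, Algebra.algebraMap_eq_smul_one (A := K),
        TensorProduct.tmul_smul, TensorProduct.smul_tmul', Algebra.smul_def, mul_comm]
      rfl
    | add a b ha hb =>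
      obtain ⟨a', ha⟩ := ha
      obtain ⟨b', hb⟩ := hb
      exact ⟨a' + b', by simp [ha, hb]⟩
  have e := Algebra.TensorProduct.comm R S K
  have : IsDomain (TensorProduct R K S) := e.symm.toMulEquiv.isDomain T
  have := Algebra.FormallyUnramified.finite_of_free K (TensorProduct R K S)
  -- A domain that is finite over the field `K` is a field.
  have hT : IsField T := e.toMulEquiv.isField
    (isField_of_isIntegral_of_isField' (R := K) (Field.toIsField K))
  let : Field T := hT.toField
  have : FaithfulSMul S T := (faithfulSMul_iff_algebraMap_injective S T).mpr hST
  have : IsFractionRing S T := by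
    refine IsFractionRing.of_field S T fun z => ?_
    obtain ⟨⟨x, y⟩, h⟩ := IsLocalization.surj (Algebra.algebraMapSubmonoid S (nonZeroDivisors R)) z
    refine ⟨x, y, ?_⟩
    rw [eq_div_iff, ← h]
    exact (map_ne_zero_iff _ hST).mpr (nonZeroDivisors.ne_zero (hle y.2))
  exact (isIntegrallyClosed_iff_isIntegrallyClosedIn T).mpr ‹_›

theorem isIntegrallyClosed_of_isStandardSmooth (k A : Type) [Field k] [CommRing A]
    [IsDomain A] [Algebra k A] [Algebra.IsStandardSmooth k A] : IsIntegrallyClosed A := by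
  obtain ⟨n, g, -, hg⟩ := RingHom.IsStandardSmooth.exists_etale_mvPolynomial
    (f := algebraMap k A) (RingHom.isStandardSmooth_algebraMap.mpr ‹_›)
  algebraize [g]
  exact isIntegrallyClosed_of_etale (MvPolynomial (Fin n) k) A

/-! ### Affine patches without chosen coordinates, their complex points, and their products. -/

noncomputable section

namespace FiberProduct

/-- An affine open subscheme of a scheme over `ℂ`. -/
structure AffinePatch (X : Scheme.{0}) [X.Over SpecC] where
  /-- the coordinate ring -/
  A : Type
  [commRing : CommRing A]
  [algebra : Algebra ℂ A]
  /-- the inclusion -/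
  ι : Spec (CommRingCat.of A) ⟶ X
  [isOpenImmersion : IsOpenImmersion ι]
  hom_over : ι ≫ X ↘ SpecC = Spec.map (CommRingCat.ofHom (algebraMap ℂ A))

attribute [instance] AffinePatch.commRing AffinePatch.algebra AffinePatch.isOpenImmersion

theorem CPoint.square_ext {X : Scheme.{0}} [X.Over SpecC] {z w : CPoint (square X)}
    (h1 : z.map (square.fst X) = w.map (square.fst X))
    (h2 : z.map (square.snd X) = w.map (square.snd X)) : z = w :=
  CPoint.ext (pullback.hom_ext (congrArg CPoint.hom h1) (congrArg CPoint.hom h2))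

namespace AffinePatch

variable {X Y : Scheme.{0}} [X.Over SpecC] [Y.Over SpecC]

theorem exists_mem (U : X.Opens) (x : X) (hx : x ∈ U) :
    ∃ c : AffinePatch X, x ∈ Set.range c.ι ∧ Set.range c.ι ⊆ U := by
  obtain ⟨_, ⟨V, hV, rfl⟩, hxV, hVU⟩ := X.isBasis_affineOpens.exists_subset_of_mem_open hx U.2
  let φ := Spec.preimage (hV.fromSpec ≫ X ↘ SpecC)
  let : Algebra ℂ Γ(X, V) := φ.hom.toAlgebra
  have := hV.isOpenImmersion_fromSpec
  refine ⟨⟨Γ(X, V), hV.fromSpec, ?_⟩, ?_, ?_⟩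
  · exact (Spec.map_preimage (hV.fromSpec ≫ X ↘ SpecC)).symm
  · rw [hV.range_fromSpec]; exact hxV
  · rw [hV.range_fromSpec]; exact hVU

/-- The complement of the zero locus of `g`. -/
def basicOpen (c : AffinePatch X) (g : c.A) : AffinePatch X where
  A := Localization.Away g
  ι := Spec.map (CommRingCat.ofHom (algebraMap c.A (Localization.Away g))) ≫ c.ι
  isOpenImmersion := by
    have : IsOpenImmersion (Spec.map (CommRingCat.ofHom (algebraMap c.A (Localization.Away g)))) :=
      IsOpenImmersion.of_isLocalization g
    infer_instance
  hom_over := by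
    rw [Category.assoc, c.hom_over, ← Spec.map_comp, ← CommRingCat.ofHom_comp,
      ← IsScalarTower.algebraMap_eq]

theorem range_basicOpen_subset (c : AffinePatch X) (g : c.A) :
    Set.range (c.basicOpen g).ι ⊆ Set.range c.ι := by
  rintro _ ⟨x, rfl⟩
  exact ⟨_, rfl⟩

theorem mem_range_basicOpen (c : AffinePatch X) (g : c.A) (p : PrimeSpectrum c.A) :
    c.ι p ∈ Set.range (c.basicOpen g).ι ↔ g ∉ p.asIdeal := by
  have h : p ∈ Set.range (PrimeSpectrum.comap (algebraMap c.A (Localization.Away g))) ↔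
      g ∉ p.asIdeal := by
    rw [PrimeSpectrum.localization_away_comap_range (Localization.Away g) g]; rfl
  rw [← h]
  constructor
  · rintro ⟨x, hx⟩
    exact ⟨x, c.ι.isOpenEmbedding.injective hx⟩
  · rintro ⟨x, rfl⟩
    exact ⟨x, rfl⟩

theorem smooth [Smooth (X ↘ SpecC)] (c : AffinePatch X) : Algebra.Smooth ℂ c.A := by
  have : Smooth (Spec.map (CommRingCat.ofHom (algebraMap ℂ c.A))) := by
    rw [← c.hom_over]; infer_instance
  exact RingHom.smooth_algebraMap.mp ((HasRingHomProperty.Spec_iff (P := @Smooth)).mp this)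

theorem finiteType [LocallyOfFiniteType (X ↘ SpecC)] (c : AffinePatch X) :
    Algebra.FiniteType ℂ c.A := by
  have : LocallyOfFiniteType (Spec.map (CommRingCat.ofHom (algebraMap ℂ c.A))) := by
    rw [← c.hom_over]; infer_instance
  exact RingHom.finiteType_algebraMap.mp
    ((HasRingHomProperty.Spec_iff (P := @LocallyOfFiniteType)).mp this)

theorem exists_mem_isStandardSmooth [Smooth (X ↘ SpecC)] (U : X.Opens) (x : X) (hx : x ∈ U) :
    ∃ c : AffinePatch X, x ∈ Set.range c.ι ∧ Set.range c.ι ⊆ U ∧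
      Algebra.IsStandardSmooth ℂ c.A := by
  obtain ⟨c, ⟨p, rfl⟩, hc⟩ := exists_mem U x hx
  have := c.smooth
  let p : PrimeSpectrum c.A := p
  obtain ⟨g, hg, hs⟩ := Algebra.IsSmoothAt.exists_notMem_isStandardSmooth ℂ (S := c.A) p.asIdeal
  exact ⟨c.basicOpen g, (c.mem_range_basicOpen g p).mpr hg,
    (c.range_basicOpen_subset g).trans hc, hs⟩

theorem isDomain [IsIntegral X] (c : AffinePatch X) (h : (Set.range c.ι).Nonempty) :
    IsDomain c.A := by
  have : Nonempty (Spec (CommRingCat.of c.A)) := Set.range_nonempty_iff_nonempty.mp h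
  have := isIntegral_of_isOpenImmersion c.ι
  exact affine_isIntegral_iff (CommRingCat.of c.A) |>.mp this

/-- The `ℂ`-valued point of `X` given by an algebra homomorphism. -/
def point (c : AffinePatch X) (α : c.A →ₐ[ℂ] ℂ) : CPoint X where
  hom := Spec.map (CommRingCat.ofHom α.toRingHom) ≫ c.ι
  hom_over := by
    rw [Category.assoc, c.hom_over, ← Spec.map_comp, ← CommRingCat.ofHom_comp, ← Spec.map_id]
    congr 2
    exact α.comp_algebraMap

theorem point_injective (c : AffinePatch X) : Function.Injective c.point := by
  intro α β h
  have h := congrArg CPoint.hom h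
  simp only [point, cancel_mono] at h
  have h := congrArg CommRingCat.Hom.hom (Spec.map_injective h)
  exact AlgHom.ext fun x => congr($h x)

theorem point_pt (c : AffinePatch X) (α : c.A →ₐ[ℂ] ℂ) :
    (c.point α).pt = c.ι (⟨RingHom.ker α.toRingHom, RingHom.ker_isPrime _⟩ : PrimeSpectrum c.A) := by
  have : PrimeSpectrum.comap α.toRingHom (IsLocalRing.closedPoint ℂ) =
      ⟨RingHom.ker α.toRingHom, RingHom.ker_isPrime _⟩ := by
    ext x
    simp [IsLocalRing.closedPoint]
  rw [← this]
  rfl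

theorem point_pt_mem_range (c : AffinePatch X) (α : c.A →ₐ[ℂ] ℂ) :
    (c.point α).pt ∈ Set.range c.ι := by
  rw [point_pt]; exact ⟨_, rfl⟩

/-- A morphism `Spec B ⟶ X` over `ℂ` into an affine patch is given by an algebra homomorphism. -/
theorem exists_algHom_of_range_subset (c : AffinePatch X) {B : Type} [CommRing B] [Algebra ℂ B]
    (h : Spec (CommRingCat.of B) ⟶ X)
    (hh : h ≫ X ↘ SpecC = Spec.map (CommRingCat.ofHom (algebraMap ℂ B)))
    (hr : Set.range h ⊆ Set.range c.ι) :
    ∃ φ : c.A →ₐ[ℂ] B, h = Spec.map (CommRingCat.ofHom φ.toRingHom) ≫ c.ι := by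
  let ψ := Spec.preimage (IsOpenImmersion.lift c.ι h hr)
  have hψ : Spec.map ψ ≫ c.ι = h := by
    rw [Spec.map_preimage, IsOpenImmersion.lift_fac]
  have hc : CommRingCat.ofHom (algebraMap ℂ c.A) ≫ ψ = CommRingCat.ofHom (algebraMap ℂ B) := by
    apply Spec.map_injective
    rw [Spec.map_comp, ← c.hom_over, ← Category.assoc, hψ, hh]
  refine ⟨⟨ψ.hom, fun r => ?_⟩, hψ.symm⟩
  exact congr(($hc).hom r)

theorem exists_point_eq (c : AffinePatch X) (p : CPoint X) (hp : p.pt ∈ Set.range c.ι) :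
    ∃ α, c.point α = p := by
  obtain ⟨φ, hφ⟩ := c.exists_algHom_of_range_subset p.hom (by
      rw [p.hom_over]
      exact (Spec.map_id _).symm) (by
    rintro _ ⟨x, rfl⟩
    convert! hp
    exact congrArg _ (Subsingleton.elim (α := PrimeSpectrum ℂ) _ _))
  exact ⟨φ, CPoint.ext hφ.symm⟩

theorem exists_map_eq (f : X ⟶ Y) [f.IsOver SpecC] (c : AffinePatch X) (e : AffinePatch Y)
    (h : Set.range c.ι ⊆ f ⁻¹' Set.range e.ι) :
    ∃ φ : e.A →ₐ[ℂ] c.A, c.ι ≫ f = Spec.map (CommRingCat.ofHom φ.toRingHom) ≫ e.ι := by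
  apply e.exists_algHom_of_range_subset
  · rw [Category.assoc, comp_over f SpecC, c.hom_over]
  · rintro _ ⟨x, rfl⟩
    exact h ⟨x, rfl⟩

theorem point_map (f : X ⟶ Y) [f.IsOver SpecC] (c : AffinePatch X) (e : AffinePatch Y)
    (φ : e.A →ₐ[ℂ] c.A) (h : c.ι ≫ f = Spec.map (CommRingCat.ofHom φ.toRingHom) ≫ e.ι)
    (α : c.A →ₐ[ℂ] ℂ) : (c.point α).map f = e.point (α.comp φ) := by
  apply CPoint.ext
  simp only [CPoint.map, point, Category.assoc, h]
  rw [← Category.assoc, ← Spec.map_comp]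
  rfl

/-- The inclusion of the product of two affine patches. -/
def prodι (c c' : AffinePatch X) :
    Spec (CommRingCat.of (TensorProduct ℂ c.A c'.A)) ⟶ pullback (X ↘ SpecC) (X ↘ SpecC) :=
  (pullbackSpecIso ℂ c.A c'.A).inv ≫ pullback.map _ _ _ _ c.ι c'.ι (𝟙 _)
    (by rw [c.hom_over, Category.comp_id]) (by rw [c'.hom_over, Category.comp_id])

theorem prodι_fst (c c' : AffinePatch X) : c.prodι c' ≫ pullback.fst _ _ =
    Spec.map (CommRingCat.ofHom (Algebra.TensorProduct.includeLeft :
      c.A →ₐ[ℂ] TensorProduct ℂ c.A c'.A).toRingHom) ≫ c.ι := by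
  rw [prodι, Category.assoc, pullback.map, pullback.lift_fst, ← Category.assoc,
    pullbackSpecIso_inv_fst]
  rfl

theorem prodι_snd (c c' : AffinePatch X) : c.prodι c' ≫ pullback.snd _ _ =
    Spec.map (CommRingCat.ofHom (Algebra.TensorProduct.includeRight :
      c'.A →ₐ[ℂ] TensorProduct ℂ c.A c'.A).toRingHom) ≫ c'.ι := by
  rw [prodι, Category.assoc, pullback.map, pullback.lift_snd, ← Category.assoc,
    pullbackSpecIso_inv_snd]
  rfl

instance (c c' : AffinePatch X) : IsOpenImmersion (c.prodι c') := by
  unfold prodι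
  infer_instance

/-- The product of two affine patches. -/
def prod (c c' : AffinePatch X) : AffinePatch (square X) where
  A := TensorProduct ℂ c.A c'.A
  ι := c.prodι c'
  isOpenImmersion := inferInstanceAs (IsOpenImmersion (c.prodι c'))
  hom_over := by
    change c.prodι c' ≫ pullback.fst _ _ ≫ X ↘ SpecC = _
    rw [← Category.assoc, prodι_fst, Category.assoc, c.hom_over, ← Spec.map_comp,
      ← CommRingCat.ofHom_comp]
    rfl

/-- The pullback of functions along the first projection. -/
def inl (c c' : AffinePatch X) : c.A →ₐ[ℂ] (c.prod c').A :=
  (Algebra.TensorProduct.includeLeft : c.A →ₐ[ℂ] TensorProduct ℂ c.A c'.A)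

/-- The pullback of functions along the second projection. -/
def inr (c c' : AffinePatch X) : c'.A →ₐ[ℂ] (c.prod c').A :=
  (Algebra.TensorProduct.includeRight : c'.A →ₐ[ℂ] TensorProduct ℂ c.A c'.A)

/-- The pair of two algebra homomorphisms. -/
def pair (c c' : AffinePatch X) (α : c.A →ₐ[ℂ] ℂ) (β : c'.A →ₐ[ℂ] ℂ) : (c.prod c').A →ₐ[ℂ] ℂ :=
  (Algebra.TensorProduct.lift α β fun _ _ => .all _ _ : TensorProduct ℂ c.A c'.A →ₐ[ℂ] ℂ)

theorem pair_comp_inl (c c' : AffinePatch X) (α : c.A →ₐ[ℂ] ℂ) (β : c'.A →ₐ[ℂ] ℂ) :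
    (c.pair c' α β).comp (c.inl c') = α :=
  Algebra.TensorProduct.lift_comp_includeLeft _ _ fun _ _ => .all _ _

theorem pair_comp_inr (c c' : AffinePatch X) (α : c.A →ₐ[ℂ] ℂ) (β : c'.A →ₐ[ℂ] ℂ) :
    (c.pair c' α β).comp (c.inr c') = β :=
  Algebra.TensorProduct.lift_comp_includeRight _ _ fun _ _ => .all _ _

theorem prod_point_fst (c c' : AffinePatch X) (α : (c.prod c').A →ₐ[ℂ] ℂ) :
    ((c.prod c').point α).map (square.fst X) = c.point (α.comp (c.inl c')) :=
  point_map _ _ _ _ (prodι_fst c c') _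

theorem prod_point_snd (c c' : AffinePatch X) (α : (c.prod c').A →ₐ[ℂ] ℂ) :
    ((c.prod c').point α).map (square.snd X) = c'.point (α.comp (c.inr c')) :=
  point_map _ _ _ _ (prodι_snd c c') _

/-- The point of the product of two patches with given components. -/
theorem prod_point_pair (c c' : AffinePatch X) (z : CPoint (square X)) (α : c.A →ₐ[ℂ] ℂ)
    (β : c'.A →ₐ[ℂ] ℂ) (h1 : z.map (square.fst X) = c.point α)
    (h2 : z.map (square.snd X) = c'.point β) :
    (c.prod c').point (c.pair c' α β) = z := by
  apply CPoint.square_ext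
  · rw [prod_point_fst, h1, pair_comp_inl]
  · rw [prod_point_snd, h2, pair_comp_inr]

end AffinePatch

end FiberProduct

end

/-! ### Krull dimension of irreducible varieties and of their closed subsets. -/

/-- Both dimensions are transcendence degrees, and `Localization.Away g` is algebraic over `A`. -/
theorem ringKrullDim_localizationAway (k A : Type) [Field k] [CommRing A] [IsDomain A]
    [Algebra k A] [Algebra.FiniteType k A] (g : A) (hg : g ≠ 0) :
    ringKrullDim (Localization.Away g) = ringKrullDim A := by
  have hle : Submonoid.powers g ≤ nonZeroDivisors A := powers_le_nonZeroDivisors_of_noZeroDivisors hg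
  have : IsDomain (Localization.Away g) := IsLocalization.isDomain_of_le_nonZeroDivisors _ hle
  have : Algebra.FiniteType A (Localization.Away g) := IsLocalization.finiteType_of_monoid_fg (Submonoid.powers g) _
  have : Algebra.FiniteType k (Localization.Away g) := .trans ‹_› this
  have : FaithfulSMul A (Localization.Away g) :=
    (faithfulSMul_iff_algebraMap_injective _ _).mpr (IsLocalization.injective _ hle)
  have : Algebra.IsAlgebraic A (Localization.Away g) :=
    IsLocalization.isAlgebraic (Localization.Away g) (Submonoid.powers g)
  obtain ⟨n, hn, hn'⟩ := exists_ringKrullDim_eq_trdeg k A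
  obtain ⟨m, hm, hm'⟩ := exists_ringKrullDim_eq_trdeg k (Localization.Away g)
  have h := trdeg_add_eq k A (A := Localization.Away g)
  rw [trdeg_eq_zero (R := A), add_zero, hn', hm'] at h
  rw [hn, hm]
  simpa using h.symm

namespace FiberProduct

variable {X : Scheme.{0}} [X.Over SpecC]

theorem AffinePatch.topologicalKrullDim_range (c : AffinePatch X) :
    topologicalKrullDim (Set.range c.ι) = ringKrullDim c.A := by
  rw [← PrimeSpectrum.topologicalKrullDim_eq_ringKrullDim]
  exact (IsHomeomorph.topologicalKrullDim_eq _
    c.ι.isOpenEmbedding.isEmbedding.toHomeomorph.isHomeomorph).symm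

/-- The two patches meet because `X` is irreducible, so some basic open subset of `c` lies in `c'`;
it has the dimension of `c`, and a subspace has no larger dimension. -/
theorem AffinePatch.ringKrullDim_le_of_nonempty [IsIntegral X] [LocallyOfFiniteType (X ↘ SpecC)]
    (c c' : AffinePatch X) (h : (Set.range c.ι).Nonempty) (h' : (Set.range c'.ι).Nonempty) :
    ringKrullDim c.A ≤ ringKrullDim c'.A := by
  have hd := c.isDomain h
  have := c.finiteType
  obtain ⟨_, ⟨p, rfl⟩, hp⟩ := nonempty_preirreducible_inter c.ι.isOpenEmbedding.isOpen_range
    c'.ι.isOpenEmbedding.isOpen_range h h'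
  have ho : IsOpen ((c.ι : PrimeSpectrum c.A → X) ⁻¹' Set.range c'.ι) :=
    c'.ι.isOpenEmbedding.isOpen_range.preimage c.ι.continuous
  obtain ⟨_, ⟨g, rfl⟩, hpg, hg⟩ :=
    PrimeSpectrum.isTopologicalBasis_basic_opens.exists_subset_of_mem_open
      (show (p : PrimeSpectrum c.A) ∈ _ from hp) ho
  have hg0 : g ≠ 0 := by
    rintro rfl
    exact hpg (Ideal.zero_mem _)
  rw [← ringKrullDim_localizationAway ℂ c.A g hg0]
  have hsub : Set.range (c.basicOpen g).ι ⊆ Set.range c'.ι := by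
    rintro x hx
    obtain ⟨q, rfl⟩ := c.range_basicOpen_subset g hx
    exact hg ((c.mem_range_basicOpen g q).mp hx)
  rw [← c'.topologicalKrullDim_range]
  refine (c.basicOpen g).topologicalKrullDim_range.symm.le.trans ?_
  exact (Topology.IsEmbedding.inclusion hsub).isInducing.topologicalKrullDim_le

theorem exists_topologicalKrullDim_eq [IsIntegral X] [LocallyOfFiniteType (X ↘ SpecC)] :
    ∃ m : ℕ, topologicalKrullDim X = m ∧
      ∀ c : AffinePatch X, (Set.range c.ι).Nonempty → ringKrullDim c.A = m := by
  obtain ⟨x⟩ : Nonempty X := inferInstance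
  obtain ⟨c, hx, -⟩ := AffinePatch.exists_mem ⊤ x trivial
  have := c.isDomain ⟨x, hx⟩
  have := c.finiteType
  obtain ⟨m, hm, -⟩ := exists_ringKrullDim_eq_trdeg ℂ c.A
  have key : ∀ c' : AffinePatch X, (Set.range c'.ι).Nonempty → ringKrullDim c'.A = m := fun c' h =>
    hm ▸ le_antisymm (c'.ringKrullDim_le_of_nonempty c h ⟨x, hx⟩)
      (c.ringKrullDim_le_of_nonempty c' ⟨x, hx⟩ h)
  refine ⟨m, le_antisymm ?_ ?_, key⟩
  · refine iSup_le fun l => ?_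
    -- A point of the smallest member lies in all members of the chain, so the whole chain restricts
    -- to a patch around it without losing length.
    obtain ⟨y, hy⟩ := l.head.isIrreducible.nonempty
    obtain ⟨c', hy', -⟩ := AffinePatch.exists_mem ⊤ y trivial
    rw [← key c' ⟨y, hy'⟩, ← PrimeSpectrum.topologicalKrullDim_eq_ringKrullDim]
    obtain ⟨z, rfl⟩ := hy'
    let e := TopologicalSpace.IrreducibleCloseds.orderIsoOfIsOpenEmbedding _ c'.ι.isOpenEmbedding
    let l' : LTSeries (TopologicalSpace.IrreducibleCloseds (Spec (CommRingCat.of c'.A))) :=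
      { length := l.length
        toFun := fun i => e.symm ⟨l i, z, (l.head_le i : _) hy⟩
        step := fun i => e.symm.strictMono (l.step i) }
    exact le_iSup (fun l : LTSeries (TopologicalSpace.IrreducibleCloseds
      (Spec (CommRingCat.of c'.A))) => (l.length : WithBot ℕ∞)) l'
  · rw [← hm, ← c.topologicalKrullDim_range]
    exact topologicalKrullDim_subspace_le _ _

/-- Any chain of irreducible closed subsets of `Z` can be prolonged in `X` by `X` itself; the
inequality is strict because the dimension is finite. -/
theorem topologicalKrullDim_lt_of_isClosed [IsIntegral X] [LocallyOfFiniteType (X ↘ SpecC)]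
    (Z : Set X) (hZ : IsClosed Z) (hne : Z ≠ Set.univ) :
    topologicalKrullDim Z < topologicalKrullDim X := by
  obtain ⟨m, hm, -⟩ := exists_topologicalKrullDim_eq (X := X)
  rw [hm]
  refine Order.krullDim_lt_coe_iff.mpr fun l => ?_
  let F : TopologicalSpace.IrreducibleCloseds Z → TopologicalSpace.IrreducibleCloseds X :=
    TopologicalSpace.IrreducibleCloseds.map Subtype.val continuous_subtype_val
  have hF : StrictMono F :=
    TopologicalSpace.IrreducibleCloseds.map_strictMono_of_isInducing Topology.IsInducing.subtypeVal
  let T : TopologicalSpace.IrreducibleCloseds X :=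
    ⟨Set.univ, IrreducibleSpace.isIrreducible_univ X, isClosed_univ⟩
  have hlt : (l.map F hF).last < T := by
    refine lt_of_le_of_ne (fun x _ => trivial) fun h => hne ?_
    have h1 : ((l.map F hF).last : Set X) ⊆ Z := by
      rw [LTSeries.last_map]
      exact closure_minimal (by rintro _ ⟨x, -, rfl⟩; exact x.2) hZ
    rw [h] at h1
    exact Set.univ_subset_iff.mp h1
  have := Order.LTSeries.length_le_krullDim ((l.map F hF).snoc T hlt)
  change _ ≤ topologicalKrullDim X at this
  rw [hm] at this
  have h2 : (l.map F hF).length + 1 ≤ m := by exact_mod_cast this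
  exact h2

end FiberProduct

/-! ### The implicit function theorem and differentials of polynomials. -/

noncomputable section

-- `G` is completed to a local coordinate system by a linear map `L` that is an isomorphism on the
-- kernel of `G'`; the inverse function theorem applies to the pair.
open scoped Topology in
theorem FiberProduct.isSubmanifoldAt_of_surjective {N d : ℕ} {ρ : Type} [Fintype ρ]
    (G : (Fin N → ℂ) → (ρ → ℂ)) (hG : ContDiff ℂ 1 G) (v : Fin N → ℂ)
    (G' : (Fin N → ℂ) →L[ℂ] (ρ → ℂ)) (hG' : HasFDerivAt G G' v) (hs : Function.Surjective G')
    (hd : d + Fintype.card ρ = N) (M : Set (Fin N → ℂ)) (hM : ∀ᶠ w in 𝓝 v, w ∈ M ↔ G w = 0) :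
    IsSubmanifoldAt d M v := by
  let ε : (ρ → ℂ) ≃L[ℂ] (Fin (Fintype.card ρ) → ℂ) :=
    ContinuousLinearEquiv.piCongrLeft ℂ (fun _ => ℂ) (Fintype.equivFin ρ)
  obtain ⟨π, hπ⟩ := LinearMap.exists_leftInverse_of_injective
    (LinearMap.ker G'.toLinearMap).subtype (Submodule.ker_subtype _)
  have hK : Module.finrank ℂ (LinearMap.ker G'.toLinearMap) = Module.finrank ℂ (Fin d → ℂ) := by
    have h := G'.toLinearMap.finrank_range_add_finrank_ker
    rw [LinearMap.range_eq_top.mpr hs, finrank_top] at h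
    simp only [Module.finrank_fintype_fun_eq_card, Fintype.card_fin] at h ⊢
    omega
  let κ := LinearEquiv.ofFinrankEq _ _ hK
  let L : (Fin N → ℂ) →L[ℂ] (Fin d → ℂ) := LinearMap.toContinuousLinearMap (κ.toLinearMap ∘ₗ π)
  let D : (Fin N → ℂ) →L[ℂ] (Fin d → ℂ) × (Fin (Fintype.card ρ) → ℂ) :=
    L.prod (ε.toContinuousLinearMap ∘L G')
  have hinj : Function.Injective D := by
    rw [injective_iff_map_eq_zero]
    intro x hx
    have h1 : L x = 0 := congrArg Prod.fst hx
    have h2 : ε (G' x) = 0 := congrArg Prod.snd hx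
    have h2 : G' x = 0 := by simpa using h2
    have h1 : π x = 0 := by simpa [L] using h1
    have h3 := congr($hπ ⟨x, h2⟩)
    simp only [LinearMap.comp_apply, Submodule.subtype_apply, LinearMap.id_apply, h1] at h3
    exact (congrArg Subtype.val h3).symm
  let D' : (Fin N → ℂ) ≃L[ℂ] (Fin d → ℂ) × (Fin (Fintype.card ρ) → ℂ) :=
    (LinearEquiv.ofInjectiveOfFinrankEq D.toLinearMap hinj (by
      simp [hd])).toContinuousLinearEquiv
  let Φ : (Fin N → ℂ) → (Fin d → ℂ) × (Fin (Fintype.card ρ) → ℂ) := fun w => (L w, ε (G w))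
  have hΦ : ContDiff ℂ 1 Φ := L.contDiff.prodMk (ε.contDiff.comp hG)
  have hΦ' : HasFDerivAt Φ (D' : (Fin N → ℂ) →L[ℂ] _) v := by
    have : (D' : (Fin N → ℂ) →L[ℂ] (Fin d → ℂ) × (Fin (Fintype.card ρ) → ℂ)) = D := by
      ext x : 1
      rfl
    rw [this]
    exact L.hasFDerivAt.prodMk (ε.toContinuousLinearMap.hasFDerivAt.comp v hG')
  obtain ⟨s, hs, hso, hvs⟩ := eventually_nhds_iff.mp hM
  let Ψ := ContDiffAt.toOpenPartialHomeomorph Φ hΦ.contDiffAt hΦ' one_ne_zero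
  have hone : (1 : WithTop ℕ∞) ≠ ((⊤ : ℕ∞) : WithTop ℕ∞) := by
    exact_mod_cast (by decide : (1 : ℕ∞) ≠ ⊤)
  have hvΨ : v ∈ Ψ.source := ContDiffAt.mem_toOpenPartialHomeomorph_source _ _ _
  have hsymm : ContDiffAt ℂ 1 Ψ.symm (Ψ v) :=
    ContDiffAt.to_localInverse hΦ.contDiffAt hΦ' one_ne_zero
  -- The domain is shrunk twice: to make the inverse differentiable on the whole target, and to stay
  -- where `M` is the zero set of `G`.
  refine ⟨Fintype.card ρ, (Ψ.restrContDiff ℂ 1 hone).restrOpen s hso, ?_, ?_, ?_, ?_⟩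
  · exact ⟨⟨hvΨ, hΦ.contDiffAt, hsymm⟩, hvs⟩
  · exact hΦ.differentiable one_ne_zero |>.differentiableOn
  · refine ((Ψ.contDiffOn_restrContDiff_target ℂ hone).differentiableOn one_ne_zero).mono ?_
    intro x hx
    exact hx.1
  · intro w hw
    rw [hs w hw.2]
    change G w = 0 ↔ ε (G w) = 0
    simp

theorem exists_mem_nhds_injOn_of_injective_fderiv {ι ρ : Type} [Fintype ι] [Fintype ρ]
    (G : (ι → ℂ) → (ρ → ℂ)) (v : ι → ℂ) (G' : (ι → ℂ) →L[ℂ] (ρ → ℂ))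
    (hG' : HasStrictFDerivAt G G' v) (hinj : Function.Injective G')
    (hcard : Fintype.card ι = Fintype.card ρ) : ∃ s ∈ nhds v, Set.InjOn G s := by
  let D' : (ι → ℂ) ≃L[ℂ] (ρ → ℂ) :=
    (LinearEquiv.ofInjectiveOfFinrankEq G'.toLinearMap hinj (by
      simp [hcard])).toContinuousLinearEquiv
  have h : HasStrictFDerivAt G (D' : (ι → ℂ) →L[ℂ] (ρ → ℂ)) v := by
    have : (D' : (ι → ℂ) →L[ℂ] (ρ → ℂ)) = G' := by ext x : 1; rfl
    rwa [this]
  exact ⟨_, (h.toOpenPartialHomeomorph G).open_source.mem_nhds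
    h.mem_toOpenPartialHomeomorph_source, (h.toOpenPartialHomeomorph G).injOn⟩

namespace MvPolynomial

variable {ι : Type} [Fintype ι]

/-- The differential of a polynomial function at a point. -/
def differential (p : MvPolynomial ι ℂ) (v : ι → ℂ) : (ι → ℂ) →L[ℂ] ℂ :=
  ∑ i, eval v (pderiv i p) • ContinuousLinearMap.proj i

theorem differential_apply (p : MvPolynomial ι ℂ) (v a : ι → ℂ) :
    p.differential v a = ∑ i, eval v (pderiv i p) * a i := by
  simp [differential]

theorem differential_add (p q : MvPolynomial ι ℂ) (v : ι → ℂ) :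
    (p + q).differential v = p.differential v + q.differential v := by
  ext a
  simp [differential_apply, add_mul, Finset.sum_add_distrib]

theorem differential_mul (p q : MvPolynomial ι ℂ) (v : ι → ℂ) :
    (p * q).differential v = eval v p • q.differential v + eval v q • p.differential v := by
  ext a
  simp only [differential_apply, pderiv_mul, map_add, map_mul, add_mul, Finset.sum_add_distrib,
    add_apply, smul_apply, smul_eq_mul, Finset.mul_sum]
  rw [add_comm]
  congr 1 <;> exact Finset.sum_congr rfl fun i _ => by ring

theorem differential_X (i : ι) (v : ι → ℂ) :
    (X i : MvPolynomial ι ℂ).differential v = ContinuousLinearMap.proj i := by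
  classical
  ext a
  simp [differential_apply, pderiv_X, Pi.single_apply, apply_ite]

theorem differential_C (z : ℂ) (v : ι → ℂ) : (C z : MvPolynomial ι ℂ).differential v = 0 := by
  ext a
  simp [differential_apply]

theorem hasStrictFDerivAt_eval (p : MvPolynomial ι ℂ) (v : ι → ℂ) :
    HasStrictFDerivAt (fun w => eval w p) (p.differential v) v := by
  induction p using MvPolynomial.induction_on with
  | C a => simpa [differential_C] using hasStrictFDerivAt_const a v
  | add p q hp hq =>
    rw [differential_add]
    simp only [map_add]
    exact hp.add hq
  | mul_X p i hp =>
    rw [differential_mul, differential_X]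
    simp only [map_mul, eval_X]
    exact hp.mul (ContinuousLinearMap.proj (R := ℂ) (φ := fun _ : ι => ℂ) i).hasStrictFDerivAt

theorem contDiff_eval (p : MvPolynomial ι ℂ) : ContDiff ℂ 1 (fun w => eval w p) := by
  induction p using MvPolynomial.induction_on with
  | C a => simpa using contDiff_const
  | add p q hp hq => simpa using hp.add hq
  | mul_X p i hp => simpa using hp.mul (contDiff_apply ℂ ℂ i)

/-- The first order Taylor expansion of a polynomial. -/
theorem aeval_dualNumber (p : MvPolynomial ι ℂ) (v a : ι → ℂ) :
    aeval (fun i => (TrivSqZeroExt.inl (v i) + TrivSqZeroExt.inr (a i) : DualNumber ℂ)) p =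
      TrivSqZeroExt.inl (eval v p) + TrivSqZeroExt.inr (p.differential v a) := by
  induction p using MvPolynomial.induction_on with
  | C x => simp [differential_C]; rfl
  | add p q hp hq =>
    rw [map_add, hp, hq, differential_add]
    ext <;> simp
  | mul_X p i hp =>
    rw [map_mul, hp, aeval_X, differential_mul, differential_X]
    ext
    · simp
    · simp [mul_comm, add_comm]

end MvPolynomial
end

/-! ### Submersive presentations: points, tangent vectors, Jacobians. -/

noncomputable section

open MvPolynomial Algebra

namespace Algebra.SubmersivePresentation

variable {B ι σ : Type} [CommRing B] [Algebra ℂ B] [Finite σ]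
  (P : SubmersivePresentation ℂ B ι σ)

/-- The relations generate the kernel of the presentation, so a common zero of them in `T` is a
homomorphism out of `B`. With `T = ℂ` this produces points, with `T = ℂ[ε]` tangent vectors. -/
theorem exists_lift {T : Type} [CommRing T] [Algebra ℂ T] (t : ι → T)
    (ht : ∀ j, aeval t (P.relation j) = 0) : ∃ χ : B →ₐ[ℂ] T, ∀ i, χ (P.val i) = t i := by
  have hker : ∀ x ∈ RingHom.ker (aeval P.val : MvPolynomial ι ℂ →ₐ[ℂ] B), aeval t x = 0 := by
    intro x hx
    have h : RingHom.ker (aeval P.val : MvPolynomial ι ℂ →ₐ[ℂ] B) =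
        Ideal.span (Set.range P.relation) := by
      rw [P.span_range_relation_eq_ker, P.ker_eq_ker_aeval_val]
    rw [h] at hx
    have h2 : Ideal.span (Set.range P.relation) ≤ RingHom.ker (aeval t : MvPolynomial ι ℂ →ₐ[ℂ] T) := by
      rw [Ideal.span_le]
      rintro _ ⟨j, rfl⟩
      exact ht j
    exact h2 hx
  have hsurj : Function.Surjective (aeval P.val : MvPolynomial ι ℂ →ₐ[ℂ] B) := fun b =>
    ⟨P.σ b, P.aeval_val_σ b⟩
  refine ⟨AlgHom.liftOfSurjective _ hsurj (aeval t) hker, fun i => ?_⟩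
  have := AlgHom.liftOfSurjective_apply _ hsurj (aeval t) hker (X i)
  simpa using this

theorem aeval_relation_eq_zero {T : Type} [CommRing T] [Algebra ℂ T] (χ : B →ₐ[ℂ] T) (j : σ) :
    aeval (fun i => χ (P.val i)) (P.relation j) = 0 := by
  have h := P.aeval_val_relation j
  have := congrArg χ h
  rwa [map_zero, MvPolynomial.comp_aeval_apply] at this

theorem algHom_ext {T : Type} [CommRing T] [Algebra ℂ T] {χ χ' : B →ₐ[ℂ] T}
    (h : ∀ i, χ (P.val i) = χ' (P.val i)) : χ = χ' := by
  ext b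
  rw [← P.aeval_val_σ b]
  rw [MvPolynomial.comp_aeval_apply, MvPolynomial.comp_aeval_apply]
  congr 2
  exact funext h

/-- The coordinates that are not pivots of the Jacobian matrix. -/
abbrev Free : Type := {i : ι // i ∉ Set.range P.map}

variable [Fintype ι]

theorem card_free_add : Nat.card P.Free + Nat.card σ = Nat.card ι := by
  classical
  rw [← Nat.card_congr (Equiv.sumCompl (fun i => i ∈ Set.range P.map)), Nat.card_sum, add_comm]
  congr 1
  exact Nat.card_congr (Equiv.ofInjective _ P.map_inj)

theorem card_free : Nat.card P.Free = P.dimension := by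
  have := P.card_free_add
  unfold Presentation.dimension
  omega

/-- The differential of the relations together with the free coordinates. -/
def jacobianMap (v : ι → ℂ) : (ι → ℂ) →L[ℂ] (σ ⊕ P.Free → ℂ) :=
  ContinuousLinearMap.pi (Sum.elim (fun j => (P.relation j).differential v)
    (fun i => ContinuousLinearMap.proj i.1))

/-- A vector with vanishing free coordinates is supported on the pivots, where the differentials of
the relations form the Jacobian minor, invertible at every point. -/
theorem jacobianMap_injective (χ : B →ₐ[ℂ] ℂ) :
    Function.Injective (P.jacobianMap fun i => χ (P.val i)) := by
  classical
  cases nonempty_fintype σ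
  let J : Matrix σ σ ℂ := fun k j => eval (fun i => χ (P.val i)) (pderiv (P.map k) (P.relation j))
  have hJ : IsUnit J.det := by
    have h := P.jacobian_isUnit.map χ
    convert! h using 1
    rw [P.jacobian_eq_jacobiMatrix_det, P.algebraMap_eq, AlgHom.coe_toRingHom,
      MvPolynomial.comp_aeval_apply, AlgHom.map_det]
    congr 1
    ext k j
    simp [J, P.jacobiMatrix_apply, aeval_eq_eval]
  rw [injective_iff_map_eq_zero]
  intro a ha
  have hfree : ∀ i : P.Free, a i = 0 := fun i => congrFun ha (Sum.inr i)
  have hrel : ∀ j, (P.relation j).differential (fun i => χ (P.val i)) a = 0 :=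
    fun j => congrFun ha (Sum.inl j)
  have hb : Matrix.vecMul (fun k => a (P.map k)) J = 0 := by
    ext j
    rw [Pi.zero_apply, ← hrel j, differential_apply]
    simp only [Matrix.vecMul, dotProduct]
    refine Finset.sum_of_injOn P.map P.map_inj.injOn (by simp) ?_ ?_
    · intro i _ hi
      rw [hfree ⟨i, by simpa using hi⟩, mul_zero]
    · intro k _
      rw [mul_comm]
  have hb0 := Matrix.eq_zero_of_vecMul_eq_zero hJ.ne_zero hb
  ext i
  by_cases hi : i ∈ Set.range P.map
  · obtain ⟨k, rfl⟩ := hi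
    exact congrFun hb0 k
  · exact hfree ⟨i, hi⟩

theorem jacobianMap_surjective (χ : B →ₐ[ℂ] ℂ) :
    Function.Surjective (P.jacobianMap fun i => χ (P.val i)) := by
  cases nonempty_fintype σ
  classical
  refine (LinearMap.injective_iff_surjective_of_finrank_eq_finrank
    (f := (P.jacobianMap fun i => χ (P.val i)).toLinearMap) ?_).mp (P.jacobianMap_injective χ)
  have := P.card_free_add
  simp only [Nat.card_eq_fintype_card] at this
  simp only [Module.finrank_fintype_fun_eq_card, Fintype.card_sum]
  omega

end Algebra.SubmersivePresentation
end

/-! ### The fiber product as a submanifold in coordinates. -/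

noncomputable section

open MvPolynomial Algebra

namespace Algebra.SubmersivePresentation

theorem hasStrictFDerivAt_jacobianMap {A κ τ : Type} [CommRing A] [Algebra ℂ A] [Fintype κ]
    [Fintype τ] (P : SubmersivePresentation ℂ A κ τ) [Fintype P.Free] (y : κ → ℂ) :
    HasStrictFDerivAt (fun y => (Sum.elim (fun j => eval y (P.relation j)) (fun i => y i.1) :
      τ ⊕ P.Free → ℂ)) (P.jacobianMap y) y := by
  refine hasStrictFDerivAt_pi'.mpr fun r => ?_
  rcases r with j | i
  · exact hasStrictFDerivAt_eval (P.relation j) y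
  · exact (ContinuousLinearMap.proj (R := ℂ) (φ := fun _ : κ => ℂ) i.1).hasStrictFDerivAt

-- Only the free coordinates of the two images in `Spec A` have to be equated. The pivot coordinates
-- then agree automatically near the point, since on the ambient space the relations and the free
-- coordinates together are locally injective. Imposing all coordinates would give dependent
-- equations. The lifting of tangent vectors is needed on one factor only.
open scoped Topology in
theorem isSubmanifoldAt_fiberProduct {A B B' κ ι ι' τ σ σ' : Type} [CommRing A] [CommRing B]
    [CommRing B'] [Algebra ℂ A] [Algebra ℂ B] [Algebra ℂ B'] [Fintype κ] [Fintype ι] [Fintype ι']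
    [Fintype τ] [Fintype σ] [Fintype σ']
    (P : SubmersivePresentation ℂ A κ τ) (Q : SubmersivePresentation ℂ B ι σ)
    (Q' : SubmersivePresentation ℂ B' ι' σ') (φ : A →ₐ[ℂ] B) (φ' : A →ₐ[ℂ] B')
    (χ : B →ₐ[ℂ] ℂ) (χ' : B' →ₐ[ℂ] ℂ) (hχ : χ.comp φ = χ'.comp φ')
    (hT : ∀ t : A →ₐ[ℂ] DualNumber ℂ, (TrivSqZeroExt.fstHom ℂ ℂ ℂ).comp t = χ.comp φ →
      ∃ t' : B →ₐ[ℂ] DualNumber ℂ, (TrivSqZeroExt.fstHom ℂ ℂ ℂ).comp t' = χ ∧ t'.comp φ = t)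
    {n d : ℕ} (e : Fin n ≃ ι ⊕ ι') (hd : d + P.dimension = Q.dimension + Q'.dimension) :
    FiberProduct.IsSubmanifoldAt d
      {w : Fin n → ℂ | ∃ (ψ : B →ₐ[ℂ] ℂ) (ψ' : B' →ₐ[ℂ] ℂ), ψ.comp φ = ψ'.comp φ' ∧
        ∀ k, w k = Sum.elim (fun i => ψ (Q.val i)) (fun i => ψ' (Q'.val i)) (e k)}
      (fun k => Sum.elim (fun i => χ (Q.val i)) (fun i => χ' (Q'.val i)) (e k)) := by
  classical
  let v : ι → ℂ := fun i => χ (Q.val i)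
  let v' : ι' → ℂ := fun i => χ' (Q'.val i)
  let u : Fin n → ℂ := fun k => Sum.elim v v' (e k)
  -- `F` and `F'` are polynomial representatives of the two maps to `Spec A` in coordinates.
  let F : κ → MvPolynomial ι ℂ := fun k => Q.σ (φ (P.val k))
  let F' : κ → MvPolynomial ι' ℂ := fun k => Q'.σ (φ' (P.val k))
  have hF : ∀ {T : Type} [CommRing T] [Algebra ℂ T] (ψ : B →ₐ[ℂ] T) (k : κ),
      aeval (fun i => ψ (Q.val i)) (F k) = ψ (φ (P.val k)) := fun ψ k => by
    rw [← MvPolynomial.comp_aeval_apply, Q.aeval_val_σ]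
  have hF' : ∀ {T : Type} [CommRing T] [Algebra ℂ T] (ψ : B' →ₐ[ℂ] T) (k : κ),
      aeval (fun i => ψ (Q'.val i)) (F' k) = ψ (φ' (P.val k)) := fun ψ k => by
    rw [← MvPolynomial.comp_aeval_apply, Q'.aeval_val_σ]
  let y : κ → ℂ := fun k => χ (φ (P.val k))
  let pr : (Fin n → ℂ) →L[ℂ] (ι → ℂ) :=
    ContinuousLinearMap.pi fun i => ContinuousLinearMap.proj (e.symm (Sum.inl i))
  let pr' : (Fin n → ℂ) →L[ℂ] (ι' → ℂ) :=
    ContinuousLinearMap.pi fun i => ContinuousLinearMap.proj (e.symm (Sum.inr i))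
  have hpru : pr u = v := by ext i; simp [pr, u]
  have hpru' : pr' u = v' := by ext i; simp [pr', u]
  let G : (Fin n → ℂ) → ((σ ⊕ σ') ⊕ P.Free → ℂ) := fun w =>
    Sum.elim (Sum.elim (fun j => eval (pr w) (Q.relation j)) (fun j => eval (pr' w) (Q'.relation j)))
      (fun f => eval (pr w) (F f) - eval (pr' w) (F' f))
  let G' : (Fin n → ℂ) →L[ℂ] ((σ ⊕ σ') ⊕ P.Free → ℂ) := ContinuousLinearMap.pi
    (Sum.elim (Sum.elim (fun j => (Q.relation j).differential v ∘L pr)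
      (fun j => (Q'.relation j).differential v' ∘L pr'))
      (fun f => (F f).differential v ∘L pr - (F' f).differential v' ∘L pr'))
  have hder : ∀ p : MvPolynomial ι ℂ,
      HasFDerivAt (fun w => eval (pr w) p) (p.differential v ∘L pr) u := fun p =>
    HasFDerivAt.comp (g := fun x => eval x p) (g' := p.differential v) u (by rw [hpru]; exact (hasStrictFDerivAt_eval p v).hasFDerivAt)
      pr.hasFDerivAt
  have hder' : ∀ p : MvPolynomial ι' ℂ,
      HasFDerivAt (fun w => eval (pr' w) p) (p.differential v' ∘L pr') u := fun p =>
    HasFDerivAt.comp (g := fun x => eval x p) (g' := p.differential v') u (by rw [hpru']; exact (hasStrictFDerivAt_eval p v').hasFDerivAt)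
      pr'.hasFDerivAt
  have hcd : ∀ p : MvPolynomial ι ℂ, ContDiff ℂ 1 (fun w => eval (pr w) p) := fun p =>
    (contDiff_eval p).comp pr.contDiff
  have hcd' : ∀ p : MvPolynomial ι' ℂ, ContDiff ℂ 1 (fun w => eval (pr' w) p) := fun p =>
    (contDiff_eval p).comp pr'.contDiff
  have hyeq : ∀ k, y k = eval v (F k) := fun k => by
    rw [← aeval_eq_eval]; exact (hF χ k).symm
  have hyeq' : ∀ k, y k = eval v' (F' k) := fun k => by
    rw [← aeval_eq_eval]
    exact (congr($hχ (P.val k))).trans (hF' χ' k).symm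
  refine FiberProduct.isSubmanifoldAt_of_surjective G ?_ u G' ?_ ?_ ?_ _ ?_
  · refine contDiff_pi.mpr ?_
    rintro ((j | j) | f)
    · exact hcd _
    · exact hcd' _
    · exact (hcd _).sub (hcd' _)
  · refine hasFDerivAt_pi'.mpr ?_
    rintro ((j | j) | f)
    · exact hder _
    · exact hder' _
    · exact (hder _).sub (hder' _)
  · intro c
    -- `a` and `a'` realize the prescribed values on the relations. The remaining discrepancy in the
    -- free coordinates of `Spec A` is the free part of a vector `z` tangent to `Spec A`; a lift `b`
    -- of `z` tangent to `Spec B` corrects `a` without disturbing the relations.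
    obtain ⟨a, ha⟩ := Q.jacobianMap_surjective χ (Sum.elim (fun j => c (Sum.inl (Sum.inl j))) 0)
    obtain ⟨a', ha'⟩ := Q'.jacobianMap_surjective χ' (Sum.elim (fun j => c (Sum.inl (Sum.inr j))) 0)
    obtain ⟨z, hz⟩ := P.jacobianMap_surjective (χ.comp φ) (Sum.elim 0 (fun f =>
      c (Sum.inr f) - ((F f).differential v a - (F' f).differential v' a')))
    have hz1 : ∀ j, (P.relation j).differential y z = 0 := fun j => congrFun hz (Sum.inl j)
    -- Since `z` is killed by the differentials of the relations, `y + ε z` is a `ℂ[ε]`-point of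
    -- `Spec A`.
    obtain ⟨t, ht⟩ := P.exists_lift (T := DualNumber ℂ)
      (fun k => TrivSqZeroExt.inl (y k) + TrivSqZeroExt.inr (z k)) (fun j => by
        rw [aeval_dualNumber, hz1, ← aeval_eq_eval]
        have := P.aeval_relation_eq_zero (χ.comp φ) j
        rw [show y = fun k => (χ.comp φ) (P.val k) from rfl, this]
        simp)
    obtain ⟨t', ht', ht''⟩ := hT t (P.algHom_ext fun k => by simp [ht, y])
    let b : ι → ℂ := fun i => (t' (Q.val i)).snd
    have htb : ∀ i, t' (Q.val i) = TrivSqZeroExt.inl (v i) + TrivSqZeroExt.inr (b i) := fun i => by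
      have : (t' (Q.val i)).fst = v i := congr($ht' (Q.val i))
      rw [← this]
      exact (TrivSqZeroExt.inl_fst_add_inr_snd_eq _).symm
    have hb : ∀ j, (Q.relation j).differential v b = 0 := fun j => by
      have := Q.aeval_relation_eq_zero t' j
      simp_rw [htb] at this
      rw [aeval_dualNumber] at this
      simpa using congrArg TrivSqZeroExt.snd this
    have hbz : ∀ k, (F k).differential v b = z k := fun k => by
      have h1 := hF t' k
      simp_rw [htb] at h1
      rw [aeval_dualNumber, show t' (φ (P.val k)) = t (P.val k) from congr($ht'' (P.val k)), ht] at h1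
      simpa using congrArg TrivSqZeroExt.snd h1
    refine ⟨fun k => Sum.elim (a + b) a' (e k), ?_⟩
    have h1 : pr (fun k => Sum.elim (a + b) a' (e k)) = a + b := by ext i; simp [pr]
    have h2 : pr' (fun k => Sum.elim (a + b) a' (e k)) = a' := by ext i; simp [pr']
    ext r
    rcases r with (j | j) | f
    · change (Q.relation j).differential v (pr _) = _
      rw [h1, map_add, hb, add_zero]
      exact congrFun ha (Sum.inl j)
    · change (Q'.relation j).differential v' (pr' _) = _
      rw [h2]
      exact congrFun ha' (Sum.inl j)
    · change (F f).differential v (pr _) - (F' f).differential v' (pr' _) = _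
      rw [h1, h2, map_add, hbz, show z f = _ from congrFun hz (Sum.inr f)]
      simp only [Sum.elim_inr]
      ring
  · have h1 := Q.card_free_add
    have h2 := Q'.card_free_add
    have h3 := Q.card_free
    have h4 := Q'.card_free
    have h5 := P.card_free
    have h6 := Fintype.card_congr e
    simp only [Nat.card_eq_fintype_card, Fintype.card_sum, Fintype.card_fin] at *
    omega
  · obtain ⟨s, hs, hinj⟩ := exists_mem_nhds_injOn_of_injective_fderiv _ y _
      (P.hasStrictFDerivAt_jacobianMap y) (P.jacobianMap_injective (χ.comp φ)) (by
        have := P.card_free_add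
        simp only [Nat.card_eq_fintype_card, Fintype.card_sum] at *
        omega)
    have hc : ∀ᶠ w in 𝓝 u, (fun k => eval (pr w) (F k)) ∈ s := by
      refine Filter.Tendsto.eventually_mem (tendsto_pi_nhds.mpr fun k => ?_) hs
      rw [hyeq, ← hpru]
      exact (hcd (F k)).continuous.tendsto u
    have hc' : ∀ᶠ w in 𝓝 u, (fun k => eval (pr' w) (F' k)) ∈ s := by
      refine Filter.Tendsto.eventually_mem (tendsto_pi_nhds.mpr fun k => ?_) hs
      rw [hyeq', ← hpru']
      exact (hcd' (F' k)).continuous.tendsto u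
    filter_upwards [hc, hc'] with w hw hw'
    constructor
    · rintro ⟨ψ, ψ', hψ, hwψ⟩
      have h1 : pr w = fun i => ψ (Q.val i) := by ext i; simp [pr, hwψ]
      have h2 : pr' w = fun i => ψ' (Q'.val i) := by ext i; simp [pr', hwψ]
      ext r
      rcases r with (j | j) | f
      · change eval (pr w) (Q.relation j) = 0
        rw [h1, ← aeval_eq_eval]
        exact Q.aeval_relation_eq_zero ψ j
      · change eval (pr' w) (Q'.relation j) = 0
        rw [h2, ← aeval_eq_eval]
        exact Q'.aeval_relation_eq_zero ψ' j
      · change eval (pr w) (F f) - eval (pr' w) (F' f) = 0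
        rw [h1, h2, ← aeval_eq_eval, ← aeval_eq_eval, sub_eq_zero]
        exact (hF ψ f).trans ((congr($hψ (P.val f))).trans (hF' ψ' f).symm)
    · intro hG
      obtain ⟨ψ, hψ⟩ := Q.exists_lift (pr w) fun j => by
        rw [aeval_eq_eval]; exact congrFun hG (Sum.inl (Sum.inl j))
      obtain ⟨ψ', hψ'⟩ := Q'.exists_lift (pr' w) fun j => by
        rw [aeval_eq_eval]; exact congrFun hG (Sum.inl (Sum.inr j))
      have h1 : pr w = fun i => ψ (Q.val i) := funext fun i => (hψ i).symm
      have h2 : pr' w = fun i => ψ' (Q'.val i) := funext fun i => (hψ' i).symm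
      have hw1 : (fun k => eval (pr w) (F k)) = fun k => (ψ.comp φ) (P.val k) := by
        ext k; rw [h1, ← aeval_eq_eval]; exact hF ψ k
      have hw2 : (fun k => eval (pr' w) (F' k)) = fun k => (ψ'.comp φ') (P.val k) := by
        ext k; rw [h2, ← aeval_eq_eval]; exact hF' ψ' k
      -- Both images satisfy the relations and share their free coordinates, so they are equal.
      have heq := hinj hw hw' (by
        ext r
        rcases r with j | f
        · simp only [Sum.elim_inl]
          rw [hw1, hw2, ← aeval_eq_eval, ← aeval_eq_eval]
          exact (P.aeval_relation_eq_zero _ j).trans (P.aeval_relation_eq_zero _ j).symm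
        · exact sub_eq_zero.mp (congrFun hG (Sum.inr f)))
      rw [hw1, hw2] at heq
      refine ⟨ψ, ψ', P.algHom_ext fun k => congrFun heq k, fun k => ?_⟩
      obtain ⟨r, rfl⟩ := e.symm.surjective k
      rw [Equiv.apply_symm_apply]
      rcases r with i | i
      · exact (hψ i).symm
      · exact (hψ' i).symm

end Algebra.SubmersivePresentation
end

/-! ### Part (a): from presentations to varieties. -/

section

open scoped TensorProduct

theorem Algebra.SubmersivePresentation.adjoin_range_val {R B ι σ : Type} [CommRing R] [CommRing B]
    [Algebra R B] [Finite σ] (P : Algebra.SubmersivePresentation R B ι σ) :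
    Algebra.adjoin R (Set.range P.val) = ⊤ := by
  rw [Algebra.adjoin_range_eq_range_aeval, AlgHom.range_eq_top]
  exact fun b => ⟨P.σ b, P.aeval_val_σ b⟩

namespace FiberProduct

variable {X Y : Scheme.{0}} [X.Over SpecC] [Y.Over SpecC]

/-- If `φ g = 0` with `g ≠ 0`, the preimage of the nonempty open set where `g ≠ 0` avoids the patch
`c`. But by dominance it is a nonempty open subset of the irreducible `X`, so it meets `c`. -/
theorem AffinePatch.algHom_injective (f : X ⟶ Y) [f.IsOver SpecC] [IsDominant f] [IsIntegral X]
    [IsIntegral Y] (c : AffinePatch X) (e : AffinePatch Y) (φ : e.A →ₐ[ℂ] c.A)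
    (h : c.ι ≫ f = Spec.map (CommRingCat.ofHom φ.toRingHom) ≫ e.ι)
    (hc : (Set.range c.ι).Nonempty) : Function.Injective φ := by
  have hce : Set.range c.ι ⊆ f ⁻¹' Set.range e.ι := by
    rintro _ ⟨x, rfl⟩
    refine ⟨Spec.map (CommRingCat.ofHom φ.toRingHom) x, ?_⟩
    exact (congr($h x)).symm
  have : IsDomain e.A := e.isDomain (by
    obtain ⟨x, hx⟩ := hc
    exact ⟨_, hce hx⟩)
  rw [injective_iff_map_eq_zero]
  intro g hg
  by_contra hg0
  let p : PrimeSpectrum e.A := ⟨⊥, Ideal.isPrime_bot⟩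
  have hp : e.ι p ∈ Set.range (e.basicOpen g).ι :=
    (e.mem_range_basicOpen g p).mpr fun h => hg0 (Ideal.mem_bot.mp h)
  obtain ⟨_, hy, x, rfl⟩ := f.denseRange.inter_open_nonempty _
    (e.basicOpen g).ι.isOpenEmbedding.isOpen_range ⟨_, hp⟩
  obtain ⟨_, ⟨q, rfl⟩, hq⟩ := nonempty_preirreducible_inter c.ι.isOpenEmbedding.isOpen_range
    ((e.basicOpen g).ι.isOpenEmbedding.isOpen_range.preimage f.continuous) hc ⟨x, hy⟩
  have h1 : f (c.ι q) = e.ι (PrimeSpectrum.comap φ.toRingHom q) := congr($h q)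
  rw [Set.mem_preimage, h1, e.mem_range_basicOpen] at hq
  exact hq (by
    change φ g ∈ q.asIdeal
    rw [hg]
    exact zero_mem _)

/-- The kernel of `ε ↦ 0` has square zero, so every prime contains it. A tangent vector at a point
therefore factors through any patch containing that point. -/
theorem range_subset_range_dualZero : Set.univ ⊆ Set.range dualZero := by
  rintro (x : PrimeSpectrum (DualNumber ℂ)) -
  have h : x ∈ Set.range (PrimeSpectrum.comap (TrivSqZeroExt.fstHom ℂ ℂ ℂ).toRingHom) := by
    rw [range_comap_of_surjective _ _ (fun a => ⟨TrivSqZeroExt.inl a, rfl⟩)]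
    intro a ha
    have ha : a.fst = 0 := ha
    refine x.2.mem_of_pow_mem 2 ?_
    convert! x.asIdeal.zero_mem
    ext <;> simp [pow_two, ha]
  exact h

/-- Translates surjectivity of the differential into the lifting condition on homomorphisms to
`ℂ[ε]` required by `isSubmanifoldAt_fiberProduct`. -/
theorem IsSubmersion.exists_algHom {f : X ⟶ Y} [f.IsOver SpecC] (hf : IsSubmersion f)
    (c : AffinePatch X) (e : AffinePatch Y) (φ : e.A →ₐ[ℂ] c.A)
    (h : c.ι ≫ f = Spec.map (CommRingCat.ofHom φ.toRingHom) ≫ e.ι) (χ : c.A →ₐ[ℂ] ℂ)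
    (t : e.A →ₐ[ℂ] DualNumber ℂ) (ht : (TrivSqZeroExt.fstHom ℂ ℂ ℂ).comp t = χ.comp φ) :
    ∃ t' : c.A →ₐ[ℂ] DualNumber ℂ,
      (TrivSqZeroExt.fstHom ℂ ℂ ℂ).comp t' = χ ∧ t'.comp φ = t := by
  let v : TangentVector ((c.point χ).map f) :=
    { hom := Spec.map (CommRingCat.ofHom t.toRingHom) ≫ e.ι
      hom_over := by
        rw [Category.assoc, e.hom_over, ← Spec.map_comp, ← CommRingCat.ofHom_comp]
        congr 2
        exact t.comp_algebraMap
      base := by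
        rw [c.point_map f e φ h, ← ht, dualZero, ← Category.assoc, ← Spec.map_comp]
        rfl }
  obtain ⟨w, hw⟩ := hf (c.point χ) v
  have hr : Set.range w.hom ⊆ Set.range c.ι := by
    rintro _ ⟨x, rfl⟩
    obtain ⟨z, rfl⟩ := range_subset_range_dualZero (Set.mem_univ x)
    have hb : w.hom (dualZero z) = c.ι (Spec.map (CommRingCat.ofHom χ.toRingHom) z) :=
      congr($(w.base) z)
    exact ⟨_, hb.symm⟩
  obtain ⟨t', ht'⟩ := c.exists_algHom_of_range_subset w.hom w.hom_over hr
  refine ⟨t', ?_, ?_⟩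
  · have h1 := w.base
    rw [ht', dualZero, ← Category.assoc, ← Spec.map_comp] at h1
    have h2 := congrArg CommRingCat.Hom.hom (Spec.map_injective ((cancel_mono c.ι).mp h1))
    exact AlgHom.ext fun x => congr($h2 x)
  · have h1 : w.hom ≫ f = _ := congrArg TangentVector.hom hw
    rw [ht', Category.assoc, h, ← Category.assoc, ← Spec.map_comp] at h1
    have h2 := congrArg CommRingCat.Hom.hom (Spec.map_injective ((cancel_mono e.ι).mp h1))
    exact AlgHom.ext fun x => congr($h2 x)

theorem dimension_eq_of_isDomain {A κ τ : Type} [CommRing A] [IsDomain A] [Algebra ℂ A] [Finite κ]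
    [Finite τ] (P : Algebra.SubmersivePresentation ℂ A κ τ) {n : ℕ} (hn : ringKrullDim A = n) :
    P.dimension = n := by
  have : Algebra.IsStandardSmoothOfRelativeDimension P.dimension ℂ A :=
    P.isStandardSmoothOfRelativeDimension rfl
  have h := ringKrullDim_of_isStandardSmoothOfRelativeDimension ℂ A P.dimension
  rw [hn] at h
  exact_mod_cast h.symm

/-- Dominance makes the coordinate rings inject, and transcendence degree is monotone. This ensures
that `2 dim X - dim Y` is a natural number. -/
theorem topologicalKrullDim_le_of_isDominant (f : X ⟶ Y) [f.IsOver SpecC] [IsDominant f]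
    [IsIntegral X] [IsIntegral Y] [LocallyOfFiniteType (X ↘ SpecC)]
    [LocallyOfFiniteType (Y ↘ SpecC)] : topologicalKrullDim Y ≤ topologicalKrullDim X := by
  obtain ⟨m, hm, hm'⟩ := exists_topologicalKrullDim_eq (X := X)
  obtain ⟨n, hn, hn'⟩ := exists_topologicalKrullDim_eq (X := Y)
  obtain ⟨x⟩ : Nonempty X := inferInstance
  obtain ⟨e, he, -⟩ := AffinePatch.exists_mem ⊤ (f x) trivial
  obtain ⟨c, hc, hce⟩ := AffinePatch.exists_mem (f ⁻¹ᵁ e.ι.opensRange) x he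
  obtain ⟨φ, hφ⟩ := AffinePatch.exists_map_eq f c e hce
  have hinj := c.algHom_injective f e φ hφ ⟨x, hc⟩
  have := c.isDomain ⟨x, hc⟩
  have := e.isDomain ⟨_, he⟩
  have := c.finiteType
  have := e.finiteType
  obtain ⟨a, ha, ha'⟩ := exists_ringKrullDim_eq_trdeg ℂ c.A
  obtain ⟨b, hb, hb'⟩ := exists_ringKrullDim_eq_trdeg ℂ e.A
  have h := trdeg_le_of_injective φ hinj
  rw [ha', hb', Nat.cast_le] at h
  rw [hm, hn, ← hm' c ⟨x, hc⟩, ← hn' e ⟨_, he⟩, ha, hb]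
  exact_mod_cast h

theorem isComplexSubmanifold_fiberSquare (f : X ⟶ Y) [f.IsOver SpecC] [IsIntegral X]
    [IsIntegral Y] [Smooth (X ↘ SpecC)] [Smooth (Y ↘ SpecC)] (hf : IsSubmersion f) {m n d : ℕ}
    (hm : topologicalKrullDim X = m) (hn : topologicalKrullDim Y = n) (hd : d + n = 2 * m) :
    IsComplexSubmanifold d (fiberSquare f) := by
  intro z hz
  have hz : (z.map (square.fst X)).map f = (z.map (square.snd X)).map f := hz
  obtain ⟨m', hm1, hm'⟩ := exists_topologicalKrullDim_eq (X := X)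
  obtain ⟨n', hn1, hn'⟩ := exists_topologicalKrullDim_eq (X := Y)
  obtain rfl : m' = m := by rw [hm] at hm1; exact_mod_cast hm1.symm
  obtain rfl : n' = n := by rw [hn] at hn1; exact_mod_cast hn1.symm
  obtain ⟨e, he, -, hsm⟩ :=
    AffinePatch.exists_mem_isStandardSmooth ⊤ (((z.map (square.fst X)).map f).pt) trivial
  -- The two components of `z` may need different patches of `X`, but one patch `e` of `Y` serves
  -- both, as their images coincide.
  have key : ∀ p : CPoint X, (p.map f).pt ∈ Set.range e.ι → ∃ (c : AffinePatch X)
      (χ : c.A →ₐ[ℂ] ℂ) (φ : e.A →ₐ[ℂ] c.A), c.point χ = p ∧ Algebra.IsStandardSmooth ℂ c.A ∧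
        c.ι ≫ f = Spec.map (CommRingCat.ofHom φ.toRingHom) ≫ e.ι := fun p hp => by
    obtain ⟨c, hc, hce, hcs⟩ :=
      AffinePatch.exists_mem_isStandardSmooth (f ⁻¹ᵁ e.ι.opensRange) p.pt hp
    obtain ⟨φ, hφ⟩ := AffinePatch.exists_map_eq f c e hce
    obtain ⟨χ, hχ⟩ := c.exists_point_eq p hc
    exact ⟨c, χ, φ, hχ, hcs, hφ⟩
  obtain ⟨c, χ, φ, hχ, hcs, hφ⟩ := key _ he
  obtain ⟨c', χ', φ', hχ', hcs', hφ'⟩ := key _ (hz ▸ he)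
  have hc0 : (Set.range c.ι).Nonempty := ⟨_, c.point_pt_mem_range χ⟩
  have hc0' : (Set.range c'.ι).Nonempty := ⟨_, c'.point_pt_mem_range χ'⟩
  have := e.isDomain ⟨_, he⟩
  have := c.isDomain hc0
  have := c'.isDomain hc0'
  obtain ⟨κ, τ, _, _, ⟨P⟩⟩ := hsm
  obtain ⟨ι, σ, _, _, ⟨Q⟩⟩ := hcs
  obtain ⟨ι', σ', _, _, ⟨Q'⟩⟩ := hcs'
  have hP := dimension_eq_of_isDomain P (hn' e ⟨_, he⟩)
  have hQ := dimension_eq_of_isDomain Q (hm' c hc0)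
  have hQ' := dimension_eq_of_isDomain Q' (hm' c' hc0')
  have := Fintype.ofFinite κ
  have := Fintype.ofFinite τ
  have := Fintype.ofFinite ι
  have := Fintype.ofFinite σ
  have := Fintype.ofFinite ι'
  have := Fintype.ofFinite σ'
  let k : Fin (Fintype.card (ι ⊕ ι')) ≃ ι ⊕ ι' := (Fintype.equivFin _).symm
  -- The product patch, with the generators of the two presentations as coordinates.
  let C : AffineChart (square X) :=
    { A := (c.prod c').A
      ι := (c.prod c').ι
      hom_over := (c.prod c').hom_over
      n := Fintype.card (ι ⊕ ι')
      coord := fun i => Sum.elim (fun j => c.inl c' (Q.val j)) (fun j => c.inr c' (Q'.val j)) (k i)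
      adjoin_coord := by
        refine Algebra.eq_top_iff.mpr fun a => ?_
        set S := Algebra.adjoin ℂ (Set.range fun i => Sum.elim (fun j => c.inl c' (Q.val j))
          (fun j => c.inr c' (Q'.val j)) (k i)) with hS
        have hl : (⊤ : Subalgebra ℂ c.A) ≤ S.comap (c.inl c') := by
          rw [← Q.adjoin_range_val, Algebra.adjoin_le_iff]
          rintro _ ⟨j, rfl⟩
          exact Algebra.subset_adjoin ⟨k.symm (Sum.inl j), by simp⟩
        have hr : (⊤ : Subalgebra ℂ c'.A) ≤ S.comap (c.inr c') := by
          rw [← Q'.adjoin_range_val, Algebra.adjoin_le_iff]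
          rintro _ ⟨j, rfl⟩
          exact Algebra.subset_adjoin ⟨k.symm (Sum.inr j), by simp⟩
        induction a using TensorProduct.induction_on with
        | zero => exact zero_mem _
        | add a b ha hb => exact add_mem ha hb
        | tmul a b =>
          have : (a ⊗ₜ[ℂ] b : TensorProduct ℂ c.A c'.A) = a ⊗ₜ 1 * 1 ⊗ₜ b := by simp
          rw [this]
          exact mul_mem (hl (x := a) trivial) (hr (x := b) trivial) }
  have hpt : ∀ α, C.point α = (c.prod c').point α := fun _ => rfl
  have hcoords : ∀ α : (c.prod c').A →ₐ[ℂ] ℂ, C.coords α = fun i =>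
      Sum.elim (fun j => α.comp (c.inl c') (Q.val j)) (fun j => α.comp (c.inr c') (Q'.val j))
        (k i) := fun α => by
    ext i
    change α (Sum.elim _ _ (k i)) = _
    rcases k i with j | j <;> rfl
  refine ⟨C, c.pair c' χ χ', ?_, ?_⟩
  · rw [hpt]
    exact AffinePatch.prod_point_pair _ _ _ _ _ hχ.symm hχ'.symm
  · have hcomp : χ.comp φ = χ'.comp φ' := by
      apply e.point_injective
      rw [← AffinePatch.point_map f c e φ hφ, ← AffinePatch.point_map f c' e φ' hφ', hχ, hχ', hz]
    have := Algebra.SubmersivePresentation.isSubmanifoldAt_fiberProduct P Q Q' φ φ' χ χ' hcomp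
      (fun t ht => hf.exists_algHom c e φ hφ χ t ht) (d := d) k (by omega)
    rw [hcoords, AffinePatch.pair_comp_inl, AffinePatch.pair_comp_inr]
    convert! this
    ext w
    constructor
    · rintro ⟨α, hα, rfl⟩
      refine ⟨α.comp (c.inl c'), α.comp (c.inr c'), ?_, fun i => congrFun (hcoords α) i⟩
      apply e.point_injective
      rw [← AffinePatch.point_map f c e φ hφ, ← AffinePatch.point_map f c' e φ' hφ',
        ← AffinePatch.prod_point_fst, ← AffinePatch.prod_point_snd]
      exact hα
    · rintro ⟨ψ, ψ', hψ, hw⟩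
      refine ⟨c.pair c' ψ ψ', ?_, ?_⟩
      · change ((C.point _).map _).map f = ((C.point _).map _).map f
        rw [hpt, AffinePatch.prod_point_fst, AffinePatch.prod_point_snd,
          AffinePatch.pair_comp_inl, AffinePatch.pair_comp_inr, AffinePatch.point_map f c e φ hφ,
          AffinePatch.point_map f c' e φ' hφ', hψ]
      · rw [hcoords, AffinePatch.pair_comp_inl, AffinePatch.pair_comp_inr]
        exact funext fun i => (hw i).symm

end FiberProduct

end

/-! ### An irreducible fiber square makes the base field algebraically closed in the function field.
-/

section

open scoped TensorProduct
open Polynomial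

/-- For `E = K(β)`, separable over `K`, the ring `E ⊗[K] E` is reduced and embeds into `L ⊗[K] L`;
hence `β ⊗ 1 = 1 ⊗ β`. Applying to the left factor a linear form `f` with `f 1 = 1` gives `β = f β`,
an element of `K`. -/
theorem mem_range_of_isNilpotent_tmul_sub_tmul (K L : Type) [Field K] [Field L] [Algebra K L]
    [CharZero K] (β : L) (hβ : IsIntegral K β)
    (h : IsNilpotent (β ⊗ₜ[K] (1 : L) - (1 : L) ⊗ₜ[K] β)) : β ∈ (algebraMap K L).range := by
  let E := IntermediateField.adjoin K {β}
  have : FiniteDimensional K E := IntermediateField.adjoin.finiteDimensional hβ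
  have : Algebra.FormallyUnramified K E := Algebra.FormallyUnramified.of_isSeparable K E
  have : IsReduced (E ⊗[K] E) := Algebra.FormallyUnramified.isReduced_of_field E (E ⊗[K] E)
  let b : E := IntermediateField.AdjoinSimple.gen K β
  have hinj : Function.Injective (Algebra.TensorProduct.map E.val E.val) :=
    TensorProduct.map_injective_of_flat_flat E.val.toLinearMap E.val.toLinearMap E.val.injective E.val.injective
  have h1 : IsNilpotent (b ⊗ₜ[K] (1 : E) - (1 : E) ⊗ₜ[K] b) := by
    obtain ⟨n, hn⟩ := h
    refine ⟨n, hinj ?_⟩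
    rw [map_pow, map_zero, ← hn]
    simp [b]
  have h2 := sub_eq_zero.mp h1.eq_zero
  obtain ⟨f, hf⟩ := LinearMap.exists_leftInverse_of_injective (Algebra.linearMap K E)
    (LinearMap.ker_eq_bot.mpr (algebraMap K E).injective)
  have hf1 : f 1 = 1 := by simpa using congr($hf 1)
  have h3 := congrArg (fun x => TensorProduct.lid K E (f.rTensor E x)) h2
  simp only [LinearMap.rTensor_tmul, TensorProduct.lid_tmul, hf1, one_smul] at h3
  refine ⟨f b, ?_⟩
  have h4 := congrArg E.val h3
  simpa [Algebra.smul_def, b] using h4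

/-- Both `x = β ⊗ 1` and `y = 1 ⊗ β` are roots of the minimal polynomial `m`. Writing `m = (X - x)
q` over `B ⊗[A] B` gives `(x - y) q(y) = 0`. Multiplication `B ⊗[A] B → B` sends `q(y)` to `m'(β) ≠
0`, so `q(y)` is not nilpotent, and `x - y` must be. -/
theorem mem_range_of_isIntegral_of_isNilpotent (A B : Type) [CommRing A] [IsDomain A]
    [IsIntegrallyClosed A] [CharZero A] [CommRing B] [IsDomain B] [Algebra A B] [FaithfulSMul A B]
    (H : ∀ u w : B ⊗[A] B, u * w = 0 → IsNilpotent u ∨ IsNilpotent w)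
    (β : B) (hβ : IsIntegral A β) : β ∈ (algebraMap A B).range := by
  let m := minpoly A β
  have hm : m.Monic := minpoly.monic hβ
  let T := B ⊗[A] B
  let x : T := β ⊗ₜ 1
  let y : T := 1 ⊗ₜ β
  let p : T[X] := m.map (algebraMap A T)
  have hpx : p.IsRoot x := by
    rw [IsRoot, eval_map_algebraMap]
    have := aeval_algHom_apply (Algebra.TensorProduct.includeLeft : B →ₐ[A] T) β m
    rw [minpoly.aeval, map_zero] at this
    exact this
  have hpy : p.eval y = 0 := by
    rw [eval_map_algebraMap]
    have := aeval_algHom_apply (Algebra.TensorProduct.includeRight : B →ₐ[A] T) β m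
    rw [minpoly.aeval, map_zero] at this
    exact this
  obtain ⟨q, hq⟩ := dvd_iff_isRoot.mpr hpx
  let μ : T →ₐ[A] B := Algebra.TensorProduct.lmul' A
  have hμx : μ x = β := (Algebra.TensorProduct.lmul'_apply_tmul β 1).trans (mul_one β)
  have hμy : μ y = β := (Algebra.TensorProduct.lmul'_apply_tmul 1 β).trans (one_mul β)
  have hder : μ (q.eval y) = aeval β (derivative m) := by
    have h1 : m.map (algebraMap A B) = (X - C β) * q.map μ.toRingHom := by
      have := congrArg (Polynomial.map μ.toRingHom) hq
      rw [Polynomial.map_map, Polynomial.map_mul, Polynomial.map_sub, map_X, map_C] at this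
      convert! this
      · exact μ.comp_algebraMap.symm
      · exact hμx.symm
    have h2 := congrArg (fun f => (derivative f).eval β) h1
    simp only [derivative_mul, derivative_map, eval_add, eval_mul, eval_sub, eval_X, eval_C,
      sub_self, zero_mul, add_zero, derivative_sub, derivative_X, derivative_C, sub_zero,
      eval_map_algebraMap, one_mul] at h2
    rw [h2, Polynomial.eval_map, ← hμy]
    exact hom_eval₂ q (RingHom.id T) μ.toRingHom y
  -- Normality of `A` makes `m` divide every polynomial over `A` vanishing at `β`; the derivative is
  -- nonzero in characteristic zero and of smaller degree.
  have hne : aeval β (derivative m) ≠ 0 := by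
    intro h0
    have hdvd := minpoly.isIntegrallyClosed_dvd hβ h0
    have hd : derivative m ≠ 0 := fun h =>
      (minpoly.natDegree_pos hβ).ne' (derivative_eq_zero.mp h)
    exact hd (eq_zero_of_dvd_of_degree_lt hdvd (degree_derivative_lt hm.ne_zero))
  rcases H (x - y) (q.eval y) (by
    rw [hq, eval_mul, eval_sub, eval_X, eval_C] at hpy
    linear_combination -hpy) with hu | hw
  · let K := FractionRing A
    let L := FractionRing B
    let : Algebra K L := FractionRing.liftAlgebra A L
    have hKL : IsScalarTower A K L := FractionRing.isScalarTower_liftAlgebra A L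
    have : CharZero K := charZero_of_injective_algebraMap (IsFractionRing.injective A K)
    let ψ : T →ₐ[A] L ⊗[K] L := Algebra.TensorProduct.lift
      ((Algebra.TensorProduct.includeLeft : L →ₐ[K] L ⊗[K] L).restrictScalars A |>.comp
        (IsScalarTower.toAlgHom A B L))
      ((Algebra.TensorProduct.includeRight : L →ₐ[K] L ⊗[K] L).restrictScalars A |>.comp
        (IsScalarTower.toAlgHom A B L)) fun _ _ => .all _ _
    have hu' := hu.map ψ
    have : ψ (x - y) = algebraMap B L β ⊗ₜ[K] 1 - 1 ⊗ₜ[K] algebraMap B L β := by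
      rw [map_sub]
      exact congrArg₂ _ ((Algebra.TensorProduct.lift_tmul ..).trans (by simp))
        ((Algebra.TensorProduct.lift_tmul ..).trans (by simp))
    rw [this] at hu'
    have hint : IsIntegral A (algebraMap B L β) := hβ.map (IsScalarTower.toAlgHom A B L)
    obtain ⟨k, hk⟩ := mem_range_of_isNilpotent_tmul_sub_tmul K L _ hint.tower_top hu'
    have hk' : IsIntegral A k := by
      refine (isIntegral_algHom_iff (IsScalarTower.toAlgHom A K L) (algebraMap K L).injective).mp ?_
      change IsIntegral A (algebraMap K L k)
      rw [hk]
      exact hint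
    obtain ⟨a, rfl⟩ := IsIntegrallyClosed.isIntegral_iff.mp hk'
    refine ⟨a, IsFractionRing.injective B L ?_⟩
    rw [← hk, ← IsScalarTower.algebraMap_apply, ← IsScalarTower.algebraMap_apply]
  · exact absurd (hder ▸ (hw.map μ).eq_zero) hne

/-- If the zero divisors of the fiber squares of all basic open subsets of `Spec B` over `Spec A` are
nilpotent, then `Frac A` is algebraically closed in `Frac B`. -/
theorem mem_range_of_isIntegral_fractionRing (A B K L : Type) [CommRing A] [IsDomain A]
    [IsIntegrallyClosed A] [CharZero A] [CommRing B] [IsDomain B] [Algebra A B] [FaithfulSMul A B]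
    [Field K] [Field L] [Algebra A K] [Algebra B L] [IsFractionRing A K] [IsFractionRing B L]
    [Algebra K L] [Algebra A L] [IsScalarTower A K L] [IsScalarTower A B L]
    (H : ∀ g : B, g ≠ 0 → ∀ u w : Localization.Away g ⊗[A] Localization.Away g,
      u * w = 0 → IsNilpotent u ∨ IsNilpotent w)
    (β : L) (hβ : IsIntegral K β) : β ∈ (algebraMap K L).range := by
  -- A multiple `a β` is integral over `A`, but it lies only in `B_c`, where `c` is a denominator of
  -- `β`. This is why `H` concerns all basic open subsets.
  obtain ⟨⟨a, ha⟩, hint⟩ := hβ.exists_multiple_integral_of_isLocalization (nonZeroDivisors A) β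
  obtain ⟨b, c, hc, rfl⟩ := IsFractionRing.div_surjective (A := B) β
  have hc0 : c ≠ 0 := nonZeroDivisors.ne_zero hc
  have ha0 : a ≠ 0 := nonZeroDivisors.ne_zero ha
  have hle : Submonoid.powers c ≤ nonZeroDivisors B := powers_le_nonZeroDivisors_of_noZeroDivisors hc0
  let Bc := Localization.Away c
  have : IsDomain Bc := IsLocalization.isDomain_of_le_nonZeroDivisors _ hle
  have hBBc : Function.Injective (algebraMap B Bc) := IsLocalization.injective _ hle
  have : FaithfulSMul A Bc := (faithfulSMul_iff_algebraMap_injective _ _).mpr (by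
    rw [IsScalarTower.algebraMap_eq A B Bc]
    exact hBBc.comp (FaithfulSMul.algebraMap_injective A B))
  let ψ : Bc →ₐ[B] L := IsLocalization.liftAlgHom (M := Submonoid.powers c) (f := Algebra.ofId B L)
    (fun s => (IsLocalization.map_units L (⟨s, hle s.2⟩ : nonZeroDivisors B)))
  have hψ : Function.Injective ψ := by
    refine IsLocalization.lift_injective_iff _ |>.mpr fun x y => ?_
    rw [hBBc.eq_iff]
    exact (IsFractionRing.injective B L).eq_iff.symm
  have hcu : algebraMap B L c ≠ 0 := fun h => hc0 (IsFractionRing.injective B L (by rw [h, map_zero]))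
  let z : Bc := IsLocalization.mk' Bc (algebraMap A B a * b) ⟨c, Submonoid.mem_powers c⟩
  have hz : ψ z = a • (algebraMap B L b / algebraMap B L c) := by
    have h1 : ψ (z * algebraMap B Bc c) = ψ (algebraMap B Bc (algebraMap A B a * b)) :=
      congrArg ψ (IsLocalization.mk'_spec Bc _ (⟨c, Submonoid.mem_powers c⟩ : Submonoid.powers c))
    rw [map_mul, AlgHom.commutes, AlgHom.commutes, map_mul, ← IsScalarTower.algebraMap_apply] at h1
    rw [Algebra.smul_def, eq_comm, mul_div_assoc', div_eq_iff hcu, h1]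
  have hint' : IsIntegral A z := by
    refine (isIntegral_algHom_iff (ψ.restrictScalars A) hψ).mp ?_
    change IsIntegral A (ψ z)
    rw [hz]
    exact hint
  obtain ⟨α, hα⟩ := mem_range_of_isIntegral_of_isNilpotent A Bc (H c hc0) z hint'
  have h2 : algebraMap K L (algebraMap A K α) =
      algebraMap K L (algebraMap A K a) * (algebraMap B L b / algebraMap B L c) := by
    rw [← IsScalarTower.algebraMap_apply, ← IsScalarTower.algebraMap_apply, ← Algebra.smul_def,
      ← hz, ← hα]
    exact ((ψ.restrictScalars A).commutes α).symm
  have ha' : algebraMap A K a ≠ 0 :=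
    fun h => ha0 (IsFractionRing.injective A K (by rw [h, map_zero]))
  refine ⟨algebraMap A K α / algebraMap A K a, ?_⟩
  rw [map_div₀, h2, mul_div_cancel_left₀]
  exact (_root_.map_ne_zero _).mpr ha'

end

/-! ### Irreducibility of polynomials under specialization. -/

section

open MvPolynomial

attribute [local instance] MvPolynomial.algebraMvPolynomial

/-- By the Nullstellensatz over `K`, an ideal without zeros in finite extensions of `K` generates
the unit ideal over `K`; clearing denominators leaves a nonzero constant of `A` in `I`. -/
theorem MvPolynomial.exists_C_mem_of_forall_finite (A K τ : Type) [CommRing A] [IsDomain A] [Field K]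
    [Algebra A K] [IsFractionRing A K] [Finite τ] (I : Ideal (MvPolynomial τ A))
    (h : ∀ (M : Type) [Field M] [Algebra K M] [FiniteDimensional K M] (x : τ → M),
      ∃ p ∈ I, eval₂ ((algebraMap K M).comp (algebraMap A K)) x p ≠ 0) :
    ∃ a : A, a ≠ 0 ∧ C a ∈ I := by
  let J := I.map (algebraMap (MvPolynomial τ A) (MvPolynomial τ K))
  have hJ : J = ⊤ := by
    by_contra hJ
    obtain ⟨m, hm, hJm⟩ := Ideal.exists_le_maximal J hJ
    let M := MvPolynomial τ K ⧸ m
    let : Field M := Ideal.Quotient.field m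
    have : FiniteDimensional K M := finite_of_finite_type_of_isJacobsonRing K M
    obtain ⟨p, hp, hne⟩ := h M (fun i => Ideal.Quotient.mk m (X i))
    refine hne ?_
    have h1 : (Ideal.Quotient.mk m) (algebraMap (MvPolynomial τ A) (MvPolynomial τ K) p) = 0 :=
      Ideal.Quotient.eq_zero_iff_mem.mpr (hJm (Ideal.mem_map_of_mem _ hp))
    rw [← h1]
    change _ = ((Ideal.Quotient.mk m).comp (algebraMap (MvPolynomial τ A) (MvPolynomial τ K))) p
    rw [← coe_eval₂Hom]
    congr 1
    apply MvPolynomial.ringHom_ext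
    · intro r
      rw [algebraMap_def, coe_eval₂Hom, eval₂_C, RingHom.comp_apply, RingHom.comp_apply, map_C]
      rfl
    · intro i
      rw [algebraMap_def, coe_eval₂Hom, eval₂_X, RingHom.comp_apply, map_X]
  obtain ⟨⟨⟨p, hp⟩, ⟨_, a, ha, rfl⟩⟩, hx⟩ := (IsLocalization.mem_map_algebraMap_iff
    ((nonZeroDivisors A).map (C (σ := τ))) (MvPolynomial τ K)).mp
    (show (1 : MvPolynomial τ K) ∈ J by rw [hJ]; trivial)
  refine ⟨a, nonZeroDivisors.ne_zero ha, ?_⟩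
  rw [one_mul] at hx
  have hinj : Function.Injective (algebraMap (MvPolynomial τ A) (MvPolynomial τ K)) := by
    rw [algebraMap_def]
    exact map_injective _ (IsFractionRing.injective A K)
  have hx' : C a = p := hinj hx
  exact hx' ▸ hp

theorem MvPolynomial.exists_coeff_ne_zero_of_not_isUnit {k σ : Type} [Field k] {F : MvPolynomial σ k}
    (h0 : F ≠ 0) (h : ¬ IsUnit F) : ∃ ν, ν ≠ 0 ∧ coeff ν F ≠ 0 := by
  classical
  by_contra! hc
  have hF : F = C (coeff 0 F) := by
    ext ν
    rw [coeff_C]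
    split_ifs with hν
    · rw [hν]
    · exact hc ν fun h => hν h.symm
  refine h ?_
  rw [hF]
  refine IsUnit.map C (isUnit_iff_ne_zero.mpr fun h => h0 ?_)
  rw [hF, h, map_zero]

theorem MvPolynomial.not_isUnit_of_coeff_ne_zero {k σ : Type} [Field k] {F : MvPolynomial σ k}
    {ν : σ →₀ ℕ} (hν : ν ≠ 0) (h : coeff ν F ≠ 0) : ¬ IsUnit F := by
  classical
  intro hu
  obtain ⟨r, -, rfl⟩ := isUnit_iff_eq_C_of_isReduced.mp hu
  rw [coeff_C, if_neg hν.symm] at h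
  exact h rfl

/-- A polynomial that is irreducible over all finite extensions of the fraction field specializes to
irreducible polynomials outside a hypersurface. -/
theorem MvPolynomial.exists_forall_irreducible_map (A K σ : Type) [CommRing A] [IsDomain A] [Field K]
    [Algebra A K] [IsFractionRing A K] [Finite σ] (P : MvPolynomial σ A)
    (h : ∀ (M : Type) [Field M] [Algebra K M] [FiniteDimensional K M],
      Irreducible (P.map ((algebraMap K M).comp (algebraMap A K)))) :
    ∃ a : A, a ≠ 0 ∧ ∀ (k : Type) [Field k] (φ : A →+* k), φ a ≠ 0 → Irreducible (P.map φ) := by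
  classical
  -- The unknowns are the coefficients of two factors `f`, `g` of degree at most that of `P`, and
  -- one more variable, `none`. The ideal `I s` expresses that `P = f g` and, by Rabinowitsch's
  -- trick, that the coefficients of `f` at `s.1` and of `g` at `s.2` are nonzero.
  let S : Type := {ν : σ →₀ ℕ // ν.degree ≤ P.totalDegree}
  have : Finite S := Finsupp.finite_of_degree_le P.totalDegree
  have := Fintype.ofFinite S
  let f : MvPolynomial σ (MvPolynomial (Option (S ⊕ S)) A) := ∑ ν : S, monomial ν.1 (X (some (Sum.inl ν)))
  let g : MvPolynomial σ (MvPolynomial (Option (S ⊕ S)) A) := ∑ ν : S, monomial ν.1 (X (some (Sum.inr ν)))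
  let I : S × S → Ideal (MvPolynomial (Option (S ⊕ S)) A) := fun s => Ideal.span (insert
    (X none * X (some (Sum.inl s.1)) * X (some (Sum.inr s.2)) - 1)
    (Set.range fun ν => coeff ν (f * g - P.map C)))
  have hev : ∀ {M : Type} [Field M] (φ : A →+* M) (x : Option (S ⊕ S) → M),
      (∀ ν, eval₂ φ x (coeff ν (f * g - P.map C)) = 0) ↔
      P.map φ = (∑ ν : S, monomial ν.1 (x (some (Sum.inl ν)))) *
        (∑ ν : S, monomial ν.1 (x (some (Sum.inr ν)))) := by
    intro M _ φ x
    have h1 : map (eval₂Hom φ x) (f * g - P.map C) =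
      (∑ ν : S, monomial ν.1 (x (some (Sum.inl ν)))) *
        (∑ ν : S, monomial ν.1 (x (some (Sum.inr ν)))) - P.map φ := by
      simp only [f, g, map_sub, map_mul, map_sum, map_monomial, coe_eval₂Hom, eval₂_X, map_map]
      rw [show (eval₂Hom φ x).comp C = φ from RingHom.ext fun r => eval₂_C _ _ _]
    rw [eq_comm, ← sub_eq_zero, ← h1, MvPolynomial.ext_iff]
    simp only [coeff_map, coeff_zero, coe_eval₂Hom]
  have hz : ∀ {M : Type} [Field M] (φ : A →+* M) (x : Option (S ⊕ S) → M) (s : S × S),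
      eval₂ φ x (X none * X (some (Sum.inl s.1)) * X (some (Sum.inr s.2)) - 1) =
        x none * x (some (Sum.inl s.1)) * x (some (Sum.inr s.2)) - 1 := by
    intro M _ φ x s
    simp only [eval₂_sub, eval₂_mul, eval₂_X, eval₂_one]
  have hcoeff : ∀ {M : Type} [Field M] (y : S → M) (ν : S),
      coeff ν.1 (∑ ν : S, monomial ν.1 (y ν)) = y ν := by
    intro M _ y ν
    rw [coeff_sum, Finset.sum_eq_single ν]
    · simp
    · intro μ _ hμ
      rw [coeff_monomial, if_neg fun h => hμ (Subtype.ext h)]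
    · simp
  -- For nonzero exponents, a zero of `I s` in `M` would factor `P` over `M` into two nonconstant
  -- polynomials.
  have key : ∀ s : S × S, s.1.1 ≠ 0 → s.2.1 ≠ 0 → ∃ a : A, a ≠ 0 ∧ C a ∈ I s := by
    intro s h1 h2
    apply exists_C_mem_of_forall_finite A K
    intro M _ _ _ x
    by_contra! hx
    have hx1 := (hev _ x).mp fun ν => hx _ (Ideal.subset_span (Or.inr ⟨ν, rfl⟩))
    have hx2 := hx _ (Ideal.subset_span (Or.inl rfl))
    rw [hz, sub_eq_zero] at hx2
    have hne1 : x (some (Sum.inl s.1)) ≠ 0 := fun h => by simp [h] at hx2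
    have hne2 : x (some (Sum.inr s.2)) ≠ 0 := fun h => by simp [h] at hx2
    rcases (h M).isUnit_or_isUnit hx1 with hu | hu
    · exact not_isUnit_of_coeff_ne_zero h1 (by
        rw [hcoeff (fun ν => x (some (Sum.inl ν)))]; exact hne1) hu
    · exact not_isUnit_of_coeff_ne_zero h2 (by
        rw [hcoeff (fun ν => x (some (Sum.inr ν)))]; exact hne2) hu
  have key' : ∀ s : S × S, ∃ a : A, a ≠ 0 ∧ (s.1.1 ≠ 0 → s.2.1 ≠ 0 → C a ∈ I s) := by
    intro s
    by_cases h1 : s.1.1 ≠ 0 ∧ s.2.1 ≠ 0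
    · obtain ⟨a, ha, hI⟩ := key s h1.1 h1.2
      exact ⟨a, ha, fun _ _ => hI⟩
    · exact ⟨1, one_ne_zero, fun h2 h3 => absurd ⟨h2, h3⟩ h1⟩
  choose a ha haI using key'
  -- Keeping one nonconstant coefficient of `P` nonzero prevents the specialization from becoming
  -- zero or a unit.
  obtain ⟨ν, hν, hPν⟩ := exists_coeff_ne_zero_of_not_isUnit (h K).ne_zero (h K).not_isUnit
  rw [coeff_map] at hPν
  refine ⟨coeff ν P * ∏ s, a s, mul_ne_zero (fun h => hPν (by rw [h, map_zero]))
    (Finset.prod_ne_zero_iff.mpr fun s _ => ha s), fun k _ φ hφ => ?_⟩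
  rw [map_mul, map_prod] at hφ
  have hφ1 := left_ne_zero_of_mul hφ
  have hφ2 := fun s => Finset.prod_ne_zero_iff.mp (right_ne_zero_of_mul hφ) s (Finset.mem_univ s)
  have hP0 : P.map φ ≠ 0 := fun h => hφ1 (by rw [← coeff_map, h, coeff_zero])
  refine ⟨not_isUnit_of_coeff_ne_zero hν (by rwa [coeff_map]), fun F G hFG => ?_⟩
  by_contra! hu
  have hF0 : F ≠ 0 := fun h => hP0 (by rw [hFG, h, zero_mul])
  have hG0 : G ≠ 0 := fun h => hP0 (by rw [hFG, h, mul_zero])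
  obtain ⟨μ, hμ, hFμ⟩ := exists_coeff_ne_zero_of_not_isUnit hF0 hu.1
  obtain ⟨ρ, hρ, hGρ⟩ := exists_coeff_ne_zero_of_not_isUnit hG0 hu.2
  have hdeg : F.totalDegree + G.totalDegree ≤ P.totalDegree := by
    rw [← totalDegree_mul_of_isDomain hF0 hG0, ← hFG]
    exact Finset.sup_mono (support_map_subset _ _)
  have hle : ∀ {H : MvPolynomial σ k} {ν}, coeff ν H ≠ 0 → ν.degree ≤ H.totalDegree :=
    fun h => le_totalDegree (mem_support_iff.mpr h)
  have hexp : ∀ {H : MvPolynomial σ k}, H.totalDegree ≤ P.totalDegree →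
      ∑ ν : S, monomial ν.1 (coeff ν.1 H) = H := by
    intro H hH
    ext ν
    by_cases hν : ν.degree ≤ P.totalDegree
    · exact hcoeff (fun ν => coeff ν.1 H) ⟨ν, hν⟩
    · have h1 : coeff ν H = 0 := by
        by_contra h1
        exact hν ((hle h1).trans hH)
      rw [h1, coeff_sum]
      refine Finset.sum_eq_zero fun μ _ => ?_
      rw [coeff_monomial, if_neg]
      rintro rfl
      exact hν μ.2
  let sμ : S := ⟨μ, (hle hFμ).trans (by omega)⟩
  let sρ : S := ⟨ρ, (hle hGρ).trans (by omega)⟩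
  let x : Option (S ⊕ S) → k := fun i => i.elim ((coeff μ F * coeff ρ G)⁻¹)
    (Sum.elim (fun ν => coeff ν.1 F) (fun ν => coeff ν.1 G))
  have hx := (hev φ x).mpr (by
    rw [hFG]
    exact (congrArg₂ _ (hexp (by omega)) (hexp (by omega))).symm)
  have hI : I (sμ, sρ) ≤ RingHom.ker (eval₂Hom φ x) := by
    rw [Ideal.span_le]
    rintro _ (rfl | ⟨ν, rfl⟩)
    · refine (hz φ x (sμ, sρ)).trans (sub_eq_zero.mpr ?_)
      change (coeff μ F * coeff ρ G)⁻¹ * coeff μ F * coeff ρ G = 1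
      rw [mul_assoc, inv_mul_cancel₀ (mul_ne_zero hFμ hGρ)]
    · exact hx ν
  have := hI (haI (sμ, sρ) hμ hρ)
  rw [RingHom.mem_ker, coe_eval₂Hom, eval₂_C] at this
  exact hφ2 _ this

end

/-! ### Irreducible polynomials over extensions in which `K` is algebraically closed. -/

section

open Polynomial IntermediateField

/-- An irreducible polynomial over `K` stays irreducible over a field in which `K` is algebraically
closed. -/
theorem Polynomial.irreducible_map_of_forall_isIntegral_mem_range {K L : Type} [Field K] [Field L]
    [Algebra K L] (hK : ∀ β : L, IsIntegral K β → β ∈ (algebraMap K L).range) {m : K[X]}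
    (hm : m.Monic) (hirr : Irreducible m) : Irreducible (m.map (algebraMap K L)) := by
  -- The coefficients of a monic factor over `L` of a monic polynomial over `K` are integral over
  -- `K`, hence lie in `K`.
  have hlift : ∀ f : L[X], f.Monic → f ∣ m.map (algebraMap K L) →
      ∃ f0 : K[X], f0.Monic ∧ f0.map (algebraMap K L) = f := by
    intro f hf hd
    have h1 := integralClosure.mem_lifts_of_monic_of_dvd_map L hm hf hd
    have h2 : f ∈ lifts (algebraMap K L) := by
      rw [lifts_iff_coeff_lifts] at h1 ⊢
      intro n
      obtain ⟨c, hc⟩ := h1 n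
      rw [← hc]
      exact hK _ c.2
    obtain ⟨f0, h3, -, h4⟩ := lifts_and_natDegree_eq_and_monic h2 hf
    exact ⟨f0, h4, h3⟩
  refine (irreducible_of_monic (hm.map _) ?_).mpr ?_
  · intro h
    have : m = 1 := map_injective _ (algebraMap K L).injective (by rw [h, Polynomial.map_one])
    exact hirr.not_isUnit (this ▸ isUnit_one)
  · intro f g hf hg hfg
    obtain ⟨f0, hf0, rfl⟩ := hlift f hf ⟨g, hfg.symm⟩
    obtain ⟨g0, hg0, rfl⟩ := hlift g hg ⟨_, by rw [mul_comm]; exact hfg.symm⟩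
    rw [← Polynomial.map_mul] at hfg
    have := map_injective _ (algebraMap K L).injective hfg
    rcases hirr.isUnit_or_isUnit this.symm with h | h
    · left
      rw [hf0.eq_one_of_isUnit h, Polynomial.map_one]
    · right
      rw [hg0.eq_one_of_isUnit h, Polynomial.map_one]

/-- Let `M = K(γ)`. The minimal polynomial `m` of `γ` stays irreducible over `L`, so `L' = L(γ)` has
degree `deg m` over `L`. For `E = F(γ)` one has `[E : F] ≤ deg m`, whence `[L' : E] ≥ [L : F]`.
Since `L' = E(α)`, the minimal polynomial of `α` over `F` does not factor over `E`. -/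
theorem exists_irreducible_map_minpoly (K F L M : Type) [Field K] [Field F] [Field L] [Field M]
    [CharZero K] [Algebra K F] [Algebra F L] [Algebra K L] [IsScalarTower K F L] [Algebra K M]
    [FiniteDimensional F L] [FiniteDimensional K M]
    (hK : ∀ β : L, IsIntegral K β → β ∈ (algebraMap K L).range) (α : L) (hα : F⟮α⟯ = ⊤) :
    ∃ (E : Type) (_ : Field E) (i : F →+* E) (j : M →+* E),
      i.comp (algebraMap K F) = j.comp (algebraMap K M) ∧ Irreducible ((minpoly F α).map i) := by
  let pb := Field.powerBasisOfFiniteOfSeparable K M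
  let m := minpoly K pb.gen
  have hint : IsIntegral K pb.gen := Algebra.IsIntegral.isIntegral _
  have hm : m.Monic := minpoly.monic hint
  have hmirr : Irreducible m := minpoly.irreducible hint
  have hmL := irreducible_map_of_forall_isIntegral_mem_range hK hm hmirr
  have := Fact.mk hmL
  let L' := AdjoinRoot (m.map (algebraMap K L))
  let γ : L' := AdjoinRoot.root _
  have hγ : aeval γ m = 0 := by
    have := AdjoinRoot.aeval_eq (f := m.map (algebraMap K L)) (m.map (algebraMap K L))
    rw [AdjoinRoot.mk_self, aeval_map_algebraMap] at this
    exact this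
  have hLL' : Module.finrank L L' = m.natDegree := by
    rw [(AdjoinRoot.powerBasis hmL.ne_zero).finrank, AdjoinRoot.powerBasis_dim, natDegree_map]
  have : FiniteDimensional L L' := (AdjoinRoot.powerBasis hmL.ne_zero).finite
  have : FiniteDimensional F L' := FiniteDimensional.trans F L L'
  let E := F⟮γ⟯
  have hFE : Module.finrank F E ≤ m.natDegree := by
    rw [adjoin.finrank (Algebra.IsIntegral.isIntegral γ), ← natDegree_map (algebraMap K F)]
    exact natDegree_le_of_dvd (minpoly.dvd F γ (by rw [aeval_map_algebraMap, hγ]))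
      (hm.map _).ne_zero
  have hFL : Module.finrank F L = (minpoly F α).natDegree := by
    rw [← adjoin.finrank (Algebra.IsIntegral.isIntegral α), hα, finrank_top']
  let α' : L' := algebraMap L L' α
  have hEL : (minpoly F α).natDegree ≤ Module.finrank E L' := by
    have h1 := Module.finrank_mul_finrank F E L'
    rw [← Module.finrank_mul_finrank F L L', hLL', hFL] at h1
    have h2 : 0 < m.natDegree := hmirr.natDegree_pos
    by_contra! h3
    nlinarith
  have htop : E⟮α'⟯ = ⊤ := by
    let S : IntermediateField F L' := E⟮α'⟯.restrictScalars F
    have hγS : γ ∈ S := by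
      have : algebraMap E L' (AdjoinSimple.gen F γ) ∈ E⟮α'⟯ := E⟮α'⟯.algebraMap_mem _
      exact this
    have hLS : ∀ l : L, algebraMap L L' l ∈ S := by
      intro l
      have h1 : F⟮α⟯ ≤ S.comap (IsScalarTower.toAlgHom F L L') := by
        rw [adjoin_simple_le_iff]
        exact mem_adjoin_simple_self E α'
      exact h1 (hα ▸ mem_top : l ∈ F⟮α⟯)
    rw [eq_top_iff]
    intro x _
    obtain ⟨p, rfl⟩ := AdjoinRoot.mk_surjective x
    change _ ∈ S
    rw [← AdjoinRoot.aeval_eq, aeval_eq_sum_range]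
    refine sum_mem fun k _ => ?_
    rw [Algebra.smul_def]
    exact mul_mem (hLS _) (pow_mem hγS _)
  have hdeg : (minpoly E α').natDegree = Module.finrank E L' := by
    rw [← adjoin.finrank (Algebra.IsIntegral.isIntegral α'), htop, finrank_top']
  have hEα : minpoly E α' = (minpoly F α).map (algebraMap F E) := by
    have hmon : (minpoly F α).Monic := minpoly.monic (Algebra.IsIntegral.isIntegral α)
    refine Eq.symm (eq_of_monic_of_dvd_of_natDegree_le
      (minpoly.monic (Algebra.IsIntegral.isIntegral α')) (hmon.map _) ?_ ?_)
    · refine minpoly.dvd E α' ?_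
      rw [aeval_map_algebraMap, aeval_algebraMap_apply, minpoly.aeval, map_zero]
    · rw [natDegree_map, hdeg]
      exact hEL
  let γ' : E := AdjoinSimple.gen F γ
  have hγ' : aeval γ' m = 0 := by
    apply E.val.injective
    rw [map_zero, ← hγ]
    exact (aeval_algHom_apply (E.val.restrictScalars K) γ' m).symm
  refine ⟨E, inferInstance, algebraMap F E, (pb.lift γ' hγ').toRingHom, ?_, ?_⟩
  · rw [← IsScalarTower.algebraMap_eq K F E]
    exact (pb.lift γ' hγ').comp_algebraMap.symm
  · rw [← hEα]
    exact minpoly.irreducible (Algebra.IsIntegral.isIntegral α')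

end

/-! ### Normal polynomial rings, points outside radical ideals, and primitive elements. -/

theorem MvPolynomial.isIntegrallyClosed_fin (A : Type) [CommRing A] [IsDomain A]
    [IsIntegrallyClosed A] (r : ℕ) : IsIntegrallyClosed (MvPolynomial (Fin r) A) := by
  induction r with
  | zero => exact IsIntegrallyClosed.of_equiv (MvPolynomial.isEmptyRingEquiv A (Fin 0)).symm
  | succ r ih => exact IsIntegrallyClosed.of_equiv (MvPolynomial.finSuccEquiv A r).symm.toRingEquiv

/-- The points of an affine variety separate a radical ideal from the functions outside it. -/
theorem exists_algHom_of_notMem_radical {B : Type} [CommRing B] [Algebra ℂ B]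
    [Algebra.FiniteType ℂ B] (Q : Ideal B) (b : B) (hb : b ∉ Q.radical) :
    ∃ χ : B →ₐ[ℂ] ℂ, (∀ x ∈ Q, χ x = 0) ∧ χ b ≠ 0 := by
  have : IsJacobsonRing B := isJacobsonRing_of_finiteType (A := ℂ)
  rw [Q.radical_eq_jacobson, Ideal.jacobson, Ideal.mem_sInf] at hb
  push Not at hb
  obtain ⟨m, ⟨hQm, hm⟩, hbm⟩ := hb
  let : Field (B ⧸ m) := Ideal.Quotient.field m
  have : FiniteDimensional ℂ (B ⧸ m) := finite_of_finite_type_of_isJacobsonRing ℂ (B ⧸ m)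
  let e := AlgEquiv.ofBijective (Algebra.ofId ℂ (B ⧸ m))
    (IsAlgClosed.algebraMap_bijective_of_isIntegral (k := ℂ))
  refine ⟨e.symm.toAlgHom.comp (Ideal.Quotient.mkₐ ℂ m), fun x hx => ?_, fun h => hbm ?_⟩
  · change e.symm (Ideal.Quotient.mk m x) = 0
    rw [Ideal.Quotient.eq_zero_iff_mem.mpr (hQm hx), map_zero]
  · change e.symm (Ideal.Quotient.mk m b) = 0 at h
    rw [map_eq_zero_iff _ e.symm.injective] at h
    exact Ideal.Quotient.eq_zero_iff_mem.mp h

section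

open Polynomial IntermediateField
open scoped nonZeroDivisors

/-- The primitive element theorem for the fraction fields of a finite extension of domains. -/
theorem exists_mem_adjoin_eq_top_of_finite (R B L : Type) [CommRing R] [IsDomain R] [CharZero R]
    [CommRing B] [IsDomain B] [Algebra R B] [FaithfulSMul R B] [Module.Finite R B] [Field L]
    [Algebra B L] [IsFractionRing B L] [Algebra R L] [IsScalarTower R B L] [Algebra (FractionRing R) L]
    [IsScalarTower R (FractionRing R) L] :
    FiniteDimensional (FractionRing R) L ∧
      ∃ α : B, (FractionRing R)⟮algebraMap B L α⟯ = ⊤ := by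
  have hfin : FiniteDimensional (FractionRing R) L := Module.Finite.of_isLocalization R B R⁰
  refine ⟨hfin, ?_⟩
  have : CharZero (FractionRing R) :=
    charZero_of_injective_algebraMap (IsFractionRing.injective R (FractionRing R))
  obtain ⟨β, hβ⟩ := Field.exists_primitive_element (FractionRing R) L
  -- A primitive element is `b / s` with `s` in `R`; its numerator generates the same field.
  obtain ⟨b, ⟨_, s, hs, rfl⟩, rfl⟩ :=
    IsLocalization.exists_mk'_eq (Algebra.algebraMapSubmonoid B R⁰) β
  refine ⟨b, ?_⟩
  rw [eq_top_iff, ← hβ, adjoin_simple_le_iff]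
  have hs0 : algebraMap R (FractionRing R) s ≠ 0 := fun h =>
    nonZeroDivisors.ne_zero hs (IsFractionRing.injective R (FractionRing R) (by rw [h, map_zero]))
  have h1 : IsLocalization.mk' L b (⟨algebraMap R B s, s, hs, rfl⟩ :
      Algebra.algebraMapSubmonoid B R⁰) =
      (algebraMap R (FractionRing R) s)⁻¹ • algebraMap B L b := by
    rw [IsLocalization.mk'_eq_iff_eq_mul, Algebra.smul_def, map_inv₀,
      ← IsScalarTower.algebraMap_apply, ← IsScalarTower.algebraMap_apply, mul_right_comm,
      inv_mul_cancel₀, one_mul]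
    rw [IsScalarTower.algebraMap_apply R (FractionRing R) L]
    exact (_root_.map_ne_zero _).mpr hs0
  rw [h1]
  exact (adjoin _ _).smul_mem (mem_adjoin_simple_self _ _)

/-- A finite extension of domains is generated by a primitive element up to a denominator. -/
theorem exists_ne_zero_forall_smul_eq_aeval (R B L : Type) [CommRing R] [IsDomain R]
    [CommRing B] [IsDomain B] [Algebra R B] [FaithfulSMul R B] [Module.Finite R B] [Field L]
    [Algebra B L] [IsFractionRing B L] [Algebra R L] [IsScalarTower R B L] [Algebra (FractionRing R) L]
    [IsScalarTower R (FractionRing R) L] [FiniteDimensional (FractionRing R) L] (α : B)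
    (hα : (FractionRing R)⟮algebraMap B L α⟯ = ⊤) :
    ∃ s : R, s ≠ 0 ∧ ∀ b : B, ∃ q : R[X], s • b = aeval α q := by
  let F := FractionRing R
  have h1 : ∀ b : B, ∃ s : R, s ≠ 0 ∧ ∃ q : R[X], s • b = aeval α q := by
    intro b
    have hb : algebraMap B L b ∈ (F⟮algebraMap B L α⟯).toSubalgebra := by
      rw [hα]; trivial
    rw [adjoin_simple_toSubalgebra_of_isAlgebraic (Algebra.IsAlgebraic.isAlgebraic _),
      Algebra.adjoin_singleton_eq_range_aeval] at hb
    obtain ⟨p, hp⟩ := hb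
    obtain ⟨s, hs0, hs⟩ := IsLocalization.integerNormalization_spec R⁰ p
    refine ⟨s, nonZeroDivisors.ne_zero hs0, IsLocalization.integerNormalization R⁰ p,
      IsFractionRing.injective B L ?_⟩
    rw [← aeval_algebraMap_apply, ← aeval_map_algebraMap F, hs, Algebra.smul_def, map_mul,
      ← IsScalarTower.algebraMap_apply, ← algebraMap_smul F, map_smul, Algebra.smul_def,
      ← IsScalarTower.algebraMap_apply]
    congr 1
    exact hp.symm
  choose s hs hq using h1
  obtain ⟨T, hT⟩ := (inferInstance : Module.Finite R B)
  refine ⟨∏ b ∈ T, s b, Finset.prod_ne_zero_iff.mpr fun b _ => hs b, fun b => ?_⟩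
  let N : Submodule R B := (Subalgebra.toSubmodule (aeval α : R[X] →ₐ[R] B).range).comap
    (LinearMap.lsmul R B (∏ b ∈ T, s b))
  have hN : N = ⊤ := by
    rw [eq_top_iff, ← hT, Submodule.span_le]
    intro b hb
    change (∏ b ∈ T, s b) • b ∈ (aeval α : R[X] →ₐ[R] B).range
    classical
    rw [← Finset.prod_erase_mul _ _ hb, mul_smul]
    exact Subalgebra.smul_mem _ (by obtain ⟨q, h⟩ := hq b; exact ⟨q, h.symm⟩) _
  obtain ⟨q, h⟩ : b ∈ N := hN ▸ trivial
  exact ⟨q, h.symm⟩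

theorem MvPolynomial.optionEquivLeft_symm_map {A k : Type} [CommRing A] [CommRing k] (φ : A →+* k)
    (σ : Type) (P : (MvPolynomial σ A)[X]) :
    MvPolynomial.map φ ((MvPolynomial.optionEquivLeft A σ).symm P) =
      (MvPolynomial.optionEquivLeft k σ).symm (P.map (MvPolynomial.map φ)) := by
  have : (MvPolynomial.map φ).comp
      ((MvPolynomial.optionEquivLeft A σ).symm :
        (MvPolynomial σ A)[X] →+* MvPolynomial (Option σ) A) =
      ((MvPolynomial.optionEquivLeft k σ).symm :
        (MvPolynomial σ k)[X] →+* MvPolynomial (Option σ) k).comp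
        (Polynomial.mapRingHom (MvPolynomial.map φ)) := by
    ext <;> simp
  exact congr($this P)

end

/-! ### General fibers of algebras finite over a polynomial ring. -/

section

open Polynomial IntermediateField
open scoped nonZeroDivisors

/-- Generic irreducibility of the minimal polynomial of a generator of a regular extension. -/
theorem exists_forall_irreducible_minpoly_map (A B L : Type) (r : ℕ) [CommRing A] [IsDomain A]
    [CharZero A] [IsIntegrallyClosed A] [CommRing B] [IsDomain B] [Algebra A B]
    [Algebra (MvPolynomial (Fin r) A) B] [IsScalarTower A (MvPolynomial (Fin r) A) B]
    [FaithfulSMul (MvPolynomial (Fin r) A) B] [Module.Finite (MvPolynomial (Fin r) A) B]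
    [Field L] [Algebra B L] [IsFractionRing B L] [Algebra A L] [IsScalarTower A B L]
    [Algebra (MvPolynomial (Fin r) A) L] [IsScalarTower (MvPolynomial (Fin r) A) B L]
    [Algebra (FractionRing (MvPolynomial (Fin r) A)) L]
    [IsScalarTower (MvPolynomial (Fin r) A) (FractionRing (MvPolynomial (Fin r) A)) L]
    [FiniteDimensional (FractionRing (MvPolynomial (Fin r) A)) L]
    (hAL : ∀ β : L, IsAlgebraic A β → ∃ a b : A, b ≠ 0 ∧ algebraMap A L b * β = algebraMap A L a)
    (α : B) (hα : (FractionRing (MvPolynomial (Fin r) A))⟮algebraMap B L α⟯ = ⊤) :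
    ∃ a : A, a ≠ 0 ∧ ∀ (k : Type) [Field k] (φ : A →+* k), φ a ≠ 0 →
      Irreducible ((minpoly (MvPolynomial (Fin r) A) α).map (MvPolynomial.map φ)) := by
  let R := MvPolynomial (Fin r) A
  let F := FractionRing R
  let K := FractionRing A
  have : IsIntegrallyClosed R := MvPolynomial.isIntegrallyClosed_fin A r
  have : CharZero K := charZero_of_injective_algebraMap (IsFractionRing.injective A K)
  have hALinj : Function.Injective (algebraMap A L) := by
    rw [IsScalarTower.algebraMap_eq A B L, IsScalarTower.algebraMap_eq A R B]
    exact (IsFractionRing.injective B L).comp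
      ((FaithfulSMul.algebraMap_injective R B).comp (MvPolynomial.C_injective _ _))
  have : FaithfulSMul A L := (faithfulSMul_iff_algebraMap_injective _ _).mpr hALinj
  have : FaithfulSMul A F := (faithfulSMul_iff_algebraMap_injective _ _).mpr (by
    rw [IsScalarTower.algebraMap_eq A R F]
    exact (IsFractionRing.injective R F).comp (MvPolynomial.C_injective _ _))
  let : Algebra K F := FractionRing.liftAlgebra A F
  let : Algebra K L := FractionRing.liftAlgebra A L
  have : IsScalarTower A K F := FractionRing.isScalarTower_liftAlgebra A F
  have : IsScalarTower A K L := FractionRing.isScalarTower_liftAlgebra A L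
  have hAFL : (algebraMap F L).comp (algebraMap A F) = algebraMap A L := by
    rw [IsScalarTower.algebraMap_eq A R F, ← RingHom.comp_assoc, ← IsScalarTower.algebraMap_eq R F L,
      IsScalarTower.algebraMap_eq R B L, RingHom.comp_assoc, ← IsScalarTower.algebraMap_eq A R B,
      ← IsScalarTower.algebraMap_eq A B L]
  have : IsScalarTower K F L := by
    refine IsScalarTower.of_algebraMap_eq' (IsLocalization.ringHom_ext A⁰ ?_)
    rw [RingHom.comp_assoc, ← IsScalarTower.algebraMap_eq A K F, hAFL,
      ← IsScalarTower.algebraMap_eq A K L]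
  have hK : ∀ β : L, IsIntegral K β → β ∈ (algebraMap K L).range := by
    intro β hβ
    obtain ⟨a, b, hb, h⟩ := hAL β ((IsFractionRing.isAlgebraic_iff A K L).mpr hβ.isAlgebraic)
    have hb' : algebraMap A L b ≠ 0 := fun h => hb (hALinj (by rw [h, map_zero]))
    refine ⟨algebraMap A K a / algebraMap A K b, ?_⟩
    rw [map_div₀, ← IsScalarTower.algebraMap_apply, ← IsScalarTower.algebraMap_apply,
      div_eq_iff hb', mul_comm, h]
  have hint : IsIntegral R α := Algebra.IsIntegral.isIntegral α
  have hmin : minpoly F (algebraMap B L α) = (minpoly R α).map (algebraMap R F) :=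
    minpoly.isIntegrallyClosed_eq_field_fractions F L hint
  have hirr : ∀ (M : Type) [Field M] [Algebra K M] [FiniteDimensional K M],
      Irreducible ((minpoly R α).map
        (MvPolynomial.map (σ := Fin r) ((algebraMap K M).comp (algebraMap A K)))) := by
    -- A monic polynomial is irreducible once its image over `E` is; the map `ψ` from `M[x₁, …,
    -- x_r]` exists because `E` receives both `F` and `M` compatibly over `K`.
    intro M _ _ _
    obtain ⟨E, _, i, j, hij, hE⟩ := exists_irreducible_map_minpoly K F L M hK _ hα
    let ψ : MvPolynomial (Fin r) M →+* E :=
      MvPolynomial.eval₂Hom j fun k => i (algebraMap R F (MvPolynomial.X k))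
    refine Monic.irreducible_of_irreducible_map ψ _ ((minpoly.monic hint).map _) ?_
    rw [Polynomial.map_map]
    rw [hmin, Polynomial.map_map] at hE
    convert! hE
    apply MvPolynomial.ringHom_ext
    · intro a
      have h1 := congr($hij (algebraMap A K a))
      simp only [RingHom.comp_apply] at h1
      rw [RingHom.comp_apply, MvPolynomial.map_C, MvPolynomial.coe_eval₂Hom, MvPolynomial.eval₂_C,
        RingHom.comp_apply, RingHom.comp_apply, ← h1, ← IsScalarTower.algebraMap_apply]
      rfl
    · intro k
      rw [RingHom.comp_apply, MvPolynomial.map_X, MvPolynomial.coe_eval₂Hom, MvPolynomial.eval₂_X]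
      rfl
  -- The minimal polynomial is read as a polynomial in `r + 1` variables over `A`.
  obtain ⟨a, ha, h⟩ := MvPolynomial.exists_forall_irreducible_map A K (Option (Fin r))
    ((MvPolynomial.optionEquivLeft A (Fin r)).symm (minpoly R α)) (by
      intro M _ _ _
      rw [MvPolynomial.optionEquivLeft_symm_map, MulEquiv.irreducible_iff]
      exact hirr M)
  refine ⟨a, ha, fun k _ φ hφ => ?_⟩
  have := h k φ hφ
  rwa [MvPolynomial.optionEquivLeft_symm_map, MulEquiv.irreducible_iff] at this

/-- A prime of a finite extension lying over the kernel of a reduction map is determined by the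
reduction of the minimal polynomial of a generator, if the latter is irreducible. -/
theorem mem_iff_minpoly_map_dvd {R B S : Type} [CommRing R] [CommRing B] [Algebra R B] [CommRing S]
    [IsDomain S] [UniqueFactorizationMonoid S] (φ : R →+* S) (hφ : Function.Surjective φ)
    (P : R[X]) (hP : P.Monic) (hirr : Irreducible (P.map φ)) (α : B) (hα : aeval α P = 0) (s : R)
    (hs : φ s ≠ 0) (Q : Ideal B) [Q.IsPrime] (hQ : Q.comap (algebraMap R B) = RingHom.ker φ)
    (b : B) (q : R[X]) (hq : s • b = aeval α q) : b ∈ Q ↔ P.map φ ∣ q.map φ := by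
  have hker : ∀ c : R, algebraMap R B c ∈ Q ↔ φ c = 0 := fun c => by
    rw [← Ideal.mem_comap, hQ, RingHom.mem_ker]
  have hπ : ∀ p : R[X], p.map φ = 0 → aeval α p ∈ Q := by
    intro p hp
    rw [aeval_eq_sum_range]
    refine sum_mem fun i _ => ?_
    rw [Algebra.smul_def]
    refine Q.mul_mem_right _ ((hker _).mpr ?_)
    rw [← coeff_map, hp, coeff_zero]
  have hb : b ∈ Q ↔ aeval α q ∈ Q := by
    rw [← hq, Algebra.smul_def]
    refine ⟨fun h => Q.mul_mem_left _ h, fun h => ?_⟩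
    exact (‹Q.IsPrime›.mem_or_mem h).resolve_left fun h => hs ((hker s).mp h)
  rw [hb]
  constructor
  · intro h
    by_contra hd
    have : (Ideal.span {P.map φ}).IsPrime :=
      (Ideal.span_singleton_prime hirr.ne_zero).mpr hirr.prime
    have : IsDomain (AdjoinRoot (P.map φ)) := Ideal.Quotient.isDomain _
    have : Module.Finite S (AdjoinRoot (P.map φ)) := (hP.map φ).finite_adjoinRoot
    have hne : AdjoinRoot.mk (P.map φ) (q.map φ) ≠ 0 := fun h => hd (AdjoinRoot.mk_eq_zero.mp h)
    -- The ring `S[X]/(P.map φ)` is a domain finite over `S`, so a nonzero class divides some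
    -- nonzero `c` of `S`. A lift of `c` would then lie in `Q`, against the hypothesis on `Q`.
    obtain ⟨c, hc, d, hcd⟩ := (Algebra.IsAlgebraic.isAlgebraic (R := S)
      (AdjoinRoot.mk (P.map φ) (q.map φ))).exists_nonzero_dvd (mem_nonZeroDivisors_of_ne_zero hne)
    obtain ⟨d, rfl⟩ := AdjoinRoot.mk_surjective d
    rw [AdjoinRoot.algebraMap_eq, ← AdjoinRoot.mk_C, ← map_mul, AdjoinRoot.mk_eq_mk] at hcd
    obtain ⟨g, hg⟩ := hcd
    obtain ⟨c, rfl⟩ := hφ c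
    obtain ⟨d, rfl⟩ := map_surjective φ hφ d
    obtain ⟨g, rfl⟩ := map_surjective φ hφ g
    have h1 := hπ (C c - q * d - P * g) (by
      simp only [Polynomial.map_sub, Polynomial.map_mul, map_C, hg, sub_self])
    rw [map_sub, map_sub, map_mul, map_mul, hα, zero_mul, sub_zero, aeval_C] at h1
    have h2 := Q.add_mem h1 (Q.mul_mem_right (aeval α d) h)
    rw [sub_add_cancel] at h2
    exact hc ((hker c).mp h2)
  · rintro ⟨h, hh⟩
    obtain ⟨h, rfl⟩ := map_surjective φ hφ h
    have h1 := hπ (q - P * h) (by rw [Polynomial.map_sub, Polynomial.map_mul, hh, sub_self])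
    rwa [map_sub, map_mul, hα, zero_mul, sub_zero] at h1

/-- The general fiber of a morphism of affine varieties, finite over an affine space over a normal
base, is irreducible if the extension of function fields is regular. -/
theorem exists_forall_fiber_irreducible_of_finite (A B L : Type) (r : ℕ) [CommRing A] [IsDomain A]
    [IsIntegrallyClosed A] [CommRing B] [IsDomain B] [Algebra ℂ A] [Algebra A B] [Algebra ℂ B]
    [IsScalarTower ℂ A B] [Algebra.FiniteType ℂ B]
    [Algebra (MvPolynomial (Fin r) A) B] [IsScalarTower A (MvPolynomial (Fin r) A) B]
    [FaithfulSMul (MvPolynomial (Fin r) A) B] [Module.Finite (MvPolynomial (Fin r) A) B]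
    [Field L] [Algebra B L] [IsFractionRing B L] [Algebra A L] [IsScalarTower A B L]
    (hAL : ∀ β : L, IsAlgebraic A β → ∃ a b : A, b ≠ 0 ∧ algebraMap A L b * β = algebraMap A L a) :
    ∃ a : A, a ≠ 0 ∧ ∀ y : A →ₐ[ℂ] ℂ, y a ≠ 0 →
      (∃ χ : B →ₐ[ℂ] ℂ, ∀ x, χ (algebraMap A B x) = y x) ∧
      ∀ (χ χ' : B →ₐ[ℂ] ℂ), (∀ x, χ (algebraMap A B x) = y x) →
        (∀ x, χ' (algebraMap A B x) = y x) → ∀ b b', χ b ≠ 0 → χ' b' ≠ 0 →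
        ∃ χ'' : B →ₐ[ℂ] ℂ, (∀ x, χ'' (algebraMap A B x) = y x) ∧ χ'' (b * b') ≠ 0 := by
  let R := MvPolynomial (Fin r) A
  let F := FractionRing R
  have : CharZero A := charZero_of_injective_algebraMap (algebraMap ℂ A).injective
  have : IsIntegrallyClosed R := MvPolynomial.isIntegrallyClosed_fin A r
  let : Algebra R L := ((algebraMap B L).comp (algebraMap R B)).toAlgebra
  have : IsScalarTower R B L := IsScalarTower.of_algebraMap_eq' rfl
  have : FaithfulSMul R L := (faithfulSMul_iff_algebraMap_injective _ _).mpr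
    ((IsFractionRing.injective B L).comp (FaithfulSMul.algebraMap_injective R B))
  let : Algebra F L := FractionRing.liftAlgebra R L
  have : IsScalarTower R F L := FractionRing.isScalarTower_liftAlgebra R L
  obtain ⟨_, α, hα⟩ := exists_mem_adjoin_eq_top_of_finite R B L
  obtain ⟨s, hs, hq⟩ := exists_ne_zero_forall_smul_eq_aeval R B L α hα
  obtain ⟨a, ha, hirr⟩ := exists_forall_irreducible_minpoly_map A B L r hAL α hα
  obtain ⟨ν, hν⟩ := MvPolynomial.ne_zero_iff.mp hs
  -- The second factor keeps the specialization of the common denominator `s` nonzero.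
  refine ⟨a * MvPolynomial.coeff ν s, mul_ne_zero ha hν, fun y hy => ?_⟩
  rw [map_mul] at hy
  let φ : R →+* MvPolynomial (Fin r) ℂ := MvPolynomial.map y.toRingHom
  have hφ : Function.Surjective φ := MvPolynomial.map_surjective _ fun c =>
    ⟨algebraMap ℂ A c, y.commutes c⟩
  have hφs : φ s ≠ 0 := MvPolynomial.ne_zero_iff.mpr ⟨ν, by
    rw [MvPolynomial.coeff_map]; exact right_ne_zero_of_mul hy⟩
  have hirr := hirr ℂ y.toRingHom (left_ne_zero_of_mul hy)
  have hint : IsIntegral R α := Algebra.IsIntegral.isIntegral α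
  -- At most one prime lies over `ker φ`: membership in it is divisibility by one fixed irreducible
  -- polynomial.
  have hmem : ∀ (Q Q' : Ideal B) [Q.IsPrime] [Q'.IsPrime], Q.comap (algebraMap R B) = RingHom.ker φ →
      Q'.comap (algebraMap R B) = RingHom.ker φ → ∀ b, b ∈ Q → b ∈ Q' := by
    intro Q Q' _ _ hQ hQ' b hb
    obtain ⟨q, hq⟩ := hq b
    have h1 := mem_iff_minpoly_map_dvd φ hφ _ (minpoly.monic hint) hirr α (minpoly.aeval R α) s hφs
    exact (h1 Q' hQ' b q hq).mpr ((h1 Q hQ b q hq).mp hb)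
  have hpt : ∀ (Q : Ideal B) [Q.IsPrime], Q.comap (algebraMap R B) = RingHom.ker φ → ∀ b ∉ Q,
      ∃ χ : B →ₐ[ℂ] ℂ, (∀ x, χ (algebraMap A B x) = y x) ∧ χ b ≠ 0 := by
    intro Q _ hQ b hb
    obtain ⟨χ, hχ, hχb⟩ := exists_algHom_of_notMem_radical Q b (by rwa [Ideal.IsPrime.radical ‹_›])
    refine ⟨χ, fun x => ?_, hχb⟩
    have h1 : algebraMap R B (MvPolynomial.C (x - algebraMap ℂ A (y x))) ∈ Q := by
      rw [← Ideal.mem_comap, hQ, RingHom.mem_ker, MvPolynomial.map_C]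
      have : y.toRingHom (x - algebraMap ℂ A (y x)) = 0 := by
        change y (x - algebraMap ℂ A (y x)) = 0
        rw [map_sub, y.commutes]
        exact sub_self _
      rw [this, map_zero]
    have h2 := hχ _ h1
    rw [← MvPolynomial.algebraMap_eq, ← IsScalarTower.algebraMap_apply, map_sub, map_sub,
      ← IsScalarTower.algebraMap_apply, χ.commutes] at h2
    exact sub_eq_zero.mp h2
  -- Going down, valid because `R` is normal and `B` is a domain: every point of the fiber lies in
  -- the closure of a prime over `ker φ`.
  have hgd : ∀ χ : B →ₐ[ℂ] ℂ, (∀ x, χ (algebraMap A B x) = y x) →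
      ∃ Q : Ideal B, Q.IsPrime ∧ Q.comap (algebraMap R B) = RingHom.ker φ ∧ ∀ b ∈ Q, χ b = 0 := by
    intro χ hχ
    have hprime : (RingHom.ker χ.toRingHom).IsPrime := RingHom.ker_isPrime _
    have hle : RingHom.ker φ ≤ (RingHom.ker χ.toRingHom).under R := by
      have h1 : χ.toRingHom.comp (algebraMap R B) = (MvPolynomial.eval₂Hom (RingHom.id ℂ)
          fun k => χ (algebraMap R B (MvPolynomial.X k))).comp φ := by
        apply MvPolynomial.ringHom_ext
        · intro x
          rw [RingHom.comp_apply, ← MvPolynomial.algebraMap_eq, ← IsScalarTower.algebraMap_apply]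
          simp [φ]
          exact hχ x
        · intro k
          simp [φ]
      intro x hx
      change χ.toRingHom.comp (algebraMap R B) x = 0
      rw [h1, RingHom.comp_apply, hx, map_zero]
    have : (RingHom.ker φ).IsPrime := RingHom.ker_isPrime _
    obtain ⟨Q, hQ, hQp, hQo⟩ := Ideal.exists_ideal_le_liesOver_of_le (R := R) (S := B)
      (p := RingHom.ker φ) (q := (RingHom.ker χ.toRingHom).under R) (RingHom.ker χ.toRingHom) hle
    exact ⟨Q, hQp, hQo.over.symm, fun b hb => hQ hb⟩
  constructor
  · have : (RingHom.ker φ).IsPrime := RingHom.ker_isPrime _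
    obtain ⟨Q, -, hQp, hQ⟩ := Ideal.exists_ideal_over_prime_of_isIntegral (RingHom.ker φ) (⊥ : Ideal B)
      (by
        rw [← RingHom.ker_eq_comap_bot, (RingHom.injective_iff_ker_eq_bot _).mp
          (FaithfulSMul.algebraMap_injective R B)]
        exact bot_le)
    obtain ⟨χ, hχ, -⟩ := hpt Q hQ 1 (Q.one_notMem)
    exact ⟨χ, hχ⟩
  · intro χ χ' hχ hχ' b b' hb hb'
    obtain ⟨Q, hQp, hQ, hQχ⟩ := hgd χ hχ
    obtain ⟨Q', hQp', hQ', hQχ'⟩ := hgd χ' hχ'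
    refine hpt Q hQ (b * b') fun h => ?_
    rcases hQp.mem_or_mem h with h | h
    · exact hb (hQχ b h)
    · exact hb' (hQχ' b' (hmem Q Q' hQ hQ' b' h))

end

/-! ### Noether normalization relative to the base. -/

section

open scoped nonZeroDivisors

/-- Noether normalization over the generic point of the base. -/
theorem exists_algebraicIndependent_forall_isIntegral (A B : Type) [CommRing A] [IsDomain A]
    [CommRing B] [IsDomain B] [Algebra A B] [FaithfulSMul A B] [Algebra.FiniteType A B] :
    ∃ (r : ℕ) (t : Fin r → B), Function.Injective (MvPolynomial.aeval t : MvPolynomial (Fin r) A →ₐ[A] B) ∧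
      ∀ b : B, ∃ c : A, c ≠ 0 ∧
        (MvPolynomial.aeval t : MvPolynomial (Fin r) A →ₐ[A] B).toRingHom.IsIntegralElem (c • b) := by
  let K := FractionRing A
  let L := FractionRing B
  let : Algebra K L := FractionRing.liftAlgebra A L
  have : IsScalarTower A K L := FractionRing.isScalarTower_liftAlgebra A L
  obtain ⟨T, hT⟩ := (inferInstance : Algebra.FiniteType A B)
  -- `S` is the coordinate ring of the generic fiber, to which Noether normalization over `K`
  -- applies.
  let S : Subalgebra K L := Algebra.adjoin K (algebraMap B L '' T)
  have : Algebra.FiniteType K S := by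
    rw [← Subalgebra.fg_iff_finiteType]
    classical
    exact ⟨T.image (algebraMap B L), by rw [Finset.coe_image]⟩
  have hBL : Function.Injective (algebraMap B L) := IsFractionRing.injective B L
  have hBS : ∀ b : B, algebraMap B L b ∈ S := by
    intro b
    have h1 : (⊤ : Subalgebra A B) ≤ (S.restrictScalars A).comap (IsScalarTower.toAlgHom A B L) := by
      rw [← hT, Algebra.adjoin_le_iff]
      exact fun b hb => Algebra.subset_adjoin ⟨b, hb, rfl⟩
    exact h1 trivial
  have hS : ∀ x ∈ S, ∃ (a : A) (b : B), a ≠ 0 ∧ algebraMap A L a * x = algebraMap B L b := by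
    intro x hx
    induction hx using Algebra.adjoin_induction with
    | mem x hx =>
      obtain ⟨b, -, rfl⟩ := hx
      exact ⟨1, b, one_ne_zero, by rw [map_one, one_mul]⟩
    | algebraMap k =>
      obtain ⟨a, s, hs, rfl⟩ := IsFractionRing.div_surjective (A := A) k
      refine ⟨s, algebraMap A B a, nonZeroDivisors.ne_zero hs, ?_⟩
      rw [map_div₀, ← IsScalarTower.algebraMap_apply, ← IsScalarTower.algebraMap_apply,
        ← IsScalarTower.algebraMap_apply, mul_div_cancel₀]
      intro h
      exact nonZeroDivisors.ne_zero hs (FaithfulSMul.algebraMap_injective A L (by rw [h, map_zero]))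
    | add x y _ _ hx hy =>
      obtain ⟨a, b, ha, h⟩ := hx
      obtain ⟨a', b', ha', h'⟩ := hy
      refine ⟨a * a', algebraMap A B a' * b + algebraMap A B a * b', mul_ne_zero ha ha', ?_⟩
      rw [map_add, map_mul, map_mul, map_mul, ← h, ← h', ← IsScalarTower.algebraMap_apply,
        ← IsScalarTower.algebraMap_apply]
      ring
    | mul x y _ _ hx hy =>
      obtain ⟨a, b, ha, h⟩ := hx
      obtain ⟨a', b', ha', h'⟩ := hy
      refine ⟨a * a', b * b', mul_ne_zero ha ha', ?_⟩
      rw [map_mul, map_mul, ← h, ← h']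
      ring
  obtain ⟨r, g, hg, hint⟩ := exists_integral_inj_algHom_of_fg K S
  choose a t ha hat using fun i => hS (g (MvPolynomial.X i)) (g (MvPolynomial.X i)).2
  have haK : ∀ i, algebraMap A K (a i) ≠ 0 := fun i h =>
    ha i (IsFractionRing.injective A K (by rw [h, map_zero]))
  -- Rescaling the variables by the denominators `a i` is an automorphism over `K`, and it moves the
  -- images of the variables into `B`.
  let sc : MvPolynomial (Fin r) K →ₐ[K] MvPolynomial (Fin r) K :=
    MvPolynomial.aeval fun i => MvPolynomial.C (algebraMap A K (a i)) * MvPolynomial.X i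
  let cs : MvPolynomial (Fin r) K →ₐ[K] MvPolynomial (Fin r) K :=
    MvPolynomial.aeval fun i => MvPolynomial.C (algebraMap A K (a i))⁻¹ * MvPolynomial.X i
  have hsc : ∀ x, sc (cs x) = x := by
    intro x
    change (sc.comp cs) x = AlgHom.id K _ x
    congr 1
    ext i : 1
    simp only [sc, cs, AlgHom.comp_apply, MvPolynomial.aeval_X, map_mul, MvPolynomial.algHom_C,
      MvPolynomial.algebraMap_eq, ← mul_assoc, ← MvPolynomial.C_mul, inv_mul_cancel₀ (haK i),
      AlgHom.id_apply, MvPolynomial.C_1, one_mul]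
  have hcs : ∀ x, cs (sc x) = x := by
    intro x
    change (cs.comp sc) x = AlgHom.id K _ x
    congr 1
    ext i : 1
    simp only [sc, cs, AlgHom.comp_apply, MvPolynomial.aeval_X, map_mul, MvPolynomial.algHom_C,
      MvPolynomial.algebraMap_eq, ← mul_assoc, ← MvPolynomial.C_mul, mul_inv_cancel₀ (haK i),
      AlgHom.id_apply, MvPolynomial.C_1, one_mul]
  let g' := g.comp sc
  have hg'inj : Function.Injective g' := hg.comp (Function.LeftInverse.injective hcs)
  have hg'int : ∀ x, g'.toRingHom.IsIntegralElem x := by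
    intro x
    refine RingHom.IsIntegralElem.of_comp (f := cs.toRingHom) ?_
    have heq : g'.toRingHom.comp cs.toRingHom = g.toRingHom :=
      RingHom.ext fun x => congrArg g (hsc x)
    rw [heq]
    exact hint x
  let f : MvPolynomial (Fin r) A →ₐ[A] B := MvPolynomial.aeval t
  let ιB : B →+* S := (algebraMap B L).codRestrict S hBS
  have hιB : Function.Injective ιB := fun x y h => hBL (congrArg Subtype.val h)
  have hcomm : ιB.comp f.toRingHom = g'.toRingHom.comp (MvPolynomial.map (algebraMap A K)) := by
    apply MvPolynomial.ringHom_ext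
    · intro c
      apply Subtype.ext
      change algebraMap B L (f (MvPolynomial.C c)) = (g' (MvPolynomial.map _ (MvPolynomial.C c)) : L)
      rw [MvPolynomial.map_C, MvPolynomial.algHom_C, MvPolynomial.algHom_C,
        ← IsScalarTower.algebraMap_apply]
      change _ = algebraMap K L (algebraMap A K c)
      rw [← IsScalarTower.algebraMap_apply]
    · intro i
      apply Subtype.ext
      change algebraMap B L (f (MvPolynomial.X i)) = (g' (MvPolynomial.map _ (MvPolynomial.X i)) : L)
      rw [MvPolynomial.map_X, MvPolynomial.aeval_X, ← hat]
      change _ = (g (sc (MvPolynomial.X i)) : L)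
      rw [MvPolynomial.aeval_X, map_mul, MvPolynomial.algHom_C]
      change _ = algebraMap K L (algebraMap A K (a i)) * _
      rw [← IsScalarTower.algebraMap_apply]
  refine ⟨r, t, ?_, fun b => ?_⟩
  · have h1 : Function.Injective (ιB.comp f.toRingHom) := by
      rw [hcomm]
      exact hg'inj.comp (MvPolynomial.map_injective _ (IsFractionRing.injective A K))
    exact fun x y h => h1 (congrArg ιB h)
  · let : Algebra (MvPolynomial (Fin r) A) (MvPolynomial (Fin r) K) := MvPolynomial.algebraMvPolynomial
    let : Algebra (MvPolynomial (Fin r) K) S := g'.toRingHom.toAlgebra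
    let : Algebra (MvPolynomial (Fin r) A) S :=
      (g'.toRingHom.comp (MvPolynomial.map (algebraMap A K))).toAlgebra
    have : IsScalarTower (MvPolynomial (Fin r) A) (MvPolynomial (Fin r) K) S :=
      IsScalarTower.of_algebraMap_eq' rfl
    obtain ⟨⟨_, c, hc, rfl⟩, hcb⟩ := IsIntegral.exists_multiple_integral_of_isLocalization
      (A⁰.map (MvPolynomial.C (σ := Fin r))) (Rₘ := MvPolynomial (Fin r) K) (ιB b) (hg'int _)
    refine ⟨c, nonZeroDivisors.ne_zero hc, ?_⟩
    obtain ⟨p, hp, hpe⟩ := hcb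
    refine ⟨p, hp, hιB ?_⟩
    rw [map_zero, ← hpe]
    have h1 : algebraMap (MvPolynomial (Fin r) A) S = ιB.comp f.toRingHom := hcomm.symm
    have h2 : (⟨MvPolynomial.C c, c, hc, rfl⟩ : A⁰.map (MvPolynomial.C (σ := Fin r))) • ιB b =
        ιB (c • b) := by
      change (MvPolynomial.C c : MvPolynomial (Fin r) A) • ιB b = _
      rw [Algebra.smul_def, h1, Algebra.smul_def, map_mul]
      congr 1
      change ιB (f (MvPolynomial.C c)) = _
      rw [MvPolynomial.algHom_C]
    rw [h2, h1]
    exact Polynomial.hom_eval₂ p f.toRingHom ιB (c • b)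

end

/-! ### The affine case of part (b). -/

section

open scoped nonZeroDivisors TensorProduct

theorem exists_algHom_localizationAway (B : Type) [CommRing B] [Algebra ℂ B] (g : B)
    (χ : B →ₐ[ℂ] ℂ) (hg : χ g ≠ 0) : ∃ χ' : Localization.Away g →ₐ[ℂ] ℂ,
      ∀ b, χ' (algebraMap B (Localization.Away g) b) = χ b := by
  have hu : ∀ s : Submonoid.powers g, IsUnit (χ s) := by
    rintro ⟨_, n, rfl⟩
    exact isUnit_iff_ne_zero.mpr (by rw [map_pow]; exact pow_ne_zero _ hg)
  exact ⟨IsLocalization.liftAlgHom (M := Submonoid.powers g) hu, fun b => IsLocalization.lift_eq _ b⟩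

/-- The general fiber of a dominant morphism of affine varieties with normal target is
irreducible, if its fiber square is so in the sense that zero divisors are nilpotent. -/
theorem exists_forall_fiber_irreducible (A B : Type) [CommRing A] [IsDomain A]
    [IsIntegrallyClosed A] [CommRing B] [IsDomain B] [Algebra ℂ A] [Algebra A B] [Algebra ℂ B]
    [IsScalarTower ℂ A B] [Algebra.FiniteType ℂ B] [FaithfulSMul A B]
    (H : ∀ g : B, g ≠ 0 → ∀ u w : Localization.Away g ⊗[A] Localization.Away g,
      u * w = 0 → IsNilpotent u ∨ IsNilpotent w) :
    ∃ a : A, a ≠ 0 ∧ ∀ y : A →ₐ[ℂ] ℂ, y a ≠ 0 →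
      (∃ χ : B →ₐ[ℂ] ℂ, ∀ x, χ (algebraMap A B x) = y x) ∧
      ∀ (χ χ' : B →ₐ[ℂ] ℂ), (∀ x, χ (algebraMap A B x) = y x) →
        (∀ x, χ' (algebraMap A B x) = y x) → ∀ b b', χ b ≠ 0 → χ' b' ≠ 0 →
        ∃ χ'' : B →ₐ[ℂ] ℂ, (∀ x, χ'' (algebraMap A B x) = y x) ∧ χ'' (b * b') ≠ 0 := by
  have : Algebra.FiniteType A B := .of_restrictScalars_finiteType ℂ A B
  have : CharZero A := charZero_of_injective_algebraMap (algebraMap ℂ A).injective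
  have hABinj := FaithfulSMul.algebraMap_injective A B
  obtain ⟨r, t, ht, hint⟩ := exists_algebraicIndependent_forall_isIntegral A B
  obtain ⟨T, hT⟩ := (inferInstance : Algebra.FiniteType ℂ B)
  choose c hc hcint using hint
  -- Inverting one denominator for each of finitely many algebra generators makes the whole
  -- localized algebra integral over the polynomial ring.
  let a := ∏ b ∈ T, c b
  have ha : a ≠ 0 := Finset.prod_ne_zero_iff.mpr fun b _ => hc b
  let g := algebraMap A B a
  have hg : g ≠ 0 := fun h => ha (hABinj (by rw [map_zero]; exact h))
  have hleA : Submonoid.powers a ≤ A⁰ := powers_le_nonZeroDivisors_of_noZeroDivisors ha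
  have hleB : Submonoid.powers g ≤ B⁰ := powers_le_nonZeroDivisors_of_noZeroDivisors hg
  let A' := Localization.Away a
  let B' := Localization.Away g
  let L := FractionRing B
  have : IsDomain A' := IsLocalization.isDomain_of_le_nonZeroDivisors _ hleA
  have : IsDomain B' := IsLocalization.isDomain_of_le_nonZeroDivisors _ hleB
  have : IsIntegrallyClosed A' := isIntegrallyClosed_of_isLocalization (R := A) A' (Submonoid.powers a) hleA
  have hpow : Submonoid.powers a ≤ (Submonoid.powers g).comap (algebraMap A B) := by
    rintro _ ⟨n, rfl⟩
    exact ⟨n, (map_pow _ _ _).symm⟩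
  let : Algebra A' B' :=
    (IsLocalization.map B' (algebraMap A B) hpow : A' →+* B').toAlgebra
  have hA'B' : ∀ x : A, algebraMap A' B' (algebraMap A A' x) = algebraMap B B' (algebraMap A B x) :=
    fun x =>
    IsLocalization.map_eq (M := Submonoid.powers a) (T := Submonoid.powers g) (Q := B') hpow x
  have : IsScalarTower A A' B' := IsScalarTower.of_algebraMap_eq fun x => by
    rw [hA'B', ← IsScalarTower.algebraMap_apply]
  have : IsScalarTower ℂ A' B' := IsScalarTower.of_algebraMap_eq fun x => by
    rw [IsScalarTower.algebraMap_apply ℂ A A', hA'B', ← IsScalarTower.algebraMap_apply,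
      ← IsScalarTower.algebraMap_apply]
  have : Algebra.FiniteType B B' := IsLocalization.finiteType_of_monoid_fg (Submonoid.powers g) _
  have : Algebra.FiniteType ℂ B' := .trans ‹Algebra.FiniteType ℂ B› this
  let f : MvPolynomial (Fin r) A' →ₐ[A'] B' := MvPolynomial.aeval fun i => algebraMap B B' (t i)
  let : Algebra (MvPolynomial (Fin r) A') B' := f.toRingHom.toAlgebra
  have : IsScalarTower A' (MvPolynomial (Fin r) A') B' :=
    IsScalarTower.of_algebraMap_eq fun x => (f.commutes x).symm
  have : IsScalarTower ℂ (MvPolynomial (Fin r) A') B' := IsScalarTower.of_algebraMap_eq fun x => by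
    rw [IsScalarTower.algebraMap_apply ℂ A' (MvPolynomial (Fin r) A'),
      ← IsScalarTower.algebraMap_apply A' (MvPolynomial (Fin r) A') B',
      ← IsScalarTower.algebraMap_apply]
  have hcomm : f.toRingHom.comp (MvPolynomial.map (algebraMap A A')) =
      (algebraMap B B').comp (MvPolynomial.aeval t : MvPolynomial (Fin r) A →ₐ[A] B).toRingHom := by
    apply MvPolynomial.ringHom_ext
    · intro x
      simp [f, hA'B']
    · intro i
      simp [f]
  have hcomm' : ∀ p, f (MvPolynomial.map (algebraMap A A') p) =
      algebraMap B B' (MvPolynomial.aeval t p) := fun p => congr($hcomm p)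
  have hfinj : Function.Injective f := by
    let : Algebra (MvPolynomial (Fin r) A) (MvPolynomial (Fin r) A') :=
      MvPolynomial.algebraMvPolynomial
    rw [injective_iff_map_eq_zero]
    intro p hp
    obtain ⟨⟨p₀, m⟩, h⟩ := IsLocalization.surj
      ((Submonoid.powers a).map (MvPolynomial.C (σ := Fin r))) p
    have h1 : algebraMap B B' (MvPolynomial.aeval t p₀) = 0 := by
      rw [← hcomm']
      exact (congrArg f h.symm).trans (by rw [map_mul, hp, zero_mul])
    have h2 := ht ((IsLocalization.injective B' hleB (h1.trans (map_zero _).symm)).trans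
      (map_zero _).symm)
    rw [h2, map_zero] at h
    exact ((IsLocalization.map_units _ m).mul_left_eq_zero).mp h
  have : FaithfulSMul (MvPolynomial (Fin r) A') B' :=
    (faithfulSMul_iff_algebraMap_injective _ _).mpr hfinj
  have hunit : ∀ (x : A) (z : B'), IsUnit (algebraMap A A' x) →
      IsIntegral (MvPolynomial (Fin r) A') (z * algebraMap B B' (algebraMap A B x)) →
      IsIntegral (MvPolynomial (Fin r) A') z := by
    intro x z hx hz
    obtain ⟨v, hv⟩ := hx.exists_right_inv
    have h1 := hz.mul (isIntegral_algebraMap (R := MvPolynomial (Fin r) A')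
      (x := MvPolynomial.C v))
    have h2 : algebraMap B B' (algebraMap A B x) *
        algebraMap (MvPolynomial (Fin r) A') B' (MvPolynomial.C v) = 1 := by
      rw [← hA'B', ← MvPolynomial.algebraMap_eq,
        ← IsScalarTower.algebraMap_apply A' (MvPolynomial (Fin r) A') B' v, ← map_mul, hv, map_one]
    rwa [mul_assoc, h2, mul_one] at h1
  have hau : IsUnit (algebraMap A A' a) := IsLocalization.Away.algebraMap_isUnit a
  have hfint : Algebra.IsIntegral (MvPolynomial (Fin r) A') B' := by
    have hB : ∀ b : B, IsIntegral (MvPolynomial (Fin r) A') (algebraMap B B' b) := by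
      intro b
      have h1 : (⊤ : Subalgebra ℂ B) ≤
          ((integralClosure (MvPolynomial (Fin r) A') B').restrictScalars ℂ).comap
            (IsScalarTower.toAlgHom ℂ B B') := by
        rw [← hT, Algebra.adjoin_le_iff]
        intro b hb
        change IsIntegral (MvPolynomial (Fin r) A') (algebraMap B B' b)
        refine hunit (c b) _ (isUnit_of_dvd_unit (map_dvd _ (Finset.dvd_prod_of_mem c hb)) hau) ?_
        obtain ⟨p, hp, hpe⟩ := hcint b
        refine ⟨p.map (MvPolynomial.map (algebraMap A A')), hp.map _, ?_⟩
        rw [← map_mul, mul_comm, ← Algebra.smul_def, Polynomial.eval₂_map]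
        change Polynomial.eval₂ (f.toRingHom.comp _) _ p = 0
        rw [hcomm, ← Polynomial.hom_eval₂, hpe, map_zero]
      exact h1 (x := b) trivial
    refine ⟨fun z => ?_⟩
    obtain ⟨⟨b, ⟨_, n, rfl⟩⟩, h⟩ := IsLocalization.surj (Submonoid.powers g) z
    refine hunit (a ^ n) z (by rw [map_pow]; exact hau.pow n) ?_
    rw [map_pow]
    exact h ▸ hB b
  have : Algebra.FiniteType (MvPolynomial (Fin r) A') B' :=
    .of_restrictScalars_finiteType ℂ _ _
  have : Module.Finite (MvPolynomial (Fin r) A') B' := Algebra.IsIntegral.finite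
  let ψ : B' →ₐ[B] L := IsLocalization.liftAlgHom (M := Submonoid.powers g) (f := Algebra.ofId B L)
    (fun s => (IsLocalization.map_units L (⟨s, hleB s.2⟩ : nonZeroDivisors B)))
  let : Algebra B' L := ψ.toRingHom.toAlgebra
  have : IsScalarTower B B' L := IsScalarTower.of_algebraMap_eq fun x => (ψ.commutes x).symm
  have : IsFractionRing B' L :=
    IsFractionRing.isFractionRing_of_isDomain_of_isLocalization (Submonoid.powers g) B' L
  let : Algebra A' L := ((algebraMap B' L).comp (algebraMap A' B')).toAlgebra
  have : IsScalarTower A' B' L := IsScalarTower.of_algebraMap_eq' rfl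
  have : IsScalarTower A A' L := IsScalarTower.of_algebraMap_eq fun x => by
    rw [IsScalarTower.algebraMap_apply A' B' L, hA'B', ← IsScalarTower.algebraMap_apply,
      ← IsScalarTower.algebraMap_apply]
  obtain ⟨a', ha', hfib⟩ := exists_forall_fiber_irreducible_of_finite A' B' L r (by
    intro β hβ
    have : Algebra.IsAlgebraic A A' := IsLocalization.isAlgebraic A' (Submonoid.powers a)
    let K := FractionRing A
    let : Algebra K L := FractionRing.liftAlgebra A L
    have : IsScalarTower A K L := FractionRing.isScalarTower_liftAlgebra A L
    have h1 : IsAlgebraic K β :=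
      (IsFractionRing.isAlgebraic_iff A K L).mp (hβ.restrictScalars A)
    obtain ⟨k, rfl⟩ := mem_range_of_isIntegral_fractionRing A B K L H β h1.isIntegral
    obtain ⟨x, s, hs, rfl⟩ := IsFractionRing.div_surjective (A := A) k
    have hsL : algebraMap A L s ≠ 0 := fun h =>
      nonZeroDivisors.ne_zero hs (FaithfulSMul.algebraMap_injective A L (by rw [h, map_zero]))
    refine ⟨algebraMap A A' x, algebraMap A A' s, fun h => nonZeroDivisors.ne_zero hs
      (IsLocalization.injective A' hleA (by rw [h, map_zero])), ?_⟩
    rw [map_div₀, ← IsScalarTower.algebraMap_apply, ← IsScalarTower.algebraMap_apply,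
      ← IsScalarTower.algebraMap_apply, ← IsScalarTower.algebraMap_apply, mul_div_cancel₀ _ hsL])
  obtain ⟨a₀, ⟨_, n, rfl⟩, rfl⟩ := IsLocalization.exists_mk'_eq (Submonoid.powers a) a'
  have ha₀ : a₀ ≠ 0 := by
    rintro rfl
    exact ha' (IsLocalization.mk'_zero _)
  -- Here `a' = a₀ / a ^ n`: if `y a ≠ 0`, then `y` extends to `A'`, and `y a₀ ≠ 0` means that the
  -- extension does not vanish at `a'`.
  refine ⟨a * a₀, mul_ne_zero ha ha₀, fun y hy => ?_⟩
  rw [map_mul] at hy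
  obtain ⟨y', hy'⟩ := exists_algHom_localizationAway A a y (left_ne_zero_of_mul hy)
  have hya : y' (IsLocalization.mk' A' a₀ (⟨a ^ n, n, rfl⟩ : Submonoid.powers a)) ≠ 0 := by
    intro h
    have h1 := congrArg y' (IsLocalization.mk'_spec A' a₀ (⟨a ^ n, n, rfl⟩ : Submonoid.powers a))
    rw [map_mul, h, zero_mul, hy'] at h1
    exact right_ne_zero_of_mul hy h1.symm
  obtain ⟨hex, hirr⟩ := hfib y' hya
  have hres : ∀ χ : B' →ₐ[ℂ] ℂ, (∀ x, χ (algebraMap A' B' x) = y' x) →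
      ∀ x, (χ.comp (IsScalarTower.toAlgHom ℂ B B')) (algebraMap A B x) = y x := by
    intro χ hχ x
    rw [← hy', ← hχ, hA'B']
    rfl
  have hlift : ∀ χ : B →ₐ[ℂ] ℂ, (∀ x, χ (algebraMap A B x) = y x) → ∃ χ' : B' →ₐ[ℂ] ℂ,
      (∀ x, χ' (algebraMap A' B' x) = y' x) ∧ ∀ b, χ' (algebraMap B B' b) = χ b := by
    intro χ hχ
    obtain ⟨χ', hχ'⟩ := exists_algHom_localizationAway B g χ (by
      rw [hχ]; exact left_ne_zero_of_mul hy)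
    refine ⟨χ', fun x => ?_, hχ'⟩
    have h1 : χ'.toRingHom.comp (algebraMap A' B') = y'.toRingHom := by
      refine IsLocalization.ringHom_ext (Submonoid.powers a) (RingHom.ext fun x => ?_)
      change χ' (algebraMap A' B' (algebraMap A A' x)) = y' (algebraMap A A' x)
      rw [hA'B', hχ', hχ, hy']
    exact congr($h1 x)
  constructor
  · obtain ⟨χ, hχ⟩ := hex
    exact ⟨_, hres χ hχ⟩
  · intro χ₁ χ₂ h₁ h₂ b b' hb hb'
    obtain ⟨χ₁', h₁', hb₁⟩ := hlift χ₁ h₁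
    obtain ⟨χ₂', h₂', hb₂⟩ := hlift χ₂ h₂
    obtain ⟨χ, hχ, hχb⟩ := hirr χ₁' χ₂' h₁' h₂' (algebraMap B B' b) (algebraMap B B' b')
      (by rwa [hb₁]) (by rwa [hb₂])
    refine ⟨_, hres χ hχ, ?_⟩
    rwa [← map_mul] at hχb

end

/-! ### Part (b): passage to varieties and gluing over patches. -/

section

open scoped TensorProduct

theorem finiteType_tensorProduct (k B : Type) [CommRing k] [CommRing B] [Algebra k B]
    [Algebra.FiniteType k B] : Algebra.FiniteType k (B ⊗[k] B) := by
  have h1 : Algebra.FiniteType B (B ⊗[k] B) := inferInstance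
  exact Algebra.FiniteType.trans (S := B) ‹_› h1

namespace FiberProduct

variable {X Y : Scheme.{0}} [X.Over SpecC] [Y.Over SpecC]

namespace AffinePatch

theorem point_pt_mem_range_basicOpen (c : AffinePatch X) (g : c.A) (χ : c.A →ₐ[ℂ] ℂ) :
    (c.point χ).pt ∈ Set.range (c.basicOpen g).ι ↔ χ g ≠ 0 := by
  rw [point_pt, mem_range_basicOpen]
  rfl

theorem exists_basicOpen_subset (c : AffinePatch X) (U : Set X) (hU : IsOpen U) (χ : c.A →ₐ[ℂ] ℂ)
    (h : (c.point χ).pt ∈ U) : ∃ g, χ g ≠ 0 ∧ Set.range (c.basicOpen g).ι ⊆ U := by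
  rw [point_pt] at h
  have ho : IsOpen ((c.ι : PrimeSpectrum c.A → X) ⁻¹' U) := hU.preimage c.ι.continuous
  obtain ⟨_, ⟨g, rfl⟩, hpg, hg⟩ :=
    PrimeSpectrum.isTopologicalBasis_basic_opens.exists_subset_of_mem_open
      (show (⟨RingHom.ker χ.toRingHom, RingHom.ker_isPrime _⟩ : PrimeSpectrum c.A) ∈ _ from h) ho
  refine ⟨g, hpg, ?_⟩
  rintro x hx
  obtain ⟨q, rfl⟩ := c.range_basicOpen_subset g hx
  exact hg ((c.mem_range_basicOpen g q).mp hx)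

/-- The complex points of `B ⊗[A] B` are the points of the fiber square in the product patch. A
function that is not nilpotent is nonzero at some such point; irreducibility would make both `u` and
`w` nonzero at a common point, against `u * w = 0`. -/
theorem isNilpotent_or_isNilpotent [LocallyOfFiniteType (X ↘ SpecC)] (f : X ⟶ Y) [f.IsOver SpecC]
    (hf : IsZariskiIrreducible (fiberSquare f)) (c : AffinePatch X) (e : AffinePatch Y)
    [Algebra e.A c.A] [IsScalarTower ℂ e.A c.A]
    (h : c.ι ≫ f = Spec.map (CommRingCat.ofHom (algebraMap e.A c.A)) ≫ e.ι)
    (u w : c.A ⊗[e.A] c.A) (huw : u * w = 0) : IsNilpotent u ∨ IsNilpotent w := by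
  let φ : e.A →ₐ[ℂ] c.A := IsScalarTower.toAlgHom ℂ e.A c.A
  have h : c.ι ≫ f = Spec.map (CommRingCat.ofHom φ.toRingHom) ≫ e.ι := h
  have := c.finiteType
  have hmem : ∀ α : (c.prod c).A →ₐ[ℂ] ℂ, (c.prod c).point α ∈ fiberSquare f ↔
      (α.comp (c.inl c)).comp φ = (α.comp (c.inr c)).comp φ := by
    intro α
    change (((c.prod c).point α).map _).map f = (((c.prod c).point α).map _).map f ↔ _
    rw [prod_point_fst, prod_point_snd, point_map f c e φ h, point_map f c e φ h]
    exact e.point_injective.eq_iff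
  let π : (c.prod c).A →ₐ[ℂ] c.A ⊗[e.A] c.A :=
    (Algebra.TensorProduct.lift (Algebra.TensorProduct.includeLeft : c.A →ₐ[ℂ] c.A ⊗[e.A] c.A)
      ((Algebra.TensorProduct.includeRight : c.A →ₐ[e.A] c.A ⊗[e.A] c.A).restrictScalars ℂ)
      (fun _ _ => .all _ _) : c.A ⊗[ℂ] c.A →ₐ[ℂ] c.A ⊗[e.A] c.A)
  have hπl : ∀ b, π (c.inl c b) = b ⊗ₜ 1 := fun b =>
    (Algebra.TensorProduct.lift_tmul ..).trans (by simp)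
  have hπr : ∀ b, π (c.inr c b) = 1 ⊗ₜ b := fun b =>
    (Algebra.TensorProduct.lift_tmul ..).trans (by simp)
  have hπ : Function.Surjective π := by
    intro z
    induction z using TensorProduct.induction_on with
    | zero => exact ⟨0, map_zero _⟩
    | add x y hx hy =>
      obtain ⟨x, rfl⟩ := hx
      obtain ⟨y, rfl⟩ := hy
      exact ⟨x + y, map_add _ _ _⟩
    | tmul b b' => exact ⟨c.inl c b * c.inr c b', by rw [map_mul, hπl, hπr]; simp⟩
  have : Algebra.FiniteType ℂ (c.prod c).A := finiteType_tensorProduct ℂ c.A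
  have : Algebra.FiniteType ℂ (c.A ⊗[e.A] c.A) := .of_surjective π hπ
  obtain ⟨u, rfl⟩ := hπ u
  obtain ⟨w, rfl⟩ := hπ w
  have key : ∀ v, ¬ IsNilpotent (π v) →
      (CPoint.pt '' fiberSquare f ∩ Set.range ((c.prod c).basicOpen v).ι).Nonempty := by
    intro v hv
    obtain ⟨χ, -, hχ⟩ := exists_algHom_of_notMem_radical (⊥ : Ideal (c.A ⊗[e.A] c.A)) (π v) hv
    refine ⟨_, ⟨(c.prod c).point (χ.comp π), (hmem _).mpr (AlgHom.ext fun x => ?_), rfl⟩,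
      ((c.prod c).point_pt_mem_range_basicOpen v _).mpr hχ⟩
    change χ (π (c.inl c (algebraMap e.A c.A x))) = χ (π (c.inr c (algebraMap e.A c.A x)))
    rw [hπl, hπr, Algebra.TensorProduct.tmul_one_eq_one_tmul]
  by_contra! hn
  obtain ⟨_, ⟨z, hz, rfl⟩, hzu, hzw⟩ := hf.isPreirreducible _ _
    ((c.prod c).basicOpen u).ι.isOpenEmbedding.isOpen_range
    ((c.prod c).basicOpen w).ι.isOpenEmbedding.isOpen_range (key u hn.1) (key w hn.2)
  obtain ⟨α, rfl⟩ := (c.prod c).exists_point_eq z ((c.prod c).range_basicOpen_subset u hzu)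
  rw [point_pt_mem_range_basicOpen] at hzu hzw
  have hα := (hmem α).mp hz
  let : Algebra e.A ℂ := ((α.comp (c.inl c)).comp φ).toRingHom.toAlgebra
  let χ₁ : c.A →ₐ[e.A] ℂ := { (α.comp (c.inl c)).toRingHom with commutes' := fun _ => rfl }
  let χ₂ : c.A →ₐ[e.A] ℂ :=
    { (α.comp (c.inr c)).toRingHom with commutes' := fun x => congr($hα x).symm }
  -- The common point, given on `B ⊗[ℂ] B`, factors through `B ⊗[A] B` because its components have
  -- the same image.
  let ψ : c.A ⊗[e.A] c.A →ₐ[e.A] ℂ := Algebra.TensorProduct.lift χ₁ χ₂ fun _ _ => .all _ _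
  have hψ : ∀ v, ψ (π v) = α v := by
    intro v
    induction v using TensorProduct.induction_on with
    | zero => exact ((congrArg ψ (map_zero π)).trans (map_zero ψ)).trans (map_zero α).symm
    | add x y hx hy =>
      exact ((congrArg ψ (map_add π x y)).trans (map_add ψ _ _)).trans
        ((congrArg₂ _ hx hy).trans (map_add α x y).symm)
    | tmul b b' =>
      have h1 : (b ⊗ₜ[ℂ] b' : c.A ⊗[ℂ] c.A) = b ⊗ₜ 1 * 1 ⊗ₜ b' := by simp
      have h2 : (b ⊗ₜ[ℂ] b' : c.A ⊗[ℂ] c.A) = (c.inl c b * c.inr c b' : (c.prod c).A) := h1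
      rw [h2, map_mul, map_mul, map_mul, hπl, hπr]
      congr 1
      · exact (Algebra.TensorProduct.lift_tmul ..).trans (by rw [map_one, mul_one]; rfl)
      · exact (Algebra.TensorProduct.lift_tmul ..).trans (by rw [map_one, one_mul]; rfl)
  have h0 := congrArg ψ huw
  rw [map_mul, hψ, hψ, map_zero] at h0
  exact (mul_ne_zero hzu hzw) h0

theorem exists_forall_fiber_inter [IsIntegral X] [IsIntegral Y] [LocallyOfFiniteType (X ↘ SpecC)]
    (f : X ⟶ Y) [f.IsOver SpecC] [IsDominant f] (hf : IsZariskiIrreducible (fiberSquare f))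
    (c : AffinePatch X) (e : AffinePatch Y) [IsIntegrallyClosed e.A]
    (hc : (Set.range c.ι).Nonempty) (hce : Set.range c.ι ⊆ f ⁻¹' Set.range e.ι) :
    ∃ a : e.A, a ≠ 0 ∧ ∀ y : e.A →ₐ[ℂ] ℂ, y a ≠ 0 →
      (∃ p ∈ fiber f (e.point y), p.pt ∈ Set.range c.ι) ∧
      ∀ U V : Set X, IsOpen U → IsOpen V →
        (∃ p ∈ fiber f (e.point y), p.pt ∈ Set.range c.ι ∩ U) →
        (∃ p ∈ fiber f (e.point y), p.pt ∈ Set.range c.ι ∩ V) →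
        ∃ p ∈ fiber f (e.point y), p.pt ∈ Set.range c.ι ∩ (U ∩ V) := by
  obtain ⟨φ, hφ⟩ := exists_map_eq f c e hce
  have hinj := c.algHom_injective f e φ hφ hc
  have := c.isDomain hc
  have := e.isDomain (by obtain ⟨x, hx⟩ := hc; exact ⟨_, hce hx⟩)
  have := c.finiteType
  let : Algebra e.A c.A := φ.toRingHom.toAlgebra
  have : IsScalarTower ℂ e.A c.A := IsScalarTower.of_algebraMap_eq fun x => (φ.commutes x).symm
  have : FaithfulSMul e.A c.A := (faithfulSMul_iff_algebraMap_injective _ _).mpr hinj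
  have hmem : ∀ (y : e.A →ₐ[ℂ] ℂ) (χ : c.A →ₐ[ℂ] ℂ), c.point χ ∈ fiber f (e.point y) ↔
      ∀ x, χ (algebraMap e.A c.A x) = y x := by
    intro y χ
    change (c.point χ).map f = e.point y ↔ _
    rw [point_map f c e φ hφ, e.point_injective.eq_iff]
    exact AlgHom.ext_iff
  obtain ⟨a, ha, h⟩ := exists_forall_fiber_irreducible e.A c.A (by
    intro g _ u w huw
    let : Algebra e.A (c.basicOpen g).A := inferInstanceAs (Algebra e.A (Localization.Away g))
    have : IsScalarTower ℂ e.A (c.basicOpen g).A :=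
      inferInstanceAs (IsScalarTower ℂ e.A (Localization.Away g))
    refine isNilpotent_or_isNilpotent f hf (c.basicOpen g) e ?_ u w huw
    change (Spec.map (CommRingCat.ofHom (algebraMap c.A (Localization.Away g))) ≫ c.ι) ≫ f = _
    rw [Category.assoc, hφ, ← Category.assoc, ← Spec.map_comp, ← CommRingCat.ofHom_comp]
    rfl)
  refine ⟨a, ha, fun y hy => ?_⟩
  obtain ⟨⟨χ, hχ⟩, hirr⟩ := h y hy
  refine ⟨⟨c.point χ, (hmem y χ).mpr hχ, c.point_pt_mem_range χ⟩, ?_⟩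
  rintro U V hU hV ⟨p, hp, hpc, hpU⟩ ⟨q, hq, hqc, hqV⟩
  obtain ⟨χ₁, rfl⟩ := c.exists_point_eq p hpc
  obtain ⟨χ₂, rfl⟩ := c.exists_point_eq q hqc
  obtain ⟨b₁, hb₁, hbU⟩ := c.exists_basicOpen_subset U hU χ₁ hpU
  obtain ⟨b₂, hb₂, hbV⟩ := c.exists_basicOpen_subset V hV χ₂ hqV
  obtain ⟨χ₃, hχ₃, hb⟩ := hirr χ₁ χ₂ ((hmem y χ₁).mp hp) ((hmem y χ₂).mp hq) b₁ b₂ hb₁ hb₂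
  rw [map_mul] at hb
  exact ⟨c.point χ₃, (hmem y χ₃).mpr hχ₃, c.point_pt_mem_range χ₃,
    hbU ((c.point_pt_mem_range_basicOpen b₁ χ₃).mpr (left_ne_zero_of_mul hb)),
    hbV ((c.point_pt_mem_range_basicOpen b₂ χ₃).mpr (right_ne_zero_of_mul hb))⟩

end AffinePatch

/-- On each patch of a finite cover the general fiber is irreducible. Any two patches share a
smaller patch `d`, which the general fiber also meets, so the irreducible pieces overlap and their
union is irreducible. -/
theorem holdsForGeneralPoint_isZariskiIrreducible_fiber [IsIntegral X] [IsIntegral Y]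
    [LocallyOfFiniteType (X ↘ SpecC)] [Smooth (Y ↘ SpecC)] [TopologicalSpace.NoetherianSpace X]
    (f : X ⟶ Y) [f.IsOver SpecC] [IsDominant f] (hf : IsZariskiIrreducible (fiberSquare f)) :
    HoldsForGeneralPoint Y (fun y => IsZariskiIrreducible (fiber f y)) := by
  obtain ⟨y₀⟩ : Nonempty Y := inferInstance
  obtain ⟨e, he, -, hsm⟩ := AffinePatch.exists_mem_isStandardSmooth ⊤ y₀ trivial
  have := e.isDomain ⟨_, he⟩
  have := isIntegrallyClosed_of_isStandardSmooth ℂ e.A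
  have heo : IsOpen (Set.range e.ι) := e.ι.isOpenEmbedding.isOpen_range
  have hex : ∀ x : f ⁻¹ᵁ e.ι.opensRange, ∃ c : AffinePatch X, x.1 ∈ Set.range c.ι ∧
      Set.range c.ι ⊆ f ⁻¹' Set.range e.ι := fun x =>
    AffinePatch.exists_mem (f ⁻¹ᵁ e.ι.opensRange) x.1 x.2
  choose c hc hce using hex
  obtain ⟨t, ht⟩ := (TopologicalSpace.NoetherianSpace.isCompact (f ⁻¹' Set.range e.ι)).elim_finite_subcover
    (fun x => Set.range (c x).ι) (fun x => (c x).ι.isOpenEmbedding.isOpen_range)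
    fun x hx => Set.mem_iUnion.mpr ⟨⟨x, hx⟩, hc _⟩
  have hex2 : ∀ x x' : f ⁻¹ᵁ e.ι.opensRange, ∃ d : AffinePatch X, (Set.range d.ι).Nonempty ∧
      Set.range d.ι ⊆ Set.range (c x).ι ∩ Set.range (c x').ι := fun x x' => by
    obtain ⟨z, hz⟩ := nonempty_preirreducible_inter (c x).ι.isOpenEmbedding.isOpen_range
      (c x').ι.isOpenEmbedding.isOpen_range ⟨_, hc x⟩ ⟨_, hc x'⟩
    obtain ⟨d, hzd, hd⟩ := AffinePatch.exists_mem ((c x).ι.opensRange ⊓ (c x').ι.opensRange) z hz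
    exact ⟨d, ⟨z, hzd⟩, hd⟩
  choose d hd hdc using hex2
  choose a ha hirr using fun x =>
    (c x).exists_forall_fiber_inter f hf e ⟨_, hc x⟩ (hce x)
  choose b hb hmeet using fun x x' =>
    (d x x').exists_forall_fiber_inter f hf e (hd x x')
      ((hdc x x').trans (Set.inter_subset_left.trans (hce x)))
  let g : e.A := ∏ x ∈ t, (a x * ∏ x' ∈ t, b x x')
  have hg : g ≠ 0 := Finset.prod_ne_zero_iff.mpr fun x _ =>
    mul_ne_zero (ha x) (Finset.prod_ne_zero_iff.mpr fun x' _ => hb x x')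
  have hgo : IsOpen (Set.range (e.basicOpen g).ι) := (e.basicOpen g).ι.isOpenEmbedding.isOpen_range
  let p₀ : PrimeSpectrum e.A := ⟨⊥, Ideal.isPrime_bot⟩
  have hp₀ : e.ι p₀ ∈ Set.range (e.basicOpen g).ι :=
    (e.mem_range_basicOpen g p₀).mpr fun h => hg (Ideal.mem_bot.mp h)
  refine ⟨(Set.range (e.basicOpen g).ι)ᶜ, hgo.isClosed_compl,
    topologicalKrullDim_lt_of_isClosed _ hgo.isClosed_compl fun h => ?_, fun y => ?_⟩
  · exact (h ▸ Set.mem_univ (e.ι p₀) : e.ι p₀ ∈ (Set.range (e.basicOpen g).ι)ᶜ) hp₀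
  contrapose!
  intro hy
  have hy : y.pt ∈ Set.range (e.basicOpen g).ι := not_not.mp hy
  obtain ⟨η, rfl⟩ := e.exists_point_eq y (e.range_basicOpen_subset g hy)
  rw [e.point_pt_mem_range_basicOpen, map_prod, Finset.prod_ne_zero_iff] at hy
  have hya : ∀ x ∈ t, η (a x) ≠ 0 := fun x hx => by
    have := hy x hx
    rw [map_mul] at this
    exact left_ne_zero_of_mul this
  have hyb : ∀ x ∈ t, ∀ x' ∈ t, η (b x x') ≠ 0 := fun x hx x' hx' => by
    have := hy x hx
    rw [map_mul, map_prod] at this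
    exact Finset.prod_ne_zero_iff.mp (right_ne_zero_of_mul this) x' hx'
  have hcov : ∀ p ∈ fiber f (e.point η), ∃ x ∈ t, p.pt ∈ Set.range (c x).ι := by
    intro p hp
    have h1 : f p.pt ∈ Set.range e.ι := by
      have h2 : (p.map f).pt ∈ Set.range e.ι := by
        rw [show p.map f = e.point η from hp]
        exact e.point_pt_mem_range η
      exact h2
    simpa using ht h1
  constructor
  · obtain ⟨_, hye, x, rfl⟩ := f.denseRange.inter_open_nonempty _ heo ⟨_, he⟩
    obtain ⟨x, hx, -⟩ : ∃ z ∈ t, x ∈ Set.range (c z).ι := by simpa using ht hye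
    obtain ⟨p, hp, -⟩ := (hirr x η (hya x hx)).1
    exact ⟨_, p, hp, rfl⟩
  · rintro U V hU hV ⟨_, ⟨p, hp, rfl⟩, hpU⟩ ⟨_, ⟨q, hq, rfl⟩, hqV⟩
    obtain ⟨x, hx, hpx⟩ := hcov p hp
    obtain ⟨x', hx', hqx'⟩ := hcov q hq
    obtain ⟨r, hr, hrd⟩ := (hmeet x x' η (hyb x hx x' hx')).1
    have hrc := hdc x x' hrd
    -- Irreducibility on patch `x` yields a fiber point of `U` that also lies in patch `x'`;
    -- irreducibility on `x'` then brings `U` and `V` together.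
    obtain ⟨s, hs, -, hsU, hsx'⟩ := (hirr x η (hya x hx)).2 U (Set.range (c x').ι) hU
      (c x').ι.isOpenEmbedding.isOpen_range ⟨p, hp, hpx, hpU⟩ ⟨r, hr, hrc.1, hrc.2⟩
    obtain ⟨z, hz, -, hzUV⟩ := (hirr x' η (hya x' hx')).2 U V hU hV ⟨s, hs, hsx', hsU⟩
      ⟨q, hq, hqx', hqV⟩
    exact ⟨_, ⟨z, hz, rfl⟩, hzUV⟩

end FiberProduct

end

theorem lemma3 (X' Y' : Scheme.{0}) [X'.Over FiberProduct.SpecC] [Y'.Over FiberProduct.SpecC]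
    [FiberProduct.IsSmoothIrreducibleVariety X'] [FiberProduct.IsSmoothIrreducibleVariety Y']
    (X : X'.Opens) (Y : Y'.Opens) (hX : (X : Set X').Nonempty)
    (f : X.toScheme ⟶ Y.toScheme) [f.IsOver FiberProduct.SpecC] [IsDominant f] :
    (FiberProduct.IsSubmersion f →
      ∃ m n d : ℕ, topologicalKrullDim X.toScheme = m ∧ topologicalKrullDim Y.toScheme = n ∧
        d + n = 2 * m ∧ FiberProduct.IsComplexSubmanifold d (FiberProduct.fiberSquare f)) ∧
    (FiberProduct.IsZariskiIrreducible (FiberProduct.fiberSquare f) →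
      FiberProduct.HoldsForGeneralPoint Y.toScheme
        (fun y => FiberProduct.IsZariskiIrreducible (FiberProduct.fiber f y))) := by
  have h1 := ‹FiberProduct.IsSmoothIrreducibleVariety X'›
  have h2 := ‹FiberProduct.IsSmoothIrreducibleVariety Y'›
  have : Nonempty X.toScheme := hX.to_subtype
  have : Nonempty Y.toScheme := this.map f
  have := h1.isIntegral
  have := h2.isIntegral
  have : IsIntegral X.toScheme := inferInstance
  have : IsIntegral Y.toScheme := isIntegral_of_isOpenImmersion Y.ι
  have : Smooth (X' ↘ FiberProduct.SpecC) := h1.smooth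
  have : Smooth (Y' ↘ FiberProduct.SpecC) := h2.smooth
  have : Smooth (X.toScheme ↘ FiberProduct.SpecC) := inferInstanceAs (Smooth (X.ι ≫ X' ↘ FiberProduct.SpecC))
  have : Smooth (Y.toScheme ↘ FiberProduct.SpecC) := inferInstanceAs (Smooth (Y.ι ≫ Y' ↘ FiberProduct.SpecC))
  have := h1.quasiCompact
  have : LocallyOfFiniteType (X' ↘ FiberProduct.SpecC) := inferInstance
  have : IsLocallyNoetherian X' := LocallyOfFiniteType.isLocallyNoetherian (X' ↘ FiberProduct.SpecC)
  have : CompactSpace X' := QuasiCompact.compactSpace_of_compactSpace (X' ↘ FiberProduct.SpecC)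
  have : IsNoetherian X' := {}
  have : TopologicalSpace.NoetherianSpace X' := inferInstance
  have : TopologicalSpace.NoetherianSpace X := TopologicalSpace.NoetherianSpace.set _
  constructor
  · intro hf
    obtain ⟨m, hm, -⟩ := FiberProduct.exists_topologicalKrullDim_eq (X := X.toScheme)
    obtain ⟨n, hn, -⟩ := FiberProduct.exists_topologicalKrullDim_eq (X := Y.toScheme)
    have h := FiberProduct.topologicalKrullDim_le_of_isDominant f
    rw [hm, hn] at h
    have h : n ≤ m := by exact_mod_cast h
    -- The subtraction is not truncated, since `n ≤ m`.
    exact ⟨m, n, 2 * m - n, hm, hn, by omega,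
      FiberProduct.isComplexSubmanifold_fiberSquare f hf hm hn (by omega)⟩
  · exact FiberProduct.holdsForGeneralPoint_isZariskiIrreducible_fiber f
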